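/- **Conventions.** Manifolds are smooth of dimension $4n$ with $n>1$. For a pseudo-Riemannian metric $g$ with Levi-Civita connection $\nabla$ and an orthogonal almost complex structure $A$, put $\Omega_A(X,Y)=g(AX,Y)$, $A\psi=-\psi\circ A$ for a 1-form $\psi$, and let the Lee form of $A$ be $\varphi(X)=\frac12\operatorname{trace}\{A(\nabla_\bullet A)X\}$. A hypercomplex structure is a triple $(I,J,K)$ of integrable almost complex structures with $I^2=J^2=K^2=IJK=-1$. $(g,I,J,K)$ is a *pseudo-hHqK* structure if $(I,J,K)$ is a $g$-orthogonal hypercomplex structure, the bundle $\operatorname{span}\{I,J,K\}\subset \operatorname{End}(TM)$ is $\nabla$-parallel, and the reduced scalar curvature $\nu=\frac{s}{4n(n+2)}$ ($s$ the scalar curvature) is a nonzero constant; it is *hHqK* if moreover $g$ is positive definite. In these cases $I,J,K$ have the same Lee form, called the Lee form of the structure. $(g_0,I,J,K)$ is *pseudo-hyper-Kähler* if $I,J,K$ are $g_0$-orthogonal almost complex structures satisfying these identities and parallel for the Levi-Civita connection of $g_0$; a *hyper-Kähler potential* is a smooth function $\mu$ with $\frac12 d(A\,d\mu)=\Omega^0_A$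 for $A=I,J,K$, where $\Omega^0_A(X,Y)=g_0(AX,Y)$. For a 1-form $\alpha$, $(1+L)\,\alpha\otimes\alpha=\alpha\otimes\alpha+I\alpha\otimes I\alpha+J\alpha\otimes J\alpha+K\alpha\otimes K\alpha$; $\operatorname{span}_{\mathbb H}\{X\}=\operatorname{span}\{X,IX,JX,KX\}$, and $\operatorname{span}_{\mathbb H}$ of a 1-form is that of its metric dual vector. **Theorem 2.** (i) Let $(g,I,J,K)$ be a hHqK structure on $M$ with closed Lee form $\varphi$ and reduced scalar curvature $\nu$, such that $g(\varphi,\varphi)+\nu\neq0$ everywhere. Then $$g_0=\frac1{\nu^2}\bigl(g(\varphi,\varphi)+\nu\bigr)\bigl((1+L)\,\varphi\otimes\varphi+\nu g\bigr)$$ is, with the same $(I,J,K)$, a pseudo-hyper-Kähler metric with hyper-Kähler potential $\mu=\frac2{\nu^2}(g(\varphi,\varphi)+\nu)$. It is positive definite where $\nu(g(\varphi,\varphi)+\nu)>0$ (hence everywhere if $\nu>0$), and where $\nu(g(\varphi,\varphi)+\nu)<0$ it has signature $(4,4(n-1))$ and is positive definite on $\operatorname{span}_{\mathbb H}\{\varphi\}$.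 (ii) Let $(g_0,I,J,K)$ be a pseudo-hyper-Kähler structure on $M$ with hyper-Kähler potential $\mu$. Then for each real $p\neq0$, on the open submanifold $U_p=\{p\,g_0(d\mu,d\mu)+1\neq0\}$, $$g_p=-\frac{p}{(p\,g_0(d\mu,d\mu)+1)^2}(1+L)\,d\mu\otimes d\mu+\frac1{p\,g_0(d\mu,d\mu)+1}\,g_0$$ forms with $(I,J,K)$ a pseudo-hHqK structure with Lee form $\varphi_p=-d\ln|p\,g_0(d\mu,d\mu)+1|$ and reduced scalar curvature $4p$. The metric $g_p$ is positive definite where $p\,g_0(d\mu,d\mu)+1>0$ and $g_0$ is positive definite, and also where $p\,g_0(d\mu,d\mu)+1<0$ and $g_0$ has signature $(4,4(n-1))$ and is positive definite on $\operatorname{span}_{\mathbb H}\{d\mu\}$. (iii) If $g_0,\mu$ are constructed from $g$ as in (i), then $\frac\nu4 g_0(d\mu,d\mu)+1\ne0$ everywhere and the metric $g_{\nu/4}$ constructed from $g_0,\mu$ as in (ii) is $g$. Conversely, if $g_p$ is constructed from $g_0,\mu$ as in (ii), then $g_p(\varphi_p,\varphi_p)+4p\neq0$ on $U_p$, and the metric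 constructed from $g_p$, with $\varphi_p$ and $\nu=4p$, by the formula of (i) is $g_0$ on $U_p$. -/

import Mathlib

set_option maxSynthPendingDepth 3

open scoped Manifold ContDiff
open Set

noncomputable section

namespace QuaternionicGeometry

/-! ## Tensor calculus in a coordinate domain of a finite-dimensional vector space `E` -/

section Coordinates

variable {E : Type*} [NormedAddCommGroup E] [NormedSpace ℝ E]

/-- The exterior derivative of a `1`-form `α`:
`dα(u,v) = u(α(v)) - v(α(u))` for constant vector fields `u`, `v`. -/
def extDeriv₁ (α : E → E →L[ℝ] ℝ) (y u v : E) : ℝ :=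
  fderiv ℝ α y u v - fderiv ℝ α y v u

/-- The Nijenhuis tensor `[Au,Av] - A[Au,v] - A[u,Av] - [u,v]` of a field `A` of almost complex
structures, evaluated on the constant vector fields `u`, `v`. -/
def nijenhuis (A : E → E →L[ℝ] E) (y u v : E) : E :=
  (fderiv ℝ A y (A y u) v - fderiv ℝ A y (A y v) u)
    + A y (fderiv ℝ A y v u) - A y (fderiv ℝ A y u v)

/-- The Christoffel symbols of the first kind,
`(u, v, w) ↦ (1/2) (u(g(v,w)) + v(g(u,w)) - w(g(u,v)))` for constant vector fields. -/
def christoffelLower (g : E → E →L[ℝ] E →L[ℝ] ℝ) (y : E) : E →L[ℝ] E →L[ℝ] E →L[ℝ] ℝ :=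
  let D : E →L[ℝ] E →L[ℝ] E →L[ℝ] ℝ := fderiv ℝ g y
  let D' : E →L[ℝ] E →L[ℝ] E →L[ℝ] ℝ :=
    (ContinuousLinearMap.flipₗᵢ ℝ E E ℝ).toContinuousLinearEquiv.toContinuousLinearMap ∘L D.flip
  (1 / 2 : ℝ) • (D + D.flip - D')

theorem christoffelLower_apply (g : E → E →L[ℝ] E →L[ℝ] ℝ) (y u v w : E) :
    christoffelLower g y u v w =
      (1 / 2) * (fderiv ℝ g y u v w + fderiv ℝ g y v u w - fderiv ℝ g y w u v) := by
  simp [christoffelLower]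

/-- The Christoffel symbols of the second kind: `Γ(u, v) = ∇_u v` for constant vector fields,
where `∇` is the Levi-Civita connection of `g`. -/
def christoffel (g : E → E →L[ℝ] E →L[ℝ] ℝ) (y : E) : E →L[ℝ] E →L[ℝ] E :=
  (ContinuousLinearMap.postcomp E (g y).inverse) ∘L christoffelLower g y

theorem christoffel_apply (g : E → E →L[ℝ] E →L[ℝ] ℝ) (y u v : E) :
    christoffel g y u v = (g y).inverse (christoffelLower g y u v) := rfl

/-- The Levi-Civita covariant derivative of a field of endomorphisms `A`, as the map
`u ↦ ∇_u A`. -/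
def covDerivEnd (g : E → E →L[ℝ] E →L[ℝ] ℝ) (A : E → E →L[ℝ] E) (y : E) :
    E →L[ℝ] E →L[ℝ] E :=
  fderiv ℝ A y + (ContinuousLinearMap.precomp E (A y)) ∘L christoffel g y
    - (ContinuousLinearMap.postcomp E (A y)) ∘L christoffel g y

theorem covDerivEnd_apply (g : E → E →L[ℝ] E →L[ℝ] ℝ) (A : E → E →L[ℝ] E) (y u v : E) :
    covDerivEnd g A y u v =
      fderiv ℝ A y u v + christoffel g y u (A y v) - A y (christoffel g y u v) := by
  simp [covDerivEnd]

/-- The curvature `R(u,v)w = ∇_u ∇_v w - ∇_v ∇_u w` for constant vector fields `u`, `v`, `w`. -/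
def riemann (g : E → E →L[ℝ] E →L[ℝ] ℝ) (y u v w : E) : E :=
  fderiv ℝ (christoffel g) y u v w - fderiv ℝ (christoffel g) y v u w
    + christoffel g y u (christoffel g y v w) - christoffel g y v (christoffel g y u w)

/-- The Ricci tensor `Ric(v,w) = trace (u ↦ R(u,v)w)`. -/
def ricci (g : E → E →L[ℝ] E →L[ℝ] ℝ) (y : E) : E →ₗ[ℝ] E →ₗ[ℝ] ℝ :=
  LinearMap.mk₂ ℝ
    (fun v w => LinearMap.trace ℝ E
      { toFun := fun u => riemann g y u v w
        map_add' := fun a b => by simp [riemann]; abel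
        map_smul' := fun c a => by simp [riemann, smul_sub, smul_add] })
    (fun v v' w => by
      rw [← map_add]; congr 1; ext u; simp [riemann]; abel)
    (fun c v w => by
      rw [← map_smul]; congr 1; ext u; simp [riemann, smul_sub, smul_add])
    (fun v w w' => by
      rw [← map_add]; congr 1; ext u; simp [riemann]; abel)
    (fun c v w => by
      rw [← map_smul]; congr 1; ext u; simp [riemann, smul_sub, smul_add])

/-- The scalar curvature: the trace of the Ricci tensor with respect to `g`. -/
def scalarCurvature [FiniteDimensional ℝ E] (g : E → E →L[ℝ] E →L[ℝ] ℝ) (y : E) : ℝ :=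
  LinearMap.trace ℝ E
    (((g y).inverse : (E →L[ℝ] ℝ) →ₗ[ℝ] E) ∘ₗ
      ((LinearMap.toContinuousLinearMap : (E →ₗ[ℝ] ℝ) ≃ₗ[ℝ] (E →L[ℝ] ℝ)) :
        (E →ₗ[ℝ] ℝ) →ₗ[ℝ] (E →L[ℝ] ℝ)) ∘ₗ ricci g y)

/-- The Lee form `φ(v) = (1/2) trace (w ↦ A (∇_w A) v)` of `A` with respect to `g`. -/
def leeForm (g : E → E →L[ℝ] E →L[ℝ] ℝ) (A : E → E →L[ℝ] E) (y v : E) : ℝ :=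
  (1 / 2) * LinearMap.trace ℝ E (((A y) ∘L (covDerivEnd g A y).flip v : E →L[ℝ] E) : E →ₗ[ℝ] E)

end Coordinates

/-! ## Tensor fields on a manifold and their coordinate expressions -/

section Manifold

variable (E : Type*) [NormedAddCommGroup E] [NormedSpace ℝ E]
  (M : Type*) [TopologicalSpace M] [ChartedSpace E M]

/-- `1`-forms on `M` (no regularity included). -/
abbrev OneForm := ∀ x : M, TangentSpace 𝓘(ℝ, E) x →L[ℝ] ℝ

/-- Fields of bilinear forms on the tangent spaces of `M` (no regularity included). -/
abbrev BilinField :=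
  ∀ x : M, TangentSpace 𝓘(ℝ, E) x →L[ℝ] TangentSpace 𝓘(ℝ, E) x →L[ℝ] ℝ

/-- Fields of endomorphisms of the tangent spaces of `M` (no regularity included). -/
abbrev EndField := ∀ x : M, TangentSpace 𝓘(ℝ, E) x →L[ℝ] TangentSpace 𝓘(ℝ, E) x

variable {E M}

/-- The differential of the inverse of the chart `e`, at the coordinate point `y`. -/
def dChartSymm (e : OpenPartialHomeomorph M E) (y : E) :
    E →L[ℝ] TangentSpace 𝓘(ℝ, E) (e.symm y) :=
  mfderiv 𝓘(ℝ, E) 𝓘(ℝ, E) e.symm y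

/-- The differential of the chart `e`, at the point with coordinates `y`. -/
def dChart (e : OpenPartialHomeomorph M E) (y : E) :
    TangentSpace 𝓘(ℝ, E) (e.symm y) →L[ℝ] E :=
  mfderiv 𝓘(ℝ, E) 𝓘(ℝ, E) e (e.symm y)

/-- Coordinate expression of a `1`-form in the chart `e` (meaningful on `e.target`). -/
def OneForm.inChart (α : OneForm E M) (e : OpenPartialHomeomorph M E) (y : E) : E →L[ℝ] ℝ :=
  (α (e.symm y)) ∘L dChartSymm e y

/-- Coordinate expression of a field of bilinear forms: `(u, v) ↦ b(De⁻¹ u, De⁻¹ v)`. -/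
def BilinField.inChart (b : BilinField E M) (e : OpenPartialHomeomorph M E) (y : E) :
    E →L[ℝ] E →L[ℝ] ℝ :=
  (ContinuousLinearMap.precomp ℝ (dChartSymm e y)) ∘L (b (e.symm y)) ∘L dChartSymm e y

/-- Coordinate expression of a field of endomorphisms: `De ∘ A ∘ De⁻¹`. -/
def EndField.inChart (A : EndField E M) (e : OpenPartialHomeomorph M E) (y : E) : E →L[ℝ] E :=
  dChart e y ∘L (A (e.symm y)) ∘L dChartSymm e y

/-- `P e y` holds for every chart `e` of the smooth structure of `M` and every coordinate point
`y` of the part of the open set `U ⊆ M` in the domain of `e`. -/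
def InChartsOn (U : Set M) (P : OpenPartialHomeomorph M E → E → Prop) : Prop :=
  ∀ e ∈ IsManifold.maximalAtlas 𝓘(ℝ, E) ∞ M, ∀ y ∈ e.target ∩ e.symm ⁻¹' U, P e y

/-- The coordinate expressions `T e`, over all charts `e` of the smooth structure, are smooth
on the open set `U ⊆ M`. -/
def SmoothInChartsOn {F : Type*} [NormedAddCommGroup F] [NormedSpace ℝ F] (U : Set M)
    (T : OpenPartialHomeomorph M E → E → F) : Prop :=
  ∀ e ∈ IsManifold.maximalAtlas 𝓘(ℝ, E) ∞ M, ContDiffOn ℝ ∞ (T e) (e.target ∩ e.symm ⁻¹' U)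

/-! ### Pointwise algebra -/

/-- The differential of a function. -/
def differential (f : M → ℝ) : OneForm E M := fun x => mfderiv 𝓘(ℝ, E) 𝓘(ℝ, ℝ) f x

/-- The vector `φ^#` dual to the `1`-form `φ`: `g(φ^#, ·) = φ` (`g` nondegenerate). -/
def sharp (g : BilinField E M) (φ : OneForm E M) (x : M) : TangentSpace 𝓘(ℝ, E) x :=
  (g x).inverse (φ x)

/-- `g(φ,φ)` for a `1`-form `φ`, which is `g(φ^#,φ^#) = φ(φ^#)`. -/
def normSq (g : BilinField E M) (φ : OneForm E M) (x : M) : ℝ := φ x (sharp g φ x)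

/-- The action of an endomorphism on `1`-forms: `Aψ = -ψ ∘ A`. -/
def actOneForm (A : EndField E M) (ψ : OneForm E M) : OneForm E M := fun x => -((ψ x) ∘L (A x))

/-- The tensor square `φ ⊗ φ`. -/
def tensorSq (φ : OneForm E M) : BilinField E M :=
  fun x => ContinuousLinearMap.smulRight (φ x) (φ x)

/-- `(X, Y) ↦ b(AX, AY)`, the action of `A ⊗ A` on bilinear forms. -/
def actBilin (A : EndField E M) (b : BilinField E M) : BilinField E M :=
  fun x => (ContinuousLinearMap.precomp ℝ (A x)) ∘L (b x) ∘L (A x)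

/-- The operator `1 + L`, with `L = I ⊗ I + J ⊗ J + K ⊗ K`, on bilinear forms. -/
def onePlusL (I J K : EndField E M) (b : BilinField E M) : BilinField E M :=
  fun x => b x + (actBilin I b x + actBilin J b x + actBilin K b x)

/-- The Kähler form `Ω_A(X, Y) = g(AX, Y)`. -/
def kahlerForm (g : BilinField E M) (A : EndField E M) : BilinField E M :=
  fun x => (g x) ∘L (A x)

/-- The quaternionic span `span {X, IX, JX, KX}` of a tangent vector `X`. -/
def quaternionicSpan (I J K : EndField E M) (x : M) (X : TangentSpace 𝓘(ℝ, E) x) :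
    Submodule ℝ (TangentSpace 𝓘(ℝ, E) x) :=
  Submodule.span ℝ {X, I x X, J x X, K x X}

/-- `g` is positive definite at `x`. -/
def PosDefAt (g : BilinField E M) (x : M) : Prop :=
  ∀ u : TangentSpace 𝓘(ℝ, E) x, u ≠ 0 → 0 < g x u u

/-- `g` is positive definite on the subspace `V` of the tangent space at `x`. -/
def PosDefAtOn (g : BilinField E M) (x : M) (V : Submodule ℝ (TangentSpace 𝓘(ℝ, E) x)) : Prop :=
  ∀ u ∈ V, u ≠ 0 → 0 < g x u u

/-- `g` has signature `(p, q)` at `x`: `p` positive and `q` negative directions. -/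
def HasSignatureAt (g : BilinField E M) (x : M) (p q : ℕ) : Prop :=
  sigPos (LinearMap.BilinMap.toQuadraticMap (g x).toLinearMap₁₂) = p ∧
    sigNeg (LinearMap.BilinMap.toQuadraticMap (g x).toLinearMap₁₂) = q

/-! ### Structures on an open subset `U` of `M` -/

/-- `g` is a (smooth) pseudo-Riemannian metric on `U`. -/
structure IsPseudoRiemannianOn (U : Set M) (g : BilinField E M) : Prop where
  smooth : SmoothInChartsOn U (fun e => g.inChart e)
  symm : ∀ x ∈ U, ∀ u v, g x u v = g x v u
  nondegenerate : ∀ x ∈ U, ∀ u, (∀ v, g x u v = 0) → u = 0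

/-- `(I, J, K)` is a (smooth) almost hypercomplex structure on `U`. -/
structure IsAlmostHypercomplexOn (U : Set M) (I J K : EndField E M) : Prop where
  smooth_I : SmoothInChartsOn U (fun e => I.inChart e)
  smooth_J : SmoothInChartsOn U (fun e => J.inChart e)
  smooth_K : SmoothInChartsOn U (fun e => K.inChart e)
  sq_I : ∀ x ∈ U, ∀ u, I x (I x u) = -u
  sq_J : ∀ x ∈ U, ∀ u, J x (J x u) = -u
  sq_K : ∀ x ∈ U, ∀ u, K x (K x u) = -u
  mul_IJK : ∀ x ∈ U, ∀ u, I x (J x (K x u)) = -u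

/-- The almost complex structure `A` is integrable on `U`: its Nijenhuis tensor vanishes. -/
def IsIntegrableOn (U : Set M) (A : EndField E M) : Prop :=
  InChartsOn U fun e y => ∀ u v, nijenhuis (A.inChart e) y u v = 0

/-- `(I, J, K)` is a hypercomplex structure on `U`. -/
structure IsHypercomplexOn (U : Set M) (I J K : EndField E M) : Prop
    extends IsAlmostHypercomplexOn U I J K where
  integrable_I : IsIntegrableOn U I
  integrable_J : IsIntegrableOn U J
  integrable_K : IsIntegrableOn U K

/-- `A` is orthogonal with respect to `g` on `U`. -/
def IsOrthogonalOn (U : Set M) (g : BilinField E M) (A : EndField E M) : Prop :=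
  ∀ x ∈ U, ∀ u v, g x (A x u) (A x v) = g x u v

/-- `(g, I, J, K)` is an almost hyper-Hermitian structure on `U`, with `g` pseudo-Riemannian. -/
structure IsPseudoAlmostHyperHermitianOn (U : Set M) (g : BilinField E M)
    (I J K : EndField E M) : Prop where
  metric : IsPseudoRiemannianOn U g
  almostHypercomplex : IsAlmostHypercomplexOn U I J K
  orthogonal_I : IsOrthogonalOn U g I
  orthogonal_J : IsOrthogonalOn U g J
  orthogonal_K : IsOrthogonalOn U g K

/-- `A` is parallel on `U` for the Levi-Civita connection of `g`. -/
def IsParallelOn (U : Set M) (g : BilinField E M) (A : EndField E M) : Prop :=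
  InChartsOn U fun e y => ∀ u, covDerivEnd (g.inChart e) (A.inChart e) y u = 0

/-- `(g, I, J, K)` is a pseudo-hyper-Kähler structure on `U`. -/
structure IsPseudoHyperKahlerOn (U : Set M) (g : BilinField E M) (I J K : EndField E M) : Prop
    extends IsPseudoAlmostHyperHermitianOn U g I J K where
  parallel_I : IsParallelOn U g I
  parallel_J : IsParallelOn U g J
  parallel_K : IsParallelOn U g K

/-- The subbundle `span {I, J, K}` of the bundle of endomorphisms of the tangent bundle is
parallel on `U` for the Levi-Civita connection of `g`. -/
def IsParallelSpanOn (U : Set M) (g : BilinField E M) (I J K : EndField E M) : Prop :=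
  InChartsOn U fun e y =>
    ∀ A ∈ ({I, J, K} : Set (EndField E M)), ∀ u,
      covDerivEnd (g.inChart e) (A.inChart e) y u
        ∈ Submodule.span ℝ {I.inChart e y, J.inChart e y, K.inChart e y}

/-- The scalar curvature of `g` on `U` is the constant `4n(n+2)ν`, that is, the reduced scalar
curvature of the `4n`-dimensional `g` is `ν`. -/
def HasReducedScalarCurvatureOn [FiniteDimensional ℝ E] (n : ℕ) (U : Set M) (g : BilinField E M)
    (ν : ℝ) : Prop :=
  InChartsOn U fun e y => scalarCurvature (g.inChart e) y = 4 * n * (n + 2) * ν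

/-- `(g, I, J, K)` is, on `U`, a pseudo-hyper-Hermitian quaternionic Kähler structure of
dimension `4n`, `n > 1`, with reduced scalar curvature `ν ≠ 0`: the pseudo-Riemannian metric `g`
is quaternionic Kähler for the subbundle `span {I, J, K}`, and `(I, J, K)` is hypercomplex. -/
structure IsPseudoHHqKOn [FiniteDimensional ℝ E] (n : ℕ) (U : Set M) (g : BilinField E M)
    (I J K : EndField E M) (ν : ℝ) : Prop
    extends IsPseudoAlmostHyperHermitianOn U g I J K where
  one_lt : 1 < n
  finrank_eq : Module.finrank ℝ E = 4 * n
  hypercomplex : IsHypercomplexOn U I J K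
  parallel : IsParallelSpanOn U g I J K
  reducedScalarCurvature : HasReducedScalarCurvatureOn n U g ν
  ne_zero : ν ≠ 0

/-- `(g, I, J, K)` is, on `U`, a hyper-Hermitian quaternionic Kähler (hHqK) structure: as above,
with `g` Riemannian. -/
structure IsHHqKOn [FiniteDimensional ℝ E] (n : ℕ) (U : Set M) (g : BilinField E M)
    (I J K : EndField E M) (ν : ℝ) : Prop
    extends IsPseudoHHqKOn n U g I J K ν where
  posDef : ∀ x ∈ U, PosDefAt g x

/-- `φ` is the Lee form of `A` with respect to `g` on `U`. -/
def IsLeeFormOn (U : Set M) (g : BilinField E M) (A : EndField E M) (φ : OneForm E M) : Prop :=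
  InChartsOn U fun e y => ∀ v, φ.inChart e y v = leeForm (g.inChart e) (A.inChart e) y v

/-- The `1`-form `φ` is closed on `U`. -/
def IsClosedFormOn (U : Set M) (φ : OneForm E M) : Prop :=
  InChartsOn U fun e y => ∀ u v, extDeriv₁ (φ.inChart e) y u v = 0

/-- `(1/2) d A dμ = Ω_A` on `U`: the condition on a Kähler potential `μ` of `(g, A)`. -/
def IsKahlerPotentialOn (U : Set M) (g : BilinField E M) (A : EndField E M) (μ : M → ℝ) : Prop :=
  ContMDiffOn 𝓘(ℝ, E) 𝓘(ℝ, ℝ) ∞ μ U ∧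
  InChartsOn U fun e y => ∀ u v,
    (1 / 2) * extDeriv₁ ((actOneForm A (differential μ)).inChart e) y u v
      = (kahlerForm g A).inChart e y u v

/-- `μ` is a hyper-Kähler potential of the pseudo-hyper-Kähler structure `(g, I, J, K)`. -/
def IsHyperKahlerPotentialOn (U : Set M) (g : BilinField E M) (I J K : EndField E M)
    (μ : M → ℝ) : Prop :=
  IsKahlerPotentialOn U g I μ ∧ IsKahlerPotentialOn U g J μ ∧ IsKahlerPotentialOn U g K μ

/-! ### The two constructions -/

/-- `g₀ = ν⁻² (g(φ,φ) + ν) ((1 + L) φ ⊗ φ + ν g)`. -/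
def toHyperKahler (ν : ℝ) (g : BilinField E M) (I J K : EndField E M) (φ : OneForm E M) :
    BilinField E M :=
  fun x => (1 / ν ^ 2 * (normSq g φ x + ν)) • (onePlusL I J K (tensorSq φ) x + ν • g x)

/-- `μ = 2 ν⁻² (g(φ,φ) + ν)`. -/
def toPotential (ν : ℝ) (g : BilinField E M) (φ : OneForm E M) : M → ℝ :=
  fun x => 2 / ν ^ 2 * (normSq g φ x + ν)

/-- The function `p g₀(dμ,dμ) + 1`. -/
def denom (p : ℝ) (g₀ : BilinField E M) (μ : M → ℝ) : M → ℝ :=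
  fun x => p * normSq g₀ (differential μ) x + 1

/-- The set where `p g₀(dμ,dμ) + 1 ≠ 0`, on which `g_p` is defined. -/
def domainSet (p : ℝ) (g₀ : BilinField E M) (μ : M → ℝ) : Set M := {x | denom p g₀ μ x ≠ 0}

/-- `g_p = - p (p g₀(dμ,dμ) + 1)⁻² (1 + L) dμ ⊗ dμ + (p g₀(dμ,dμ) + 1)⁻¹ g₀`. -/
def toHHqK (p : ℝ) (g₀ : BilinField E M) (I J K : EndField E M) (μ : M → ℝ) :
    BilinField E M :=
  fun x => (-(p / denom p g₀ μ x ^ 2)) • onePlusL I J K (tensorSq (differential μ)) x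
    + (1 / denom p g₀ μ x) • g₀ x

/-- `φ_p = - d ln |p g₀(dμ,dμ) + 1|`. -/
def toLeeForm (p : ℝ) (g₀ : BilinField E M) (μ : M → ℝ) : OneForm E M :=
  fun x => -(differential (E := E) (fun z => Real.log |denom p g₀ μ z|) x)

end Manifold

end QuaternionicGeometry

end

/-!
# Closed Lee forms on quaternionic Kähler manifolds and hyper-Kähler potentials

Everything is checked in charts, where a structure is a triple of fields on an open subset of a
vector space `E` and its Levi-Civita connection is the field of Christoffel symbols.

*Lee form and Obata connection.* If `∇` preserves `span {I, J, K}` and `I`, `J`, `K` are integrable,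
the vanishing of the Nijenhuis tensors forces `∇_u I = -φ(Ku) J + φ(Ju) K` and its cyclic
permutations, with `φ` the common Lee form (`IsLeeConnectionOn`). Hence `∇ + S^φ` makes `I`, `J`,
`K` parallel, where the symmetric tensor `S^φ` is `quatShift`, and `∇ + S^φ` is the torsion-free
hypercomplex (Obata) connection. The two metric constructions differ by exactly such a shift.

*From `g` to `g₀`.* The curvature of `∇` acts on `span {I, J, K}` through three `2`-forms. For
`n > 1` the contracted Bianchi identity makes them the Kähler forms times the reduced scalar
curvature, `ν Ω_A` (`IsQuaternionicCurvature.exists_const`). On the other hand these forms can be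
written through `φ` and `∇φ`, by differentiating the formula for `∇I`. When `φ` is closed, the
comparison determines `∇φ` completely: `∇φ` is a combination of `g`, `φ ⊗ φ` and the `Aφ ⊗ Aφ`.
It follows that `d(g(φ,φ) + ν) = -(g(φ,φ) + ν) φ`, that `g₀` is parallel for `∇ + S^φ`, and that
the Hessian of `μ` for this connection is `g₀`. So `∇ + S^φ` is the Levi-Civita connection of `g₀`,
`I`, `J`, `K` are parallel for it, and a Hessian equal to `g₀` is the condition on a hyper-Kähler
potential.

*From `g₀` to `g_p`.* The three conditions `½ d(A dμ) = Ω⁰_A` say that the Hessian of `μ` is `g₀`: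
they make the symmetric form `Hess μ - g₀` anti-invariant under each of `I`, `J` and `K`, and
`K = IJ`. Therefore `d(p g₀(dμ,dμ) + 1) = 2p dμ`, so that `φ_p = -2p (p g₀(dμ,dμ) + 1)⁻¹ dμ`, and a
direct computation shows that `g_p` is parallel for `∇⁰ - S^{φ_p}`. This connection preserves the
span of `I`, `J`, `K`, with Lee form `φ_p`. The resulting curvature `2`-forms are `4p Ω_A`, and the
contracted Bianchi identity gives the Ricci tensor `4p (n + 2) g_p`, hence the scalar curvature.

*Pointwise algebra.* On the quaternionic line of `φ^♯` the form `(1 + L) φ ⊗ φ` is `g(φ,φ) g`, and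
on the orthogonal complement of that line it vanishes. This gives all statements about signatures,
and also the two round trips, because `dμ` is a multiple of `φ` in the first construction and `φ_p` a
multiple of `dμ` in the second.
-/

noncomputable section

namespace QuaternionicGeometry

/-! ### Quaternionic linear algebra -/

section Pointwise

variable {E : Type*} [NormedAddCommGroup E] [NormedSpace ℝ E]

/-- `(I, J, K)` satisfies the multiplication table of the imaginary quaternions. -/
structure IsQuaternionic (I J K : E →L[ℝ] E) : Prop where
  II : ∀ u, I (I u) = -u
  JJ : ∀ u, J (J u) = -u
  KK : ∀ u, K (K u) = -u
  IJ : ∀ u, I (J u) = K u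
  JK : ∀ u, J (K u) = I u
  KI : ∀ u, K (I u) = J u
  JI : ∀ u, J (I u) = -K u
  KJ : ∀ u, K (J u) = -I u
  IK : ∀ u, I (K u) = -J u

theorem IsQuaternionic.of_mul {I J K : E →L[ℝ] E} (hI : ∀ u, I (I u) = -u)
    (hJ : ∀ u, J (J u) = -u) (hK : ∀ u, K (K u) = -u) (h : ∀ u, I (J (K u)) = -u) :
    IsQuaternionic I J K := by
  have hJK : ∀ u, J (K u) = I u := fun u => by
    have := congrArg I (h u)
    rw [hI, map_neg] at this
    exact neg_injective this
  have hIJ : ∀ u, I (J u) = K u := fun u => by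
    have := h (K u)
    rw [hK] at this
    simpa using this
  have hKI : ∀ u, K (I u) = J u := fun u => by
    have h1 := hK (J u)
    rw [← hIJ (J u), hJ, map_neg, map_neg] at h1
    exact neg_injective h1
  have hKJ : ∀ u, K (J u) = -I u := fun u => by
    have h1 := congrArg J (hJK (J u))
    rw [hJ, hIJ, hJK] at h1
    exact neg_eq_iff_eq_neg.1 h1
  refine ⟨hI, hJ, hK, hIJ, hJK, hKI, fun u => ?_, hKJ, fun u => ?_⟩
  · rw [← hJK, hJ]
  · rw [← hIJ, hI]

theorem IsQuaternionic.cycle {I J K : E →L[ℝ] E} (h : IsQuaternionic I J K) :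
    IsQuaternionic J K I :=
  ⟨h.JJ, h.KK, h.II, h.JK, h.KI, h.IJ, h.KJ, h.IK, h.JI⟩

/-- `g` is a nondegenerate symmetric bilinear form for which the quaternionic triple `(I, J, K)`
is orthogonal. -/
structure IsQuaternionHermitian (g : E →L[ℝ] E →L[ℝ] ℝ) (I J K : E →L[ℝ] E) : Prop where
  quat : IsQuaternionic I J K
  symm : ∀ u v, g u v = g v u
  nondeg : ∀ u, (∀ v, g u v = 0) → u = 0
  orthI : ∀ u v, g (I u) (I v) = g u v
  orthJ : ∀ u v, g (J u) (J v) = g u v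
  orthK : ∀ u v, g (K u) (K v) = g u v

namespace IsQuaternionHermitian

variable {g : E →L[ℝ] E →L[ℝ] ℝ} {I J K : E →L[ℝ] E}

theorem cycle (h : IsQuaternionHermitian g I J K) : IsQuaternionHermitian g J K I :=
  ⟨h.quat.cycle, h.symm, h.nondeg, h.orthJ, h.orthK, h.orthI⟩

theorem skewI (h : IsQuaternionHermitian g I J K) (u v : E) : g (I u) v = -g u (I v) := by
  rw [← h.orthI u (I v), h.quat.II]; simp

theorem skewJ (h : IsQuaternionHermitian g I J K) (u v : E) : g (J u) v = -g u (J v) :=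
  h.cycle.skewI u v

theorem skewK (h : IsQuaternionHermitian g I J K) (u v : E) : g (K u) v = -g u (K v) :=
  h.cycle.cycle.skewI u v

theorem apply_I_self (h : IsQuaternionHermitian g I J K) (u : E) : g u (I u) = 0 := by
  have h1 := h.skewI u u
  rw [h.symm] at h1
  linarith

end IsQuaternionHermitian

section Musical

variable [FiniteDimensional ℝ E] {b : E →L[ℝ] E →L[ℝ] ℝ}

theorem isInvertible_of_nondegenerate (hb : ∀ u, (∀ v, b u v = 0) → u = 0) :
    b.IsInvertible := by
  have hinj : Function.Injective (b : E →ₗ[ℝ] (E →L[ℝ] ℝ)) := by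
    refine (injective_iff_map_eq_zero _).2 fun u hu => hb u fun v => ?_
    change (b : E →ₗ[ℝ] (E →L[ℝ] ℝ)) u v = 0
    rw [hu]; rfl
  have hdim : Module.finrank ℝ E = Module.finrank ℝ (E →L[ℝ] ℝ) := by
    rw [← (LinearMap.toContinuousLinearMap : (E →ₗ[ℝ] ℝ) ≃ₗ[ℝ] (E →L[ℝ] ℝ)).finrank_eq]
    exact (Subspace.dual_finrank_eq (K := ℝ) (V := E)).symm
  let e := (LinearEquiv.ofInjectiveOfFinrankEq (b : E →ₗ[ℝ] (E →L[ℝ] ℝ)) hinj hdim)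
  refine ⟨e.toContinuousLinearEquiv, ?_⟩
  ext u v
  rfl

theorem apply_inverse (hb : ∀ u, (∀ v, b u v = 0) → u = 0) (φ : E →L[ℝ] ℝ) :
    b (b.inverse φ) = φ := by
  obtain ⟨e, he⟩ := isInvertible_of_nondegenerate hb
  rw [← he, ContinuousLinearMap.inverse_equiv]
  simp

theorem inverse_apply_eq (hb : ∀ u, (∀ v, b u v = 0) → u = 0) {φ : E →L[ℝ] ℝ} {ξ : E}
    (h : ∀ v, b ξ v = φ v) : b.inverse φ = ξ := by
  have h1 : b (b.inverse φ - ξ) = 0 := by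
    ext v; rw [map_sub, apply_inverse hb]; simp [h]
  exact sub_eq_zero.1 (hb _ fun v => by rw [h1]; rfl)

omit [FiniteDimensional ℝ E] in
theorem eq_of_nondegenerate (hb : ∀ u, (∀ v, b u v = 0) → u = 0) {u v : E}
    (h : ∀ w, b u w = b v w) : u = v :=
  sub_eq_zero.1 (hb _ fun w => by simp [h])

/-- Adjoint endomorphisms have the same trace. -/
theorem trace_eq_of_adjoint (hb : ∀ u, (∀ v, b u v = 0) → u = 0) {P Q : E →ₗ[ℝ] E}
    (h : ∀ u v, b (P u) v = b u (Q v)) : LinearMap.trace ℝ E P = LinearMap.trace ℝ E Q := by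
  obtain ⟨e, he⟩ := isInvertible_of_nondegenerate hb
  let e' : E ≃ₗ[ℝ] Module.Dual ℝ E :=
    e.toLinearEquiv ≪≫ₗ (LinearMap.toContinuousLinearMap : (E →ₗ[ℝ] ℝ) ≃ₗ[ℝ] (E →L[ℝ] ℝ)).symm
  have he' : ∀ u v, e' u v = b u v := fun u v => by rw [← he]; rfl
  rw [← LinearMap.trace_transpose' (R := ℝ) Q, ← LinearMap.trace_conj' P e']
  congr 1
  ext φ v
  obtain ⟨u, rfl⟩ := e'.surjective φ
  simp [LinearEquiv.conj_apply, he', h, Module.Dual.transpose_apply]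

end Musical

section Trace

variable [FiniteDimensional ℝ E]

theorem trace_rankOne (f : E →L[ℝ] ℝ) (x : E) :
    LinearMap.trace ℝ E (f.smulRight x : E →L[ℝ] E) = f x := by
  simp

omit [FiniteDimensional ℝ E] in
theorem trace_comp_comm_clm (f h : E →L[ℝ] E) :
    LinearMap.trace ℝ E (f ∘L h : E →L[ℝ] E) = LinearMap.trace ℝ E (h ∘L f : E →L[ℝ] E) :=
  LinearMap.trace_mul_comm ℝ (f : E →ₗ[ℝ] E) (h : E →ₗ[ℝ] E)

omit [FiniteDimensional ℝ E] in
theorem IsQuaternionic.trace_eq_zero {I J K : E →L[ℝ] E} (h : IsQuaternionic I J K) :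
    LinearMap.trace ℝ E (I : E →ₗ[ℝ] E) = 0 := by
  have h1 := trace_comp_comm_clm J K
  have h2 : J ∘L K = I := by ext u; exact h.JK u
  have h3 : K ∘L J = -I := by ext u; exact h.KJ u
  rw [h2, h3] at h1
  simp only [ContinuousLinearMap.toLinearMap_neg, map_neg] at h1
  linarith

end Trace

end Pointwise

end QuaternionicGeometry

namespace QuaternionicGeometry

/-! ### Curvature tensors of quaternionic Kähler type -/

section CurvatureAlgebra

variable {E : Type*} [NormedAddCommGroup E] [NormedSpace ℝ E]

/-- `R` has the symmetries of the curvature operator of a Levi-Civita connection of `g`, and it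
normalises `span {I, J, K}`, acting on it by the bilinear forms `α`, `β`, `γ`. -/
structure IsQuaternionicCurvature (g : E →L[ℝ] E →L[ℝ] ℝ) (I J K : E →L[ℝ] E)
    (R : E →L[ℝ] E →L[ℝ] E →L[ℝ] E) (α β γ : E →L[ℝ] E →L[ℝ] ℝ) : Prop where
  skew : ∀ u v w, R u v w = -R v u w
  bianchi : ∀ u v w, R u v w + R v w u + R w u v = 0
  metric : ∀ u v w z, g (R u v w) z + g w (R u v z) = 0
  commI : ∀ u v w, R u v (I w) - I (R u v w) = γ u v • J w - β u v • K w
  commJ : ∀ u v w, R u v (J w) - J (R u v w) = α u v • K w - γ u v • I w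
  commK : ∀ u v w, R u v (K w) - K (R u v w) = β u v • I w - α u v • J w

/-- The Ricci tensor of `R`, normalised as `trace (u ↦ R(u, v) w)`. -/
def ricciOf (R : E →L[ℝ] E →L[ℝ] E →L[ℝ] E) (v w : E) : ℝ :=
  LinearMap.trace ℝ E ((R.flip v).flip w : E →L[ℝ] E)

namespace IsQuaternionicCurvature

variable {g : E →L[ℝ] E →L[ℝ] ℝ} {I J K : E →L[ℝ] E}
  {R : E →L[ℝ] E →L[ℝ] E →L[ℝ] E} {α β γ : E →L[ℝ] E →L[ℝ] ℝ}

theorem cycle (h : IsQuaternionicCurvature g I J K R α β γ) :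
    IsQuaternionicCurvature g J K I R β γ α :=
  ⟨h.skew, h.bianchi, h.metric, h.commJ, h.commK, h.commI⟩

theorem pair_symm (h : IsQuaternionicCurvature g I J K R α β γ)
    (hg : ∀ u v, g u v = g v u) (u v w z : E) :
    g (R u v w) z = g (R w z u) v := by
  have sk : ∀ u v w z, g (R u v w) z = -g (R v u w) z := fun u v w z => by
    rw [h.skew]; simp
  have sk' : ∀ u v w z, g (R u v w) z = -g (R u v z) w := fun u v w z => by
    rw [hg (R u v z)]; linarith [h.metric u v w z]
  have bi : ∀ u v w z, g (R u v w) z + g (R v w u) z + g (R w u v) z = 0 := fun u v w z => by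
    have := congrArg (fun x => g x z) (h.bianchi u v w)
    simpa using this
  have b1 := bi u v w z
  have b2 := bi v w z u
  have b3 := bi w z u v
  have b4 := bi z u v w
  linarith [sk' v w u z, sk' w z v u, sk' z u w v, sk' u v z w, sk w u v z, sk' u w v z,
    sk z v w u, sk' v z w u, sk w u z v, sk z v u w, sk u v w z, sk v w z u, sk w z u v, sk z u v w]

variable [FiniteDimensional ℝ E]

/-- The trace of `R(u, v) ∘ I` computed from the commutation relations. -/
theorem trace_comp_I (h : IsQuaternionicCurvature g I J K R α β γ) (hq : IsQuaternionic I J K)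
    (u v : E) : LinearMap.trace ℝ E (R u v ∘L I : E →L[ℝ] E) =
      -(Module.finrank ℝ E / 2) * α u v := by
  have e1 : (R u v ∘L J) ∘L K - J ∘L (R u v ∘L K)
      = -(α u v • ContinuousLinearMap.id ℝ E) + γ u v • J := by
    ext w
    have := h.commJ u v (K w)
    simp only [hq.KK, hq.IK] at this
    simpa using this
  have e2 : (R u v ∘L J) ∘L K = R u v ∘L I := by ext w; simp [hq.JK]
  have e3 : (R u v ∘L K) ∘L J = -(R u v ∘L I) := by ext w; simp [hq.KJ]
  have t1 := congrArg (fun L : E →L[ℝ] E => LinearMap.trace ℝ E (L : E →ₗ[ℝ] E)) e1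
  have t2 := trace_comp_comm_clm J (R u v ∘L K)
  simp only [e2, ContinuousLinearMap.toLinearMap_sub, ContinuousLinearMap.toLinearMap_add,
    ContinuousLinearMap.toLinearMap_neg, ContinuousLinearMap.toLinearMap_smul, map_sub, map_add,
    map_neg, map_smul, t2, e3, hq.cycle.trace_eq_zero] at t1
  have t3 : LinearMap.trace ℝ E (ContinuousLinearMap.id ℝ E : E →ₗ[ℝ] E)
      = Module.finrank ℝ E := by
    simp
  rw [t3] at t1
  simp only [smul_eq_mul] at t1
  linarith

theorem trace_I_comp (h : IsQuaternionicCurvature g I J K R α β γ) (u v : E) :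
    LinearMap.trace ℝ E (I ∘L (R.flip u).flip v : E →L[ℝ] E)
      = ricciOf R u (I v) - γ (J v) u + β (K v) u := by
  have e : I ∘L (R.flip u).flip v = (R.flip u).flip (I v)
      - (γ.flip u).smulRight (J v) + (β.flip u).smulRight (K v) := by
    ext w
    have := h.commI w u v
    simp only [ContinuousLinearMap.comp_apply, ContinuousLinearMap.flip_apply,
      add_apply, sub_apply,
      ContinuousLinearMap.smulRight_apply]
    rw [sub_eq_iff_eq_add] at this
    rw [this]; abel
  rw [e]
  simp only [ContinuousLinearMap.toLinearMap_sub, ContinuousLinearMap.toLinearMap_add, map_sub,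
    map_add, trace_rankOne, ricciOf, ContinuousLinearMap.flip_apply]

/-- The contracted first Bianchi identity expresses the Ricci tensor by the curvature of
`span {I, J, K}`. -/
theorem ricciOf_eq (h : IsQuaternionicCurvature g I J K R α β γ)
    (hg : IsQuaternionHermitian g I J K) (v w : E) :
    ricciOf R v w = Module.finrank ℝ E / 4 * α (I w) v + β (J w) v + γ (K w) v := by
  -- `trace (u ↦ I R(u, v) w)` is skew in `v` and `w` by pair symmetry.
  have key : ∀ v w : E, LinearMap.trace ℝ E (I ∘L (R.flip v).flip w : E →L[ℝ] E)
      = -LinearMap.trace ℝ E (I ∘L (R.flip w).flip v : E →L[ℝ] E) := by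
    intro v w
    have := trace_eq_of_adjoint hg.nondeg
      (P := ((I ∘L (R.flip v).flip w : E →L[ℝ] E) : E →ₗ[ℝ] E))
      (Q := ((-((R.flip w).flip v ∘L I) : E →L[ℝ] E) : E →ₗ[ℝ] E)) (fun a b => by
        simp only [ContinuousLinearMap.coe_coe, ContinuousLinearMap.comp_apply,
          ContinuousLinearMap.flip_apply, neg_apply]
        rw [hg.skewI, h.pair_symm hg.symm, h.skew w, map_neg, neg_apply,
          neg_neg, hg.symm a, map_neg, neg_apply, ← neg_eq_iff_eq_neg]
        have := h.metric (I b) w a v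
        rw [hg.symm a] at this
        linarith)
    rw [this, ContinuousLinearMap.toLinearMap_neg, map_neg, trace_comp_comm_clm]
  have tr : ∀ u v : E, LinearMap.trace ℝ E (R u v ∘L I : E →L[ℝ] E)
      = 2 * LinearMap.trace ℝ E (I ∘L (R.flip v).flip u : E →L[ℝ] E) := by
    intro u v
    have e : R u v ∘L I = (R.flip v).flip u ∘L I - (R.flip u).flip v ∘L I := by
      ext w
      have b := h.bianchi u v (I w)
      simp only [ContinuousLinearMap.comp_apply, ContinuousLinearMap.flip_apply,
        sub_apply]
      rw [h.skew v] at b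
      rw [← sub_eq_zero, ← b]; abel
    rw [e, ContinuousLinearMap.toLinearMap_sub, map_sub, trace_comp_comm_clm,
      trace_comp_comm_clm _ I, key u v]
    ring
  have h1 := tr (I w) v
  rw [h.trace_comp_I hg.quat, h.trace_I_comp, hg.quat.II, hg.quat.JI, hg.quat.KI] at h1
  have : ricciOf R v (-w) = -ricciOf R v w := by
    simp [ricciOf]
  simp only [this, map_neg, neg_apply] at h1
  linarith

theorem ricciOf_eq_of_eq {ν : ℝ} (h : IsQuaternionicCurvature g I J K R α β γ)
    (hg : IsQuaternionHermitian g I J K) (hα : ∀ u v, α u v = ν * g u (I v))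
    (hβ : ∀ u v, β u v = ν * g u (J v)) (hγ : ∀ u v, γ u v = ν * g u (K v)) (v w : E) :
    ricciOf R v w = (Module.finrank ℝ E / 4 + 2) * ν * g v w := by
  rw [h.ricciOf_eq hg, hα, hβ, hγ, hg.orthI, hg.orthJ, hg.orthK, hg.symm w v]
  ring

/-- In dimension greater than four, the curvature of `span {I, J, K}` is a multiple of the
three Kähler forms. -/
theorem exists_const (h : IsQuaternionicCurvature g I J K R α β γ)
    (hg : IsQuaternionHermitian g I J K) (hd : Module.finrank ℝ E ≠ 4)
    (hpos : 0 < Module.finrank ℝ E)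
    (hpd : ∀ u, u ≠ 0 → 0 < g u u) :
    ∃ ν : ℝ, (∀ u v, α u v = ν * g u (I v)) ∧ (∀ u v, β u v = ν * g u (J v)) ∧
      (∀ u v, γ u v = ν * g u (K v)) := by
  have hdim : (Module.finrank ℝ E : ℝ) / 4 - 1 ≠ 0 := by
    intro h0
    apply hd
    have : (Module.finrank ℝ E : ℝ) = 4 := by linarith
    exact_mod_cast this
  have hab : ∀ v w, α (I w) v = β (J w) v := fun v w => by
    have h1 := h.ricciOf_eq hg v w
    have h2 := h.cycle.ricciOf_eq hg.cycle v w
    refine sub_eq_zero.1 ((mul_eq_zero.1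
      (?_ : ((Module.finrank ℝ E : ℝ) / 4 - 1) * _ = 0)).resolve_left hdim)
    linarith
  have hbc : ∀ v w, β (J w) v = γ (K w) v := fun v w => by
    have h1 := h.cycle.ricciOf_eq hg.cycle v w
    have h2 := h.cycle.cycle.ricciOf_eq hg.cycle.cycle v w
    refine sub_eq_zero.1 ((mul_eq_zero.1
      (?_ : ((Module.finrank ℝ E : ℝ) / 4 - 1) * _ = 0)).resolve_left hdim)
    linarith
  obtain ⟨x₀, hx₀⟩ := Module.finrank_pos_iff_exists_ne_zero (R := ℝ) |>.1 hpos
  have hex : ∀ A B C : E →L[ℝ] E, ∀ a b c : E →L[ℝ] E →L[ℝ] ℝ,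
      IsQuaternionicCurvature g A B C R a b c → IsQuaternionic A B C →
      ∀ u v, a u v = -a v u := fun A B C a b c h hq u v => by
    have h1 := h.trace_comp_I hq u v
    have h2 := h.trace_comp_I hq v u
    have h3 : R u v ∘L A = -(R v u ∘L A) := by ext w; simp [h.skew u v]
    rw [h3, ContinuousLinearMap.toLinearMap_neg, map_neg, h2] at h1
    have : (Module.finrank ℝ E : ℝ) ≠ 0 := by exact_mod_cast hpos.ne'
    have h4 : (Module.finrank ℝ E : ℝ) * (a u v + a v u) = 0 := by linarith
    linarith [(mul_eq_zero.1 h4).resolve_left this]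
  have hα := hex _ _ _ _ _ _ h hg.quat
  have hβ := hex _ _ _ _ _ _ h.cycle hg.quat.cycle
  have hγ := hex _ _ _ _ _ _ h.cycle.cycle hg.quat.cycle.cycle
  -- the common value of `α(Iw, v)`, `β(Jw, v)`, `γ(Kw, v)` is symmetric
  let T : E → E → ℝ := fun v w => α (I w) v
  have TI : ∀ v w, T (I v) (I w) = T w v := fun v w => by
    simp only [T, hg.quat.II]; rw [hα]; simp
  have TJ : ∀ v w, T (J v) (J w) = T w v := fun v w => by
    simp only [T, hab, hg.quat.JJ]; rw [hβ]; simp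
  have TK : ∀ v w, T (K v) (K w) = T w v := fun v w => by
    simp only [T, hab, hbc, hg.quat.KK]; rw [hγ]; simp
  have Tsymm : ∀ v w, T v w = T w v := fun v w => by
    rw [← TK v w, ← hg.quat.IJ v, ← hg.quat.IJ w, TI, TJ]
  have expand : ∀ X Y Z, α X Y * g Z Z = g (R X Y (J Z)) (K Z) + g (R X Y Z) (I Z) := by
    intro X Y Z
    have h1 := congrArg (fun x => g x (K Z)) (h.commJ X Y Z)
    simp only [map_sub, map_smul, sub_apply, smul_apply,
      smul_eq_mul, hg.orthK, hg.skewJ, hg.quat.JK, hg.skewI, hg.quat.IK] at h1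
    have := hg.cycle.apply_I_self Z
    simp only [map_neg, this] at h1
    linarith
  have swap : ∀ X Z, T X X * g Z Z = T Z Z * g X X := by
    intro X Z
    have a1 := expand (I X) X Z
    have a2 := expand (I (J X)) (J X) Z
    have b1 := expand (I Z) Z X
    have b2 := expand (I (J Z)) (J Z) X
    have c1 : α (I X) X = T X X := rfl
    have c2 : α (I (J X)) (J X) = T X X := TJ X X
    have d1 : α (I Z) Z = T Z Z := rfl
    have d2 : α (I (J Z)) (J Z) = T Z Z := TJ Z Z
    rw [c1] at a1; rw [c2] at a2; rw [d1] at b1; rw [d2] at b2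
    rw [hg.quat.IJ] at a2 b2
    have flip : ∀ u v w z, g (R u v w) z = g (R z w v) u := fun u v w z => by
      rw [h.pair_symm hg.symm, h.skew, map_neg, neg_apply]
      have := h.metric z w u v
      rw [hg.symm u] at this
      linarith
    have e1 := flip (I X) X Z (I Z)
    have e2 := flip (I X) X (J Z) (K Z)
    have e3 := flip (K X) (J X) Z (I Z)
    have e4 := flip (K X) (J X) (J Z) (K Z)
    linarith
  have hν := hpd x₀ hx₀
  refine ⟨T x₀ x₀ / g x₀ x₀, ?_⟩
  have hdiag : ∀ v, T v v = T x₀ x₀ / g x₀ x₀ * g v v := fun v => by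
    have := swap v x₀
    field_simp
    linarith
  have hT : ∀ v w, T v w = T x₀ x₀ / g x₀ x₀ * g v w := fun v w => by
    have h1 := hdiag (v + w)
    have h2 := hdiag v
    have h3 := hdiag w
    have h4 := Tsymm v w
    have h5 : T (v + w) (v + w) = T v v + T v w + T w v + T w w := by
      simp only [T, map_add, add_apply]; ring
    have h6 : g (v + w) (v + w) = g v v + g v w + g w v + g w w := by
      simp only [map_add, add_apply]; ring
    rw [h5, h6, h2, h3, hg.symm w v] at h1
    linarith
  have fin : ∀ A B C : E →L[ℝ] E, ∀ a : E →L[ℝ] E →L[ℝ] ℝ, IsQuaternionic A B C →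
      (∀ u v, g (A u) v = -g u (A v)) →
      (∀ v w, T v w = a (A w) v) → ∀ u v, a u v = T x₀ x₀ / g x₀ x₀ * g u (A v) := by
    intro A B C a hq hA hTa u v
    have := hTa v (A u)
    rw [hq.II, hT, hg.symm v, hA] at this
    simp only [map_neg, neg_apply] at this
    linarith
  exact ⟨fin _ _ _ α hg.quat hg.skewI fun v w => rfl,
    fin _ _ _ β hg.quat.cycle hg.skewJ fun v w => hab v w,
    fin _ _ _ γ hg.quat.cycle.cycle hg.skewK fun v w => (hab v w).trans (hbc v w)⟩

end IsQuaternionicCurvature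

end CurvatureAlgebra

end QuaternionicGeometry

namespace QuaternionicGeometry

/-! ### Levi-Civita calculus in a coordinate domain -/

section Calculus

open scoped Topology

variable {E : Type*} [NormedAddCommGroup E] [NormedSpace ℝ E]
  {F : Type*} [NormedAddCommGroup F] [NormedSpace ℝ F]
  {G : Type*} [NormedAddCommGroup G] [NormedSpace ℝ G]

theorem fderiv_eval {A : E → F →L[ℝ] G} {f : E → F} {y : E} (hA : DifferentiableAt ℝ A y)
    (hf : DifferentiableAt ℝ f y) (u : E) :
    fderiv ℝ (fun z => A z (f z)) y u = fderiv ℝ A y u (f y) + A y (fderiv ℝ f y u) := by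
  rw [fderiv_clm_apply hA hf]
  simp [add_comm]

theorem fderiv_eval_const {A : E → F →L[ℝ] G} {y : E} (hA : DifferentiableAt ℝ A y) (w : F)
    (u : E) : fderiv ℝ (fun z => A z w) y u = fderiv ℝ A y u w := by
  rw [fderiv_eval hA (differentiableAt_const w)]
  simp

theorem fderiv_fderiv_symm {f : E → F} {y : E} (hf : ContDiffAt ℝ ∞ f y) (u v : E) :
    fderiv ℝ (fderiv ℝ f) y u v = fderiv ℝ (fderiv ℝ f) y v u :=
  (hf.isSymmSndFDerivAt (by simpa using WithTop.coe_le_coe.2 (le_top : (2 : ℕ∞) ≤ ⊤))).eq u v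

theorem differentiableAt_of_smooth {f : E → F} {y : E} (hf : ContDiffAt ℝ ∞ f y) :
    DifferentiableAt ℝ f y := hf.differentiableAt (by simp)

theorem contDiffAt_fderiv {f : E → F} {y : E} (hf : ContDiffAt ℝ ∞ f y) :
    ContDiffAt ℝ ∞ (fderiv ℝ f) y := hf.fderiv_right (by simp)

/-- `g` is a pseudo-Riemannian metric on the open subset `V` of the vector space `E`. -/
structure IsMetricOn (V : Set E) (g : E → E →L[ℝ] E →L[ℝ] ℝ) : Prop where
  isOpen : IsOpen V
  smooth : ContDiffOn ℝ ∞ g V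
  symm : ∀ y ∈ V, ∀ u v, g y u v = g y v u
  nondeg : ∀ y ∈ V, ∀ u, (∀ v, g y u v = 0) → u = 0

namespace IsMetricOn

variable {V : Set E} {g : E → E →L[ℝ] E →L[ℝ] ℝ} {y : E}

theorem contDiffAt (h : IsMetricOn V g) (hy : y ∈ V) : ContDiffAt ℝ ∞ g y :=
  h.smooth.contDiffAt (h.isOpen.mem_nhds hy)

theorem fderiv_symm (h : IsMetricOn V g) (hy : y ∈ V) (u v w : E) :
    fderiv ℝ g y u v w = fderiv ℝ g y u w v := by
  have hd := differentiableAt_of_smooth (h.contDiffAt hy)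
  have h1 : (fun z => g z v w) =ᶠ[𝓝 y] fun z => g z w v :=
    Filter.eventually_of_mem (h.isOpen.mem_nhds hy) fun z hz => h.symm z hz v w
  have h2 := congrArg (fun L : E →L[ℝ] ℝ => L u) h1.fderiv_eq
  rwa [fderiv_eval_const (A := fun z => g z v) (by fun_prop),
    fderiv_eval_const (A := fun z => g z w) (by fun_prop), fderiv_eval_const hd,
    fderiv_eval_const hd] at h2

variable [FiniteDimensional ℝ E]

theorem christoffel_spec (h : IsMetricOn V g) (hy : y ∈ V) (u v w : E) :
    g y (christoffel g y u v) w =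
      (1 / 2) * (fderiv ℝ g y u v w + fderiv ℝ g y v u w - fderiv ℝ g y w u v) := by
  rw [christoffel_apply, apply_inverse (h.nondeg y hy), christoffelLower_apply]

theorem christoffel_symm (h : IsMetricOn V g) (hy : y ∈ V) (u v : E) :
    christoffel g y u v = christoffel g y v u := by
  refine eq_of_nondegenerate (h.nondeg y hy) fun w => ?_
  rw [h.christoffel_spec hy, h.christoffel_spec hy, h.fderiv_symm hy w]
  ring

theorem fderiv_metric (h : IsMetricOn V g) (hy : y ∈ V) (u v w : E) :
    fderiv ℝ g y u v w = g y (christoffel g y u v) w + g y v (christoffel g y u w) := by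
  rw [h.symm y hy v, h.christoffel_spec hy, h.christoffel_spec hy, h.fderiv_symm hy w u v,
    h.fderiv_symm hy v u w, h.fderiv_symm hy u w v]
  ring

/-- The fundamental lemma of Riemannian geometry: the Levi-Civita connection is the only
torsion-free metric connection. -/
theorem christoffel_unique (h : IsMetricOn V g) (hy : y ∈ V) {C : E → E → E}
    (hC : ∀ u v, C u v = C v u)
    (hm : ∀ u v w, fderiv ℝ g y u v w = g y (C u v) w + g y v (C u w)) (u v : E) :
    christoffel g y u v = C u v := by
  refine eq_of_nondegenerate (h.nondeg y hy) fun w => ?_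
  rw [h.christoffel_spec hy, hm, hm, hm, hC v u, hC w u, hC w v, h.symm y hy u (C v w),
    h.symm y hy v (C u w)]
  ring

theorem contDiffAt_christoffel (h : IsMetricOn V g) (hy : y ∈ V) :
    ContDiffAt ℝ ∞ (christoffel g) y := by
  have hg := h.contDiffAt hy
  have hinv : ContDiffAt ℝ ∞ (fun z => (g z).inverse) y :=
    (isInvertible_of_nondegenerate (h.nondeg y hy)).contDiffAt_map_inverse.comp y hg
  have hd := contDiffAt_fderiv hg
  have hlow : ContDiffAt ℝ ∞ (christoffelLower g) y := by
    unfold christoffelLower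
    refine ContDiffAt.const_smul (1 / 2 : ℝ) ((hd.add ?_).sub ?_)
    · exact (ContinuousLinearMap.flipₗᵢ ℝ E E (E →L[ℝ] ℝ)).contDiff.contDiffAt.comp y hd
    · refine contDiffAt_const.clm_comp ?_
      exact (ContinuousLinearMap.flipₗᵢ ℝ E E (E →L[ℝ] ℝ)).contDiff.contDiffAt.comp y hd
  unfold christoffel
  refine ContDiffAt.clm_comp ?_ hlow
  exact (ContinuousLinearMap.compL ℝ E (E →L[ℝ] ℝ) E).contDiff.contDiffAt.comp y hinv

end IsMetricOn

/-- The curvature operator as a continuous trilinear map. -/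
def riemannCLM (g : E → E →L[ℝ] E →L[ℝ] ℝ) (y : E) : E →L[ℝ] E →L[ℝ] E →L[ℝ] E :=
  let D : E →L[ℝ] E →L[ℝ] E →L[ℝ] E := fderiv ℝ (christoffel g) y
  let Q : E →L[ℝ] E →L[ℝ] E →L[ℝ] E :=
    (ContinuousLinearMap.compL ℝ E E E).bilinearComp (christoffel g y) (christoffel g y)
  D - D.flip + (Q - Q.flip)

theorem riemannCLM_apply (g : E → E →L[ℝ] E →L[ℝ] ℝ) (y u v w : E) :
    riemannCLM g y u v w = riemann g y u v w := by
  simp [riemannCLM, riemann]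
  abel

theorem ricci_eq_ricciOf (g : E → E →L[ℝ] E →L[ℝ] ℝ) (y v w : E) :
    ricci g y v w = ricciOf (riemannCLM g y) v w := by
  unfold ricciOf
  change LinearMap.trace ℝ E _ = _
  congr 1
  ext u
  exact (riemannCLM_apply g y u v w).symm

namespace IsMetricOn

variable {V : Set E} {g : E → E →L[ℝ] E →L[ℝ] ℝ} {y : E} [FiniteDimensional ℝ E]

omit [FiniteDimensional ℝ E] in
theorem riemann_skew (u v w : E) : riemann g y u v w = -riemann g y v u w := by
  simp only [riemann]; abel

theorem riemann_bianchi (h : IsMetricOn V g) (hy : y ∈ V) (u v w : E) :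
    riemann g y u v w + riemann g y v w u + riemann g y w u v = 0 := by
  have hd := differentiableAt_of_smooth (h.contDiffAt_christoffel hy)
  have sd : ∀ u v w, fderiv ℝ (christoffel g) y u v w = fderiv ℝ (christoffel g) y u w v := by
    intro u v w
    have h1 : (fun z => christoffel g z v w) =ᶠ[𝓝 y] fun z => christoffel g z w v :=
      Filter.eventually_of_mem (h.isOpen.mem_nhds hy) fun z hz => h.christoffel_symm hz v w
    have h2 := congrArg (fun L : E →L[ℝ] E => L u) h1.fderiv_eq
    rwa [fderiv_eval_const (A := fun z => christoffel g z v) (by fun_prop),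
      fderiv_eval_const (A := fun z => christoffel g z w) (by fun_prop), fderiv_eval_const hd,
      fderiv_eval_const hd] at h2
  simp only [riemann]
  rw [sd u v w, sd v u w, sd w u v, h.christoffel_symm hy v w, h.christoffel_symm hy u w,
    h.christoffel_symm hy u v]
  abel

theorem riemann_metric (h : IsMetricOn V g) (hy : y ∈ V) (u v w x : E) :
    g y (riemann g y u v w) x + g y w (riemann g y u v x) = 0 := by
  have hg := h.contDiffAt hy
  have dg := differentiableAt_of_smooth hg
  have dg' := differentiableAt_of_smooth (contDiffAt_fderiv hg)
  have dΓ := differentiableAt_of_smooth (h.contDiffAt_christoffel hy)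
  have key : ∀ u v, fderiv ℝ (fderiv ℝ g) y u v w x =
      fderiv ℝ g y u (christoffel g y v w) x + g y (fderiv ℝ (christoffel g) y u v w) x
        + (fderiv ℝ g y u w (christoffel g y v x) + g y w (fderiv ℝ (christoffel g) y u v x)) := by
    intro u v
    have h1 : (fun z => fderiv ℝ g z v w x) =ᶠ[𝓝 y]
        fun z => g z (christoffel g z v w) x + g z w (christoffel g z v x) :=
      Filter.eventually_of_mem (h.isOpen.mem_nhds hy) fun z hz => h.fderiv_metric hz v w x
    have h2 := congrArg (fun L : E →L[ℝ] ℝ => L u) h1.fderiv_eq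
    rw [fderiv_eval_const (A := fun z => fderiv ℝ g z v w) (by fun_prop),
      fderiv_eval_const (A := fun z => fderiv ℝ g z v) (by fun_prop), fderiv_eval_const dg'] at h2
    rw [h2, fderiv_fun_add (by fun_prop) (by fun_prop), add_apply,
      fderiv_eval_const (A := fun z => g z (christoffel g z v w)) (by fun_prop),
      fderiv_eval dg (f := fun z => christoffel g z v w) (by fun_prop),
      fderiv_eval (A := fun z => g z w) (by fun_prop) (f := fun z => christoffel g z v x)
        (by fun_prop), fderiv_eval_const dg,
      fderiv_eval_const (A := fun z => christoffel g z v) (by fun_prop),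
      fderiv_eval_const (A := fun z => christoffel g z v) (by fun_prop),
      fderiv_eval_const dΓ]
    simp
  have k1 := key u v
  have k2 := key v u
  have k3 : fderiv ℝ (fderiv ℝ g) y u v w x = fderiv ℝ (fderiv ℝ g) y v u w x := by
    rw [fderiv_fderiv_symm hg]
  rw [h.fderiv_metric hy, h.fderiv_metric hy] at k1 k2
  simp only [riemann, map_add, map_sub, add_apply, sub_apply]
  linarith

/-- The commutator of the curvature with an endomorphism field `A` whose covariant derivative is
`c ⊗ B - b ⊗ C`. -/
theorem riemann_comm (h : IsMetricOn V g) (hy : y ∈ V) {A B C : E → E →L[ℝ] E}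
    {b c : E → E →L[ℝ] ℝ} (hA : ContDiffAt ℝ ∞ A y) (hB : DifferentiableAt ℝ B y)
    (hC : DifferentiableAt ℝ C y) (hb : DifferentiableAt ℝ b y) (hc : DifferentiableAt ℝ c y)
    (hcov : ∀ z ∈ V, ∀ v w, covDerivEnd g A z v w = c z v • B z w - b z v • C z w)
    (u v w : E) :
    riemann g y u v (A y w) - A y (riemann g y u v w) =
      (fderiv ℝ c y u v - fderiv ℝ c y v u) • B y w - (fderiv ℝ b y u v - fderiv ℝ b y v u) • C y w
        + (c y v • covDerivEnd g B y u w - c y u • covDerivEnd g B y v w)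
        - (b y v • covDerivEnd g C y u w - b y u • covDerivEnd g C y v w) := by
  have dA := differentiableAt_of_smooth hA
  have dA' := differentiableAt_of_smooth (contDiffAt_fderiv hA)
  have dΓ := differentiableAt_of_smooth (h.contDiffAt_christoffel hy)
  have key : ∀ u v, fderiv ℝ (fderiv ℝ A) y u v w
      + (fderiv ℝ (christoffel g) y u v (A y w) + christoffel g y v (fderiv ℝ A y u w))
      - (fderiv ℝ A y u (christoffel g y v w) + A y (fderiv ℝ (christoffel g) y u v w))
      = (c y v • fderiv ℝ B y u w + fderiv ℝ c y u v • B y w)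
        - (b y v • fderiv ℝ C y u w + fderiv ℝ b y u v • C y w) := by
    intro u v
    have h1 : (fun z => fderiv ℝ A z v w + christoffel g z v (A z w) - A z (christoffel g z v w))
        =ᶠ[𝓝 y] fun z => c z v • B z w - b z v • C z w :=
      Filter.eventually_of_mem (h.isOpen.mem_nhds hy) fun z hz => by
        simp only [← covDerivEnd_apply]; exact hcov z hz v w
    have h2 := congrArg (fun L : E →L[ℝ] E => L u) h1.fderiv_eq
    rw [fderiv_fun_sub (by fun_prop) (by fun_prop), fderiv_fun_add (by fun_prop) (by fun_prop),
      fderiv_fun_sub (by fun_prop) (by fun_prop), fderiv_fun_smul (by fun_prop) (by fun_prop),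
      fderiv_fun_smul (by fun_prop) (by fun_prop)] at h2
    simp only [sub_apply, add_apply, smul_apply, ContinuousLinearMap.smulRight_apply] at h2
    rw [fderiv_eval_const (A := fun z => fderiv ℝ A z v) (by fun_prop), fderiv_eval_const dA',
      fderiv_eval (A := fun z => christoffel g z v) (by fun_prop) (f := fun z => A z w)
        (by fun_prop), fderiv_eval_const dΓ, fderiv_eval_const dA,
      fderiv_eval dA (f := fun z => christoffel g z v w) (by fun_prop),
      fderiv_eval_const (A := fun z => christoffel g z v) (by fun_prop), fderiv_eval_const dΓ,
      fderiv_eval_const hc, fderiv_eval_const hb, fderiv_eval_const hB,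
      fderiv_eval_const hC] at h2
    exact h2
  have k1 := key u v
  have k2 := key v u
  rw [fderiv_fderiv_symm hA v u] at k2
  have c1 := fun u w => covDerivEnd_apply g A y u w
  have dAf : ∀ u w, fderiv ℝ A y u w = c y u • B y w - b y u • C y w
      - christoffel g y u (A y w) + A y (christoffel g y u w) := fun u w => by
    rw [← hcov y hy, covDerivEnd_apply]; abel
  rw [dAf, dAf] at k1 k2
  simp only [riemann, covDerivEnd_apply, map_add, map_sub, map_smul] at k1 k2 ⊢
  rw [← sub_eq_zero] at k1 k2 ⊢
  rw [← sub_zero (_ - _ : E), ← sub_self (0 : E)]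
  nth_rw 1 [← k1]
  rw [← k2]
  module

end IsMetricOn

end Calculus

end QuaternionicGeometry

namespace QuaternionicGeometry

/-! ### Quaternionic connections and their Lee forms -/

section LeeConnection

open scoped Topology

variable {E : Type*} [NormedAddCommGroup E] [NormedSpace ℝ E]

/-- `(1 + L) φ ⊗ φ` on a vector space. -/
def quatSq (I J K : E →L[ℝ] E) (φ : E →L[ℝ] ℝ) : E →L[ℝ] E →L[ℝ] ℝ :=
  φ.smulRight φ + ((φ ∘L I).smulRight (φ ∘L I) + (φ ∘L J).smulRight (φ ∘L J)
    + (φ ∘L K).smulRight (φ ∘L K))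

theorem quatSq_apply (I J K : E →L[ℝ] E) (φ : E →L[ℝ] ℝ) (u v : E) :
    quatSq I J K φ u v = φ u * φ v + (φ (I u) * φ (I v) + φ (J u) * φ (J v)
      + φ (K u) * φ (K v)) := by
  simp [quatSq]

/-- The difference of two torsion-free connections that preserve `span {I, J, K}`; the
normalisation is such that adding it to a connection with Lee form `φ` gives the Obata
connection. -/
def quatShift (I J K : E →L[ℝ] E) (φ : E →L[ℝ] ℝ) (u v : E) : E :=
  -(1 / 2 : ℝ) • (φ u • v + φ v • u - (φ (I u) • I v + φ (I v) • I u)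
    - (φ (J u) • J v + φ (J v) • J u) - (φ (K u) • K v + φ (K v) • K u))

theorem quatShift_symm (I J K : E →L[ℝ] E) (φ : E →L[ℝ] ℝ) (u v : E) :
    quatShift I J K φ u v = quatShift I J K φ v u := by
  unfold quatShift; module

theorem quatShift_cycle (I J K : E →L[ℝ] E) (φ : E →L[ℝ] ℝ) (u v : E) :
    quatShift I J K φ u v = quatShift J K I φ u v := by
  unfold quatShift; module

theorem IsQuaternionic.quatShift_comm {I J K : E →L[ℝ] E} (h : IsQuaternionic I J K)
    (φ : E →L[ℝ] ℝ) (u v : E) :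
    quatShift I J K φ u (I v) - I (quatShift I J K φ u v) = φ (K u) • J v - φ (J u) • K v := by
  unfold quatShift
  simp only [map_add, map_sub, map_smul, map_neg, h.II, h.JI, h.KI, h.IJ, h.IK]
  module

theorem IsQuaternionic.eq_zero_of_combination {I J K : E →L[ℝ] E} (h : IsQuaternionic I J K)
    {u : E} (hu : u ≠ 0) {a b c d : ℝ} (h0 : a • u + b • I u + c • J u + d • K u = 0) :
    a = 0 ∧ b = 0 ∧ c = 0 ∧ d = 0 := by
  -- multiply by the conjugate quaternion
  have h1 : (a ^ 2 + b ^ 2 + c ^ 2 + d ^ 2) • u = 0 := by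
    have e1 := congrArg I h0
    have e2 := congrArg J h0
    have e3 := congrArg K h0
    simp only [map_add, map_smul, map_zero, h.II, h.JJ, h.KK, h.IJ, h.JK, h.KI, h.JI, h.KJ,
      h.IK] at e1 e2 e3
    have : (a ^ 2 + b ^ 2 + c ^ 2 + d ^ 2) • u = a • (a • u + b • I u + c • J u + d • K u)
        - b • (a • I u + b • -u + c • K u + d • -J u) - c • (a • J u + b • -K u + c • -u + d • I u)
        - d • (a • K u + b • J u + c • -I u + d • -u) := by module
    rw [this, h0, e1, e2, e3]; simp
  have h2 := (smul_eq_zero.1 h1).resolve_right hu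
  refine ⟨?_, ?_, ?_, ?_⟩ <;> nlinarith [sq_nonneg a, sq_nonneg b, sq_nonneg c, sq_nonneg d]

/-- The trace as a continuous linear functional. -/
def traceCLM (E : Type*) [NormedAddCommGroup E] [NormedSpace ℝ E] [FiniteDimensional ℝ E] :
    (E →L[ℝ] E) →L[ℝ] ℝ :=
  LinearMap.toContinuousLinearMap (LinearMap.trace ℝ E ∘ₗ ContinuousLinearMap.coeLM ℝ)

/-- The pointwise form of the connection of a hyper-Hermitian quaternionic Kähler metric: covariant
derivatives of `I`, `J`, `K` in `span {I, J, K}` that satisfy the product rule and have vanishing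
Nijenhuis tensors are determined by the Lee form. -/
theorem IsQuaternionic.connection_eq [FiniteDimensional ℝ E] [Nontrivial E]
    {I J K : E →L[ℝ] E} (h : IsQuaternionic I J K) {ΘI ΘJ ΘK : E →L[ℝ] E →L[ℝ] E}
    (spanI : ∀ u, ΘI u ∈ Submodule.span ℝ {I, J, K})
    (spanJ : ∀ u, ΘJ u ∈ Submodule.span ℝ {I, J, K})
    (antiI : ∀ u w, ΘI u (I w) + I (ΘI u w) = 0) (antiJ : ∀ u w, ΘJ u (J w) + J (ΘJ u w) = 0)
    (antiK : ∀ u w, ΘK u (K w) + K (ΘK u w) = 0)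
    (prod : ∀ u w, ΘK u w = ΘI u (J w) + I (ΘJ u w))
    (nijI : ∀ u v, ΘI (I u) v - ΘI (I v) u + I (ΘI v u) - I (ΘI u v) = 0)
    (nijJ : ∀ u v, ΘJ (J u) v - ΘJ (J v) u + J (ΘJ v u) - J (ΘJ u v) = 0)
    {φ : E →L[ℝ] ℝ} (hφ : ∀ v, φ v = 1 / 2 * LinearMap.trace ℝ E (I ∘L ΘI.flip v : E →L[ℝ] E)) :
    (∀ u w, ΘI u w = φ (J u) • K w - φ (K u) • J w) ∧
      (∀ u w, ΘJ u w = φ (K u) • I w - φ (I u) • K w) ∧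
      (∀ u w, ΘK u w = φ (I u) • J w - φ (J u) • I w) := by
  obtain ⟨w₀, hw₀⟩ := exists_ne (0 : E)
  have exI : ∀ u, ∃ c b : ℝ, ΘI u = c • J - b • K := fun u => by
    obtain ⟨x, c, b, hx⟩ := Submodule.mem_span_triple.1 (spanI u)
    have h1 := antiI u w₀
    rw [← hx] at h1
    simp only [add_apply, smul_apply, map_add, map_smul, h.II, h.JI, h.KI, h.IJ, h.IK] at h1
    have h2 : (-2 * x) • w₀ = 0 := by rw [← h1]; module
    have h3 : x = 0 := by
      have := (smul_eq_zero.1 h2).resolve_right hw₀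
      linarith
    exact ⟨c, -b, by rw [← hx, h3]; module⟩
  have exJ : ∀ u, ∃ a c : ℝ, ΘJ u = a • K - c • I := fun u => by
    obtain ⟨c, x, a, hx⟩ := Submodule.mem_span_triple.1 (spanJ u)
    have h1 := antiJ u w₀
    rw [← hx] at h1
    simp only [add_apply, smul_apply, map_add, map_smul, h.JJ, h.JI, h.KJ, h.IJ, h.JK] at h1
    have h2 : (-2 * x) • w₀ = 0 := by rw [← h1]; module
    have h3 : x = 0 := by
      have := (smul_eq_zero.1 h2).resolve_right hw₀
      linarith
    exact ⟨a, -c, by rw [← hx, h3]; module⟩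
  choose c₀ b₀ hI₀ using exI
  choose a c' hJ₀ using exJ
  have hcc : ∀ u, c' u = c₀ u := fun u => by
    have h1 := antiK u w₀
    simp only [prod, hI₀, hJ₀, sub_apply, smul_apply, map_add, map_sub, map_smul,
      map_neg, h.II, h.JJ, h.KK, h.IJ, h.JK, h.KI, h.JI, h.KJ, h.IK] at h1
    have h2 : (2 * (c' u - c₀ u)) • K w₀ = 0 := by rw [← h1]; module
    have h3 : K w₀ ≠ 0 := fun h0 => hw₀ (by
      have := h.KK w₀; rw [h0, map_zero] at this; simpa using this)
    linarith [(smul_eq_zero.1 h2).resolve_right h3]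
  have hd : (Module.finrank ℝ E : ℝ) ≠ 0 := by
    exact_mod_cast Module.finrank_pos.ne'
  -- the coefficient of `J` in `ΘI`, as a continuous linear form
  let c : E →L[ℝ] ℝ := (-(1 / (Module.finrank ℝ E : ℝ))) •
    (traceCLM E ∘L ContinuousLinearMap.postcomp E J ∘L ΘI)
  have hc : ∀ u, c u = c₀ u := fun u => by
    have e : J ∘L (ΘI u) = -(c₀ u • ContinuousLinearMap.id ℝ E) - b₀ u • I := by
      ext w
      simp [hI₀, h.JJ, h.JK]
    change -(1 / (Module.finrank ℝ E : ℝ)) • LinearMap.trace ℝ E (J ∘L (ΘI u) : E →L[ℝ] E) = _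
    rw [e]
    simp only [ContinuousLinearMap.toLinearMap_sub, ContinuousLinearMap.toLinearMap_neg,
      ContinuousLinearMap.toLinearMap_smul, map_sub, map_neg, map_smul, h.trace_eq_zero]
    have : LinearMap.trace ℝ E (ContinuousLinearMap.id ℝ E : E →ₗ[ℝ] E)
      = Module.finrank ℝ E := by simp
    rw [this]
    simp only [smul_eq_mul]
    field_simp
    ring
  have nI : ∀ u, b₀ u = c (I u) := fun u => by
    by_cases hu : u = 0
    · have h1 : ΘI u = 0 := by rw [hu, map_zero]
      rw [hI₀] at h1
      have h2 := congrArg (fun L : E →L[ℝ] E => J (L w₀)) h1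
      simp only [sub_apply, smul_apply, map_sub, map_smul, h.JJ, h.JK, zero_apply,
        map_zero] at h2
      have h3 := h.eq_zero_of_combination hw₀ (a := -c₀ u) (b := -b₀ u) (c := 0) (d := 0)
        (by rw [← h2]; module)
      rw [neg_eq_zero.1 h3.2.1, hu]; simp
    · have h1 := nijI u (J u)
      simp only [hI₀, sub_apply, smul_apply, map_sub, map_smul, map_neg, h.II, h.JJ, h.IJ,
        h.KJ, h.IK] at h1
      have h2 := h.eq_zero_of_combination hu (a := b₀ u - c₀ (I u)) (b := b₀ (I u) + c₀ u)
        (c := b₀ (J u) - c₀ (K u)) (d := c₀ (J u) + b₀ (K u)) (by rw [← h1]; module)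
      rw [hc]; linarith [h2.1]
  have nJ : ∀ u, a u = -c (J u) := fun u => by
    by_cases hu : u = 0
    · have h1 : ΘJ u = 0 := by rw [hu, map_zero]
      rw [hJ₀] at h1
      have h2 := congrArg (fun L : E →L[ℝ] E => I (L w₀)) h1
      simp only [sub_apply, smul_apply, map_sub, map_smul, h.II, h.IK, zero_apply,
        map_zero] at h2
      have h3 := h.eq_zero_of_combination hw₀ (a := c' u) (b := 0) (c := -a u) (d := 0)
        (by rw [← h2]; module)
      rw [neg_eq_zero.1 h3.2.2.1, hu]; simp
    · have h1 := nijJ u (K u)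
      simp only [hJ₀, sub_apply, smul_apply, map_sub, map_smul, map_neg, h.JJ, h.KK,
        h.JK, h.JI, h.IK] at h1
      have h2 := h.eq_zero_of_combination hu (a := -a (J u) + c' u) (b := c' (I u) + a (K u))
        (c := a u + c' (J u)) (d := c' (K u) - a (I u)) (by rw [← h1]; module)
      rw [hc, ← hcc]; linarith [h2.2.2.1]
  have hφc : ∀ v, φ v = c (K v) := fun v => by
    have e : I ∘L ΘI.flip v = c.smulRight (K v) + (c ∘L I).smulRight (J v) := by
      ext w
      simp [hI₀, nI, hc, h.IJ, h.IK]
    rw [hφ, e]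
    simp only [ContinuousLinearMap.toLinearMap_add, map_add, trace_rankOne,
      ContinuousLinearMap.comp_apply, h.IJ]
    ring
  refine ⟨fun u w => ?_, fun u w => ?_, fun u w => ?_⟩
  · rw [hI₀]
    simp only [hφc, sub_apply, smul_apply, nI, ← hc, h.KK, h.KJ, map_neg]
    module
  · rw [hJ₀]
    simp only [hφc, sub_apply, smul_apply, nJ, hcc, ← hc, h.KK, h.KI, map_neg]
    module
  · rw [prod, hI₀, hJ₀]
    simp only [hφc, sub_apply, smul_apply, nI, nJ, hcc, ← hc, h.KI, h.KJ, map_neg, map_sub,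
      map_smul, h.JJ, h.II, h.IK]
    module

end LeeConnection

end QuaternionicGeometry

namespace QuaternionicGeometry

/-! ### Hyper-Hermitian metrics in a coordinate domain -/

section Hermitian

open scoped Topology

variable {E : Type*} [NormedAddCommGroup E] [NormedSpace ℝ E]
  {V : Set E} {g : E → E →L[ℝ] E →L[ℝ] ℝ} {I J K : E → E →L[ℝ] E} {φ : E → E →L[ℝ] ℝ} {y : E}

/-- `(g, I, J, K)` is an almost hyper-Hermitian structure on the open subset `V` of `E`. -/
structure IsHermitianOn (V : Set E) (g : E → E →L[ℝ] E →L[ℝ] ℝ) (I J K : E → E →L[ℝ] E) : Prop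
    extends IsMetricOn V g where
  smoothI : ContDiffOn ℝ ∞ I V
  smoothJ : ContDiffOn ℝ ∞ J V
  smoothK : ContDiffOn ℝ ∞ K V
  herm : ∀ y ∈ V, IsQuaternionHermitian (g y) (I y) (J y) (K y)

/-- The Levi-Civita connection of `g` acts on `I`, `J`, `K` as it does on a hyper-Hermitian
quaternionic Kähler manifold with Lee form `φ`. -/
structure IsLeeConnectionOn (V : Set E) (g : E → E →L[ℝ] E →L[ℝ] ℝ) (I J K : E → E →L[ℝ] E)
    (φ : E → E →L[ℝ] ℝ) : Prop where
  covI : ∀ y ∈ V, ∀ u w,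
    covDerivEnd g I y u w = φ y (J y u) • K y w - φ y (K y u) • J y w
  covJ : ∀ y ∈ V, ∀ u w,
    covDerivEnd g J y u w = φ y (K y u) • I y w - φ y (I y u) • K y w
  covK : ∀ y ∈ V, ∀ u w,
    covDerivEnd g K y u w = φ y (I y u) • J y w - φ y (J y u) • I y w

theorem IsLeeConnectionOn.cycle (h : IsLeeConnectionOn V g I J K φ) :
    IsLeeConnectionOn V g J K I φ := ⟨h.covJ, h.covK, h.covI⟩

theorem IsHermitianOn.cycle (h : IsHermitianOn V g I J K) : IsHermitianOn V g J K I :=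
  { h.toIsMetricOn with
    smoothI := h.smoothJ, smoothJ := h.smoothK, smoothK := h.smoothI
    herm := fun y hy => (h.herm y hy).cycle }

theorem IsHermitianOn.contDiffAtI (h : IsHermitianOn V g I J K) (hy : y ∈ V) :
    ContDiffAt ℝ ∞ I y := h.smoothI.contDiffAt (h.isOpen.mem_nhds hy)

/-- The Levi-Civita covariant derivative of a `1`-form. -/
def covDerivForm (g : E → E →L[ℝ] E →L[ℝ] ℝ) (φ : E → E →L[ℝ] ℝ) (y : E) : E →L[ℝ] E →L[ℝ] ℝ :=
  fderiv ℝ φ y - (ContinuousLinearMap.postcomp E (φ y)) ∘L christoffel g y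

theorem covDerivForm_apply (u v : E) :
    covDerivForm g φ y u v = fderiv ℝ φ y u v - φ y (christoffel g y u v) := by
  simp [covDerivForm]

/-- The component of the curvature of `span {I, J, K}` that is attached to `I`, in terms of the
Lee form `φ` and its covariant derivative `F`. -/
def leeCurv (I J K : E →L[ℝ] E) (φ : E →L[ℝ] ℝ) (F : E →L[ℝ] E →L[ℝ] ℝ) : E →L[ℝ] E →L[ℝ] ℝ :=
  F.flip ∘L I - ContinuousLinearMap.precomp ℝ I ∘L F
    + ((φ ∘L K).smulRight (φ ∘L J) - (φ ∘L J).smulRight (φ ∘L K))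

theorem leeCurv_apply (I J K : E →L[ℝ] E) (φ : E →L[ℝ] ℝ) (F : E →L[ℝ] E →L[ℝ] ℝ) (u v : E) :
    leeCurv I J K φ F u v = F v (I u) - F u (I v) + (φ (K u) * φ (J v) - φ (J u) * φ (K v)) := by
  simp [leeCurv]

variable [FiniteDimensional ℝ E]

theorem nijenhuis_eq (h : IsMetricOn V g) (hy : y ∈ V) (A : E → E →L[ℝ] E) (u v : E) :
    nijenhuis A y u v = covDerivEnd g A y (A y u) v - covDerivEnd g A y (A y v) u
      + A y (covDerivEnd g A y v u) - A y (covDerivEnd g A y u v) := by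
  simp only [nijenhuis, covDerivEnd_apply, map_add, map_sub]
  rw [h.christoffel_symm hy (A y u) v, h.christoffel_symm hy (A y v) u,
    h.christoffel_symm hy (A y u) (A y v), h.christoffel_symm hy u v]
  rw [h.christoffel_symm hy v (A y u)]
  abel

omit [FiniteDimensional ℝ E] in
/-- The product rule for the composition of endomorphism fields. -/
theorem covDerivEnd_comp {A B C : E → E →L[ℝ] E} (hV : IsOpen V) (hy : y ∈ V)
    (hA : DifferentiableAt ℝ A y) (hB : DifferentiableAt ℝ B y) (hC : DifferentiableAt ℝ C y)
    (hABC : ∀ z ∈ V, ∀ w, A z (B z w) = C z w) (u w : E) :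
    covDerivEnd g C y u w = covDerivEnd g A y u (B y w) + A y (covDerivEnd g B y u w) := by
  have h1 : (fun z => C z w) =ᶠ[𝓝 y] fun z => A z (B z w) :=
    Filter.eventually_of_mem (hV.mem_nhds hy) fun z hz => (hABC z hz w).symm
  have h2 := congrArg (fun L : E →L[ℝ] E => L u) h1.fderiv_eq
  rw [fderiv_eval_const hC, fderiv_eval hA (f := fun z => B z w) (by fun_prop),
    fderiv_eval_const hB] at h2
  simp only [covDerivEnd_apply, h2, map_add, map_sub, ← hABC y hy]
  abel

omit [FiniteDimensional ℝ E] in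
theorem covDerivEnd_sq {A : E → E →L[ℝ] E} (hV : IsOpen V) (hy : y ∈ V)
    (hA : DifferentiableAt ℝ A y) (hsq : ∀ z ∈ V, ∀ w, A z (A z w) = -w) (u w : E) :
    covDerivEnd g A y u (A y w) + A y (covDerivEnd g A y u w) = 0 := by
  rw [← covDerivEnd_comp (C := fun _ => -ContinuousLinearMap.id ℝ E) hV hy hA hA
    (by fun_prop) (fun z hz w => by simp [hsq z hz w])]
  simp [covDerivEnd_apply]

/-- The Lee form as a field of continuous linear forms. -/
def leeFormCLM (g : E → E →L[ℝ] E →L[ℝ] ℝ) (A : E → E →L[ℝ] E) (y : E) : E →L[ℝ] ℝ :=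
  (1 / 2 : ℝ) • (traceCLM E ∘L ContinuousLinearMap.postcomp E (A y) ∘L (covDerivEnd g A y).flip)

theorem contDiffAt_covDerivEnd (h : IsMetricOn V g) (hy : y ∈ V) {A : E → E →L[ℝ] E}
    (hA : ContDiffAt ℝ ∞ A y) : ContDiffAt ℝ ∞ (covDerivEnd g A) y := by
  have hΓ := h.contDiffAt_christoffel hy
  unfold covDerivEnd
  refine ((contDiffAt_fderiv hA).add (ContDiffAt.clm_comp ?_ hΓ)).sub (ContDiffAt.clm_comp ?_ hΓ)
  · exact (ContinuousLinearMap.compL ℝ E E E).flip.contDiff.contDiffAt.comp y hA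
  · exact (ContinuousLinearMap.compL ℝ E E E).contDiff.contDiffAt.comp y hA

theorem contDiffAt_leeFormCLM (h : IsMetricOn V g) (hy : y ∈ V) {A : E → E →L[ℝ] E}
    (hA : ContDiffAt ℝ ∞ A y) : ContDiffAt ℝ ∞ (leeFormCLM g A) y := by
  unfold leeFormCLM
  refine ContDiffAt.const_smul (1 / 2 : ℝ) (contDiffAt_const.clm_comp (ContDiffAt.clm_comp ?_ ?_))
  · exact (ContinuousLinearMap.compL ℝ E E E).contDiff.contDiffAt.comp y hA
  · exact (ContinuousLinearMap.flipₗᵢ ℝ E E E).contDiff.contDiffAt.comp y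
      (contDiffAt_covDerivEnd h hy hA)

namespace IsLeeConnectionOn

theorem leeForm_eq (hφ : IsLeeConnectionOn V g I J K φ) (h : IsHermitianOn V g I J K)
    (hy : y ∈ V) (v : E) : leeForm g I y v = φ y v := by
  have hq := (h.herm y hy).quat
  have e : I y ∘L (covDerivEnd g I y).flip v =
      -((φ y ∘L J y).smulRight (J y v)) - (φ y ∘L K y).smulRight (K y v) := by
    ext w
    simp only [ContinuousLinearMap.comp_apply, ContinuousLinearMap.flip_apply, sub_apply,
      neg_apply, ContinuousLinearMap.smulRight_apply, hφ.covI y hy, map_sub, map_smul, hq.IJ, hq.IK]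
    module
  rw [leeForm, e]
  simp only [ContinuousLinearMap.toLinearMap_sub, ContinuousLinearMap.toLinearMap_neg, map_sub,
    map_neg, trace_rankOne, ContinuousLinearMap.comp_apply, hq.JJ, hq.KK]
  ring

/-- The curvature commutator with `I` in terms of the Lee form. -/
theorem riemann_comm_I (hφ : IsLeeConnectionOn V g I J K φ) (h : IsHermitianOn V g I J K)
    (hy : y ∈ V) (dφ : DifferentiableAt ℝ φ y) (u v w : E) :
    riemann g y u v (I y w) - I y (riemann g y u v w) =
      leeCurv (K y) (I y) (J y) (φ y) (covDerivForm g φ y) u v • J y w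
        - leeCurv (J y) (K y) (I y) (φ y) (covDerivForm g φ y) u v • K y w := by
  have dJ := differentiableAt_of_smooth (h.cycle.contDiffAtI hy)
  have dK := differentiableAt_of_smooth (h.cycle.cycle.contDiffAtI hy)
  have hcomm := h.riemann_comm hy (h.contDiffAtI hy) dJ dK
    (b := fun z => -(φ z ∘L J z)) (c := fun z => -(φ z ∘L K z)) (by fun_prop) (by fun_prop)
    (fun z hz v w => by
      rw [hφ.covI z hz]
      simp only [neg_apply, ContinuousLinearMap.comp_apply]
      module) u v w
  have dcomp : ∀ {A : E → E →L[ℝ] E}, DifferentiableAt ℝ A y → ∀ u v,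
      fderiv ℝ (fun z => -(φ z ∘L A z)) y u v =
        -(covDerivForm g φ y u (A y v) + φ y (covDerivEnd g A y u v)
          + φ y (A y (christoffel g y u v))) := by
    intro A dA u v
    rw [← fderiv_eval_const (A := fun z => -(φ z ∘L A z)) (by fun_prop)]
    have : (fun z => (-(φ z ∘L A z)) v) = fun z => -(φ z (A z v)) := by ext z; simp
    rw [this, fderiv_fun_neg, neg_apply, fderiv_eval dφ (f := fun z => A z v) (by fun_prop),
      fderiv_eval_const dA, covDerivForm_apply, covDerivEnd_apply]
    simp only [map_sub, map_add]
    ring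
  rw [hcomm, dcomp dJ, dcomp dJ, dcomp dK, dcomp dK]
  simp only [hφ.covJ y hy, hφ.covK y hy, h.christoffel_symm hy v u, leeCurv_apply, map_sub,
    map_smul, smul_eq_mul, neg_apply, ContinuousLinearMap.comp_apply]
  module

theorem isQuaternionicCurvature (hφ : IsLeeConnectionOn V g I J K φ)
    (h : IsHermitianOn V g I J K) (hy : y ∈ V) (dφ : DifferentiableAt ℝ φ y) :
    IsQuaternionicCurvature (g y) (I y) (J y) (K y) (riemannCLM g y)
      (leeCurv (I y) (J y) (K y) (φ y) (covDerivForm g φ y))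
      (leeCurv (J y) (K y) (I y) (φ y) (covDerivForm g φ y))
      (leeCurv (K y) (I y) (J y) (φ y) (covDerivForm g φ y)) where
  skew u v w := by simp only [riemannCLM_apply]; exact IsMetricOn.riemann_skew u v w
  bianchi u v w := by simp only [riemannCLM_apply]; exact h.riemann_bianchi hy u v w
  metric u v w z := by simp only [riemannCLM_apply]; exact h.riemann_metric hy u v w z
  commI u v w := by simp only [riemannCLM_apply]; exact hφ.riemann_comm_I h hy dφ u v w
  commJ u v w := by
    simp only [riemannCLM_apply]; exact hφ.cycle.riemann_comm_I h.cycle hy dφ u v w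
  commK u v w := by
    simp only [riemannCLM_apply]; exact hφ.cycle.cycle.riemann_comm_I h.cycle.cycle hy dφ u v w

end IsLeeConnectionOn

theorem scalarCurvature_eq (h : IsMetricOn V g) (hy : y ∈ V) {c : ℝ}
    (hric : ∀ v w, ricciOf (riemannCLM g y) v w = c * g y v w) :
    scalarCurvature g y = Module.finrank ℝ E * c := by
  unfold scalarCurvature
  have : (((g y).inverse : (E →L[ℝ] ℝ) →ₗ[ℝ] E) ∘ₗ
      ((LinearMap.toContinuousLinearMap : (E →ₗ[ℝ] ℝ) ≃ₗ[ℝ] (E →L[ℝ] ℝ)) :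
        (E →ₗ[ℝ] ℝ) →ₗ[ℝ] (E →L[ℝ] ℝ)) ∘ₗ ricci g y) = c • LinearMap.id := by
    ext v
    refine inverse_apply_eq (h.nondeg y hy) fun w => ?_
    change g y (c • v) w = ricci g y v w
    rw [ricci_eq_ricciOf, hric]
    simp
  rw [this, map_smul, LinearMap.trace_id]
  simp [mul_comm]

/-- A metric with the connection of an hHqK structure whose span `span {I, J, K}` has curvature
`ν` times the Kähler forms has scalar curvature `4n(n+2)ν`. -/
theorem scalarCurvature_of_leeCurv {n : ℕ} (hn : Module.finrank ℝ E = 4 * n) {ν : ℝ}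
    (hφ : IsLeeConnectionOn V g I J K φ) (h : IsHermitianOn V g I J K) (hy : y ∈ V)
    (dφ : DifferentiableAt ℝ φ y)
    (hα : ∀ u v, leeCurv (I y) (J y) (K y) (φ y) (covDerivForm g φ y) u v = ν * g y u (I y v))
    (hβ : ∀ u v, leeCurv (J y) (K y) (I y) (φ y) (covDerivForm g φ y) u v = ν * g y u (J y v))
    (hγ : ∀ u v, leeCurv (K y) (I y) (J y) (φ y) (covDerivForm g φ y) u v = ν * g y u (K y v)) :
    scalarCurvature g y = 4 * n * (n + 2) * ν := by
  rw [scalarCurvature_eq h.toIsMetricOn hy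
    ((hφ.isQuaternionicCurvature h hy dφ).ricciOf_eq_of_eq (h.herm y hy) hα hβ hγ), hn]
  push_cast
  ring

/-- Conversely, the curvature of `span {I, J, K}` is determined by the scalar curvature. -/
theorem leeCurv_of_scalarCurvature {n : ℕ} (hn1 : 1 < n) (hn : Module.finrank ℝ E = 4 * n) {ν : ℝ}
    (hφ : IsLeeConnectionOn V g I J K φ) (h : IsHermitianOn V g I J K) (hy : y ∈ V)
    (dφ : DifferentiableAt ℝ φ y) (hpos : ∀ u, u ≠ 0 → 0 < g y u u)
    (hs : scalarCurvature g y = 4 * n * (n + 2) * ν) :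
    (∀ u v, leeCurv (I y) (J y) (K y) (φ y) (covDerivForm g φ y) u v = ν * g y u (I y v)) ∧
    (∀ u v, leeCurv (J y) (K y) (I y) (φ y) (covDerivForm g φ y) u v = ν * g y u (J y v)) ∧
    (∀ u v, leeCurv (K y) (I y) (J y) (φ y) (covDerivForm g φ y) u v = ν * g y u (K y v)) := by
  obtain ⟨ν', hα, hβ, hγ⟩ := (hφ.isQuaternionicCurvature h hy dφ).exists_const (h.herm y hy)
    (by omega) (by omega) hpos
  have h1 := scalarCurvature_of_leeCurv hn hφ h hy dφ hα hβ hγ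
  rw [hs] at h1
  have hn0 : (0 : ℝ) < n := by exact_mod_cast (by omega : 0 < n)
  have : ν = ν' := mul_left_cancel₀ (by positivity) h1
  rw [this]
  exact ⟨hα, hβ, hγ⟩

/-- The hypotheses of a hyper-Hermitian quaternionic Kähler structure determine the covariant
derivatives of `I`, `J`, `K` by the Lee form of `I`. -/
theorem isLeeConnectionOn_of_parallelSpan [Nontrivial E] (h : IsHermitianOn V g I J K)
    (hspan : ∀ y ∈ V, ∀ u, covDerivEnd g I y u ∈ Submodule.span ℝ {I y, J y, K y} ∧
      covDerivEnd g J y u ∈ Submodule.span ℝ {I y, J y, K y})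
    (nijI : ∀ y ∈ V, ∀ u v, nijenhuis I y u v = 0) (nijJ : ∀ y ∈ V, ∀ u v, nijenhuis J y u v = 0) :
    IsLeeConnectionOn V g I J K (leeFormCLM g I) := by
  have key : ∀ y ∈ V, _ := fun y hy => (h.herm y hy).quat.connection_eq
    (fun u => (hspan y hy u).1) (fun u => (hspan y hy u).2)
    (covDerivEnd_sq h.isOpen hy (differentiableAt_of_smooth (h.contDiffAtI hy))
      fun z hz => (h.herm z hz).quat.II)
    (covDerivEnd_sq h.isOpen hy (differentiableAt_of_smooth (h.cycle.contDiffAtI hy))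
      fun z hz => (h.herm z hz).quat.JJ)
    (covDerivEnd_sq h.isOpen hy (differentiableAt_of_smooth (h.cycle.cycle.contDiffAtI hy))
      fun z hz => (h.herm z hz).quat.KK)
    (covDerivEnd_comp h.isOpen hy (differentiableAt_of_smooth (h.contDiffAtI hy))
      (differentiableAt_of_smooth (h.cycle.contDiffAtI hy))
      (differentiableAt_of_smooth (h.cycle.cycle.contDiffAtI hy))
      fun z hz => (h.herm z hz).quat.IJ)
    (fun u v => by rw [← nijenhuis_eq h.toIsMetricOn hy, nijI y hy])
    (fun u v => by rw [← nijenhuis_eq h.toIsMetricOn hy, nijJ y hy])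
    (φ := leeFormCLM g I y) (fun v => rfl)
  exact ⟨fun y hy => (key y hy).1, fun y hy => (key y hy).2.1, fun y hy => (key y hy).2.2⟩

end Hermitian

end QuaternionicGeometry

namespace QuaternionicGeometry

/-! ### The two metric constructions on a vector space -/

section Constructions

variable {E : Type*} [NormedAddCommGroup E] [NormedSpace ℝ E]
  {g : E →L[ℝ] E →L[ℝ] ℝ} {I J K : E →L[ℝ] E} {φ : E →L[ℝ] ℝ} {ν p : ℝ}

/-- The square norm `g(φ, φ)` of a linear form. -/
def formNormSq (g : E →L[ℝ] E →L[ℝ] ℝ) (φ : E →L[ℝ] ℝ) : ℝ := φ (g.inverse φ)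

/-- The bilinear form `ν⁻² (g(φ,φ) + ν) ((1 + L) φ ⊗ φ + ν g)`. -/
def hkForm (ν : ℝ) (g : E →L[ℝ] E →L[ℝ] ℝ) (I J K : E →L[ℝ] E) (φ : E →L[ℝ] ℝ) :
    E →L[ℝ] E →L[ℝ] ℝ :=
  (1 / ν ^ 2 * (formNormSq g φ + ν)) • (quatSq I J K φ + ν • g)

/-- The bilinear form `-p (p g(φ,φ) + 1)⁻² (1 + L) φ ⊗ φ + (p g(φ,φ) + 1)⁻¹ g`. -/
def qkForm (p : ℝ) (g : E →L[ℝ] E →L[ℝ] ℝ) (I J K : E →L[ℝ] E) (φ : E →L[ℝ] ℝ) :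
    E →L[ℝ] E →L[ℝ] ℝ :=
  (-(p / (p * formNormSq g φ + 1) ^ 2)) • quatSq I J K φ
    + (1 / (p * formNormSq g φ + 1)) • g

theorem hkForm_apply (u v : E) : hkForm ν g I J K φ u v =
    1 / ν ^ 2 * (formNormSq g φ + ν) * (quatSq I J K φ u v + ν * g u v) := by
  simp only [hkForm, smul_apply, add_apply, smul_eq_mul]

theorem qkForm_apply (u v : E) : qkForm p g I J K φ u v =
    -(p / (p * formNormSq g φ + 1) ^ 2) * quatSq I J K φ u v
      + 1 / (p * formNormSq g φ + 1) * g u v := by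
  simp [qkForm]

theorem quatSq_symm (u v : E) : quatSq I J K φ u v = quatSq I J K φ v u := by
  simp only [quatSq_apply]; ring

theorem quatSq_cycle (I J K : E →L[ℝ] E) (φ : E →L[ℝ] ℝ) :
    quatSq J K I φ = quatSq I J K φ := by
  ext u v; simp only [quatSq_apply]; ring

theorem quatSq_smul (c : ℝ) : quatSq I J K (c • φ) = c ^ 2 • quatSq I J K φ := by
  ext u v; simp only [quatSq_apply, smul_apply, smul_eq_mul]; ring

theorem IsQuaternionic.quatSq_orth (h : IsQuaternionic I J K) (u v : E) :
    quatSq I J K φ (I u) (I v) = quatSq I J K φ u v := by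
  simp only [quatSq_apply, h.II, h.JI, h.KI, map_neg]; ring

/-- A symmetric bilinear form that is a combination of `(1 + L) φ ⊗ φ` and a quaternion-Hermitian
form is quaternion-Hermitian as soon as it is nondegenerate. -/
theorem IsQuaternionHermitian.combination (h : IsQuaternionHermitian g I J K) {a b : ℝ}
    (hnd : ∀ u, (∀ v, a * quatSq I J K φ u v + b * g u v = 0) → u = 0)
    {k : E →L[ℝ] E →L[ℝ] ℝ} (hk : ∀ u v, k u v = a * quatSq I J K φ u v + b * g u v) :
    IsQuaternionHermitian k I J K where
  quat := h.quat
  symm u v := by rw [hk, hk, quatSq_symm, h.symm]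
  nondeg u hu := hnd u fun v => by rw [← hk, hu]
  orthI u v := by rw [hk, hk, h.quat.quatSq_orth, h.orthI]
  orthJ u v := by rw [hk, hk, ← quatSq_cycle, h.quat.cycle.quatSq_orth, h.orthJ]
  orthK u v := by
    rw [hk, hk, ← quatSq_cycle, ← quatSq_cycle, h.quat.cycle.cycle.quatSq_orth, h.orthK]

variable [FiniteDimensional ℝ E]

namespace IsQuaternionHermitian

theorem apply_sharp (h : IsQuaternionHermitian g I J K) (v : E) : g (g.inverse φ) v = φ v := by
  rw [apply_inverse h.nondeg]

theorem form_I_sharp (h : IsQuaternionHermitian g I J K) : φ (I (g.inverse φ)) = 0 := by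
  rw [← h.apply_sharp, h.apply_I_self]

theorem form_J_sharp (h : IsQuaternionHermitian g I J K) : φ (J (g.inverse φ)) = 0 :=
  h.cycle.form_I_sharp

theorem form_K_sharp (h : IsQuaternionHermitian g I J K) : φ (K (g.inverse φ)) = 0 :=
  h.cycle.cycle.form_I_sharp

/-- On the dual vector of `φ` the form `(1 + L) φ ⊗ φ` is `g(φ, φ) φ`. -/
theorem quatSq_sharp (h : IsQuaternionHermitian g I J K) (v : E) :
    quatSq I J K φ (g.inverse φ) v = formNormSq g φ * φ v := by
  rw [quatSq_apply, h.form_I_sharp, h.form_J_sharp, h.form_K_sharp, formNormSq]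
  ring

/-- `a (1 + L) φ ⊗ φ + b g` is nondegenerate when `b` and `a g(φ, φ) + b` do not vanish. -/
theorem nondeg_combination (h : IsQuaternionHermitian g I J K) {a b : ℝ} (hb : b ≠ 0)
    (hab : a * formNormSq g φ + b ≠ 0) (u : E)
    (hu : ∀ v, a * quatSq I J K φ u v + b * g u v = 0) : u = 0 := by
  have key : ∀ A B C : E →L[ℝ] E, IsQuaternionHermitian g A B C →
      quatSq A B C φ = quatSq I J K φ → φ (A u) = 0 := by
    intro A B C hA hQ
    have h1 := hu (-A (g.inverse φ))
    have h2 := hA.quat.quatSq_orth (φ := φ) (A u) (-(g.inverse φ))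
    rw [hA.quat.II, map_neg] at h2
    have h3 : quatSq A B C φ u (-A (g.inverse φ)) = formNormSq g φ * φ (A u) := by
      have : quatSq A B C φ (A u) (-(g.inverse φ)) = -(formNormSq g φ * φ (A u)) := by
        rw [map_neg, quatSq_symm, hA.quatSq_sharp]
      rw [this, map_neg, neg_apply] at h2
      linarith
    rw [← hQ, h3, map_neg, ← hA.skewI, hA.symm, hA.apply_sharp] at h1
    have h4 : (a * formNormSq g φ + b) * φ (A u) = 0 := by linarith
    exact (mul_eq_zero.1 h4).resolve_left hab
  have k0 : φ u = 0 := by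
    have h1 := hu (g.inverse φ)
    rw [quatSq_symm, h.quatSq_sharp, h.symm, h.apply_sharp] at h1
    have h4 : (a * formNormSq g φ + b) * φ u = 0 := by linarith
    exact (mul_eq_zero.1 h4).resolve_left hab
  have k1 := key I J K h rfl
  have k2 := key J K I h.cycle (quatSq_cycle I J K φ)
  have k3 := key K I J h.cycle.cycle ((quatSq_cycle J K I φ).trans (quatSq_cycle I J K φ))
  refine h.nondeg u fun v => ?_
  have h1 := hu v
  rw [quatSq_apply, k0, k1, k2, k3] at h1
  have h4 : b * g u v = 0 := by linarith
  exact (mul_eq_zero.1 h4).resolve_left hb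

theorem hkForm (h : IsQuaternionHermitian g I J K) (hν : ν ≠ 0)
    (hw : formNormSq g φ + ν ≠ 0) : IsQuaternionHermitian (hkForm ν g I J K φ) I J K := by
  have hc : 1 / ν ^ 2 * (formNormSq g φ + ν) ≠ 0 := mul_ne_zero (by positivity) hw
  refine h.combination (φ := φ) (a := 1 / ν ^ 2 * (formNormSq g φ + ν))
    (b := 1 / ν ^ 2 * (formNormSq g φ + ν) * ν)
    (h.nondeg_combination (mul_ne_zero hc hν) ?_) fun u v => by rw [hkForm_apply]; ring
  rw [show ∀ c N : ℝ, c * N + c * ν = c * (N + ν) by intros; ring]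
  exact mul_ne_zero hc hw

theorem qkForm (h : IsQuaternionHermitian g I J K) (hd : p * formNormSq g φ + 1 ≠ 0) :
    IsQuaternionHermitian (qkForm p g I J K φ) I J K := by
  refine h.combination (φ := φ) (h.nondeg_combination (by positivity) ?_)
    fun u v => qkForm_apply u v
  have : -(p / (p * formNormSq g φ + 1) ^ 2) * formNormSq g φ + 1 / (p * formNormSq g φ + 1)
      = 1 / (p * formNormSq g φ + 1) ^ 2 := by
    field_simp; ring
  rw [this]
  positivity

theorem formNormSq_hkForm (h : IsQuaternionHermitian g I J K) (hν : ν ≠ 0)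
    (hw : formNormSq g φ + ν ≠ 0) :
    formNormSq (QuaternionicGeometry.hkForm ν g I J K φ) φ =
      ν ^ 2 / (formNormSq g φ + ν) ^ 2 * formNormSq g φ := by
  have : (QuaternionicGeometry.hkForm ν g I J K φ).inverse φ =
      (ν ^ 2 / (formNormSq g φ + ν) ^ 2) • g.inverse φ := by
    refine inverse_apply_eq (h.hkForm hν hw).nondeg fun v => ?_
    rw [map_smul, smul_apply, hkForm_apply, h.quatSq_sharp, h.apply_sharp, smul_eq_mul]
    field_simp
  rw [formNormSq, this, map_smul, smul_eq_mul, formNormSq]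

theorem formNormSq_qkForm (h : IsQuaternionHermitian g I J K) (hd : p * formNormSq g φ + 1 ≠ 0) :
    formNormSq (QuaternionicGeometry.qkForm p g I J K φ) φ =
      (p * formNormSq g φ + 1) ^ 2 * formNormSq g φ := by
  have : (QuaternionicGeometry.qkForm p g I J K φ).inverse φ =
      ((p * formNormSq g φ + 1) ^ 2) • g.inverse φ := by
    refine inverse_apply_eq (h.qkForm hd).nondeg fun v => ?_
    rw [map_smul, smul_apply, qkForm_apply, h.quatSq_sharp, h.apply_sharp, smul_eq_mul]
    field_simp
    ring
  rw [formNormSq, this, map_smul, smul_eq_mul, formNormSq]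

end IsQuaternionHermitian

omit [FiniteDimensional ℝ E] in
theorem formNormSq_smul (c : ℝ) : formNormSq g (c • φ) = c ^ 2 * formNormSq g φ := by
  have : g.inverse (c • φ) = c • g.inverse φ := map_smul _ _ _
  rw [formNormSq, this, map_smul, smul_apply, smul_eq_mul, smul_eq_mul, formNormSq]
  ring

/-- The metric `g` is recovered from `g₀` and `dμ = -2ν⁻²(g(φ,φ) + ν) φ`. -/
theorem qkForm_hkForm (h : IsQuaternionHermitian g I J K) (hν : ν ≠ 0)
    (hw : formNormSq g φ + ν ≠ 0) {m : E →L[ℝ] ℝ}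
    (hm : m = (-(2 / ν ^ 2 * (formNormSq g φ + ν))) • φ) :
    ν / 4 * formNormSq (hkForm ν g I J K φ) m + 1 ≠ 0 ∧
      qkForm (ν / 4) (hkForm ν g I J K φ) I J K m = g := by
  have h1 : ν / 4 * formNormSq (hkForm ν g I J K φ) m + 1 = (formNormSq g φ + ν) / ν := by
    rw [hm, formNormSq_smul, h.formNormSq_hkForm hν hw]
    field_simp
    ring
  refine ⟨by rw [h1]; exact div_ne_zero hw hν, ?_⟩
  ext u v
  rw [qkForm_apply, h1, hkForm_apply, hm, quatSq_smul, smul_apply, smul_apply, smul_eq_mul]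
  field_simp
  ring

/-- The metric `g₀` is recovered from `g_p` and `φ_p = -2p (p g₀(dμ,dμ) + 1)⁻¹ dμ`. -/
theorem hkForm_qkForm (h : IsQuaternionHermitian g I J K) (hp : p ≠ 0) {m : E →L[ℝ] ℝ}
    (hd : p * formNormSq g m + 1 ≠ 0) (hφ : φ = (-(2 * p / (p * formNormSq g m + 1))) • m) :
    formNormSq (qkForm p g I J K m) φ + 4 * p ≠ 0 ∧
      hkForm (4 * p) (qkForm p g I J K m) I J K φ = g := by
  have h1 : formNormSq (qkForm p g I J K m) φ + 4 * p = 4 * p * (p * formNormSq g m + 1) := by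
    rw [hφ, formNormSq_smul, h.formNormSq_qkForm hd]
    field_simp
    ring
  refine ⟨by rw [h1]; positivity, ?_⟩
  ext u v
  rw [hkForm_apply, h1, qkForm_apply, hφ, quatSq_smul, smul_apply, smul_apply, smul_eq_mul]
  field_simp
  ring

end Constructions

end QuaternionicGeometry

namespace QuaternionicGeometry

/-! ### From quaternionic Kähler to hyper-Kähler, in a coordinate domain -/

section ToHyperKahler

open scoped Topology

variable {E : Type*} [NormedAddCommGroup E] [NormedSpace ℝ E]

/-- Closedness of the Lee form and constancy of the curvature of `span {I, J, K}` determine the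
covariant derivative `F` of the Lee form. -/
theorem IsQuaternionHermitian.form_of_leeCurv {g : E →L[ℝ] E →L[ℝ] ℝ} {I J K : E →L[ℝ] E}
    {φ : E →L[ℝ] ℝ} {F : E →L[ℝ] E →L[ℝ] ℝ} {ν : ℝ} (h : IsQuaternionHermitian g I J K)
    (hF : ∀ u v, F u v = F v u)
    (hα : ∀ u v, leeCurv I J K φ F u v = ν * g u (I v))
    (hβ : ∀ u v, leeCurv J K I φ F u v = ν * g u (J v))
    (hγ : ∀ u v, leeCurv K I J φ F u v = ν * g u (K v)) (u v : E) :
    F u v = -(ν / 2) * g u v - 1 / 2 * (φ u * φ v - (φ (I u) * φ (I v) + φ (J u) * φ (J v)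
      + φ (K u) * φ (K v))) := by
  have hq := h.quat
  -- the parts of `F` invariant under `I`, `J` and `K`
  have e1 := hα (J u) (I (J v))
  have e2 := hβ u (J v)
  have e3 := hγ u (K v)
  simp only [leeCurv_apply, hq.JJ, hq.KK, hq.IJ, hq.JK, hq.KJ, hq.IK,
    map_neg, h.orthJ] at e1 e2 e3
  linarith [hF (K v) (K u), hF (J v) (J u)]

/-- A Hessian with prescribed invariant parts under `I`, `J` and `K`. -/
theorem IsQuaternionHermitian.hessian_eq {g : E →L[ℝ] E →L[ℝ] ℝ} {I J K : E →L[ℝ] E}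
    {F : E →L[ℝ] E →L[ℝ] ℝ} (h : IsQuaternionHermitian g I J K) (hF : ∀ u v, F u v = F v u)
    (hI : ∀ u v, 1 / 2 * (F v (I u) - F u (I v)) = g (I u) v)
    (hJ : ∀ u v, 1 / 2 * (F v (J u) - F u (J v)) = g (J u) v)
    (hK : ∀ u v, 1 / 2 * (F v (K u) - F u (K v)) = g (K u) v) (u v : E) :
    F u v = g u v := by
  have hq := h.quat
  have e1 := hI (J u) (I (J v))
  have e2 := hJ u (J v)
  have e3 := hK u (K v)
  simp only [hq.JJ, hq.KK, hq.IJ, hq.IK,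
    map_neg, h.orthJ, h.orthK] at e1 e2 e3
  linarith [hF (K v) (K u), hF (J v) (J u)]

/-- The pointwise identity behind `∇⁰ g₀ = 0`: here `P` is the covariant derivative of `φ` for the
Obata connection. -/
theorem IsQuaternionHermitian.shift_identity {g : E →L[ℝ] E →L[ℝ] ℝ} {I J K : E →L[ℝ] E}
    {φ : E →L[ℝ] ℝ} {ν : ℝ} (h : IsQuaternionHermitian g I J K) {P : E → E → ℝ}
    (hP : ∀ u v, P u v = -(ν / 2) * g u v + 1 / 2 * (φ u * φ v - (φ (I u) * φ (I v)
      + φ (J u) * φ (J v) + φ (K u) * φ (K v)))) (u v w : E) :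
    P u v * φ w + φ v * P u w + (P u (I v) * φ (I w) + φ (I v) * P u (I w)
      + (P u (J v) * φ (J w) + φ (J v) * P u (J w))
      + (P u (K v) * φ (K w) + φ (K v) * P u (K w)))
      - ν * (g (quatShift I J K φ u v) w + g v (quatShift I J K φ u w))
      = φ u * (quatSq I J K φ v w + ν * g v w) := by
  have hq := h.quat
  simp only [hP, quatSq_apply, quatShift, map_add, map_sub, map_smul, map_neg, add_apply, sub_apply,
    smul_apply, smul_eq_mul, h.skewI, h.skewJ, h.skewK, hq.II, hq.JJ, hq.KK, hq.IJ,
    hq.JK, hq.KI, hq.JI, hq.KJ, hq.IK, h.symm v u, h.symm v (I u), h.symm v (J u), h.symm v (K u)]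
  ring

variable {V : Set E} {g : E → E →L[ℝ] E →L[ℝ] ℝ} {I J K : E → E →L[ℝ] E} {φ : E → E →L[ℝ] ℝ} {y : E}

theorem contDiffAt_quatSq (hI : ContDiffAt ℝ ∞ I y) (hJ : ContDiffAt ℝ ∞ J y)
    (hK : ContDiffAt ℝ ∞ K y) (hφ : ContDiffAt ℝ ∞ φ y) :
    ContDiffAt ℝ ∞ (fun z => quatSq (I z) (J z) (K z) (φ z)) y := by
  have sm : ∀ {ψ : E → E →L[ℝ] ℝ}, ContDiffAt ℝ ∞ ψ y →
      ContDiffAt ℝ ∞ (fun z => (ψ z).smulRight (ψ z)) y := fun {ψ} hψ =>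
    ContDiffAt.clm_apply
      ((ContinuousLinearMap.smulRightL ℝ E (E →L[ℝ] ℝ)).contDiff.contDiffAt.comp y hψ) hψ
  unfold quatSq
  exact (sm hφ).add (((sm (hφ.clm_comp hI)).add (sm (hφ.clm_comp hJ))).add
    (sm (hφ.clm_comp hK)))

variable [FiniteDimensional ℝ E]

theorem IsMetricOn.contDiffAt_inverse (h : IsMetricOn V g) (hy : y ∈ V) :
    ContDiffAt ℝ ∞ (fun z => (g z).inverse) y :=
  (isInvertible_of_nondegenerate (h.nondeg y hy)).contDiffAt_map_inverse.comp y (h.contDiffAt hy)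

theorem IsMetricOn.contDiffAt_formNormSq (h : IsMetricOn V g) (hy : y ∈ V)
    (hφ : ContDiffAt ℝ ∞ φ y) : ContDiffAt ℝ ∞ (fun z => formNormSq (g z) (φ z)) y :=
  hφ.clm_apply ((h.contDiffAt_inverse hy).clm_apply hφ)

theorem IsMetricOn.fderiv_formNormSq (h : IsMetricOn V g) (hy : y ∈ V)
    (hφ : ContDiffAt ℝ ∞ φ y) (u : E) :
    fderiv ℝ (fun z => formNormSq (g z) (φ z)) y u
      = 2 * covDerivForm g φ y u ((g y).inverse (φ y)) := by
  have dφ := differentiableAt_of_smooth hφ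
  have dg := differentiableAt_of_smooth (h.contDiffAt hy)
  have dξ : DifferentiableAt ℝ (fun z => (g z).inverse (φ z)) y :=
    differentiableAt_of_smooth ((h.contDiffAt_inverse hy).clm_apply hφ)
  set ξ : E → E := fun z => (g z).inverse (φ z) with hξ
  have h1 : fderiv ℝ (fun z => formNormSq (g z) (φ z)) y u =
      fderiv ℝ φ y u (ξ y) + φ y (fderiv ℝ ξ y u) := fderiv_eval dφ dξ u
  have h2 : (fun z => φ z (ξ y)) =ᶠ[𝓝 y] fun z => g z (ξ z) (ξ y) :=
    Filter.eventually_of_mem (h.isOpen.mem_nhds hy) fun z hz => by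
      simp only [hξ]; rw [apply_inverse (h.nondeg z hz)]
  have h3 := congrArg (fun L : E →L[ℝ] ℝ => L u) h2.fderiv_eq
  rw [fderiv_eval_const dφ, fderiv_eval_const (A := fun z => g z (ξ z)) (by fun_prop),
    fderiv_eval dg dξ, add_apply] at h3
  have h4 : ∀ v, g y (ξ y) v = φ y v := fun v => by
    simp only [hξ]; rw [apply_inverse (h.nondeg y hy)]
  have h5 : g y (fderiv ℝ ξ y u) (ξ y) = φ y (fderiv ℝ ξ y u) := by
    rw [h.symm y hy, h4]
  rw [h1, covDerivForm_apply]
  rw [h.fderiv_metric hy, h5, h.symm y hy _ (ξ y), h4] at h3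
  change _ = 2 * (fderiv ℝ φ y u (ξ y) - φ y (christoffel g y u (ξ y)))
  linarith

omit [FiniteDimensional ℝ E] in
/-- A connection that differs from the Levi-Civita connection of `g` by `quatShift` preserves
`I`. -/
theorem IsLeeConnectionOn.fderiv_I (hφ : IsLeeConnectionOn V g I J K φ)
    (h : IsHermitianOn V g I J K) (hy : y ∈ V) (u v : E) :
    fderiv ℝ I y u v =
      I y (christoffel g y u v + quatShift (I y) (J y) (K y) (φ y) u v)
        - (christoffel g y u (I y v) + quatShift (I y) (J y) (K y) (φ y) u (I y v)) := by
  have h1 := hφ.covI y hy u v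
  have h2 := (h.herm y hy).quat.quatShift_comm (φ y) u v
  rw [covDerivEnd_apply] at h1
  rw [map_add]
  have h3 : fderiv ℝ I y u v + christoffel g y u (I y v) - I y (christoffel g y u v)
      + (quatShift (I y) (J y) (K y) (φ y) u (I y v)
        - I y (quatShift (I y) (J y) (K y) (φ y) u v)) = 0 := by
    rw [h1, h2]; module
  rw [← sub_eq_zero, ← h3]; abel

theorem IsHermitianOn.contDiffAt_hkForm (h : IsHermitianOn V g I J K) (hy : y ∈ V) (ν : ℝ)
    (hφ : ContDiffAt ℝ ∞ φ y) :
    ContDiffAt ℝ ∞ (fun z => hkForm ν (g z) (I z) (J z) (K z) (φ z)) y := by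
  have h1 := h.contDiffAt_formNormSq hy hφ
  have h2 := contDiffAt_quatSq (h.contDiffAtI hy) (h.cycle.contDiffAtI hy)
    (h.cycle.cycle.contDiffAtI hy) hφ
  have h3 : ContDiffAt ℝ ∞ (fun z => 1 / ν ^ 2 * (formNormSq (g z) (φ z) + ν)) y :=
    contDiffAt_const.mul (h1.add contDiffAt_const)
  exact h3.smul (h2.add ((h.contDiffAt hy).const_smul ν))

theorem IsHermitianOn.isHermitianOn_hkForm (h : IsHermitianOn V g I J K) {ν : ℝ} (hν : ν ≠ 0)
    (hφ : ContDiffOn ℝ ∞ φ V) (hw : ∀ y ∈ V, formNormSq (g y) (φ y) + ν ≠ 0) :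
    IsHermitianOn V (fun z => hkForm ν (g z) (I z) (J z) (K z) (φ z)) I J K :=
  have hh := fun y hy => (h.herm y hy).hkForm hν (hw y hy)
  { isOpen := h.isOpen
    smooth := fun _ hy =>
      (h.contDiffAt_hkForm hy ν (hφ.contDiffAt (h.isOpen.mem_nhds hy))).contDiffWithinAt
    symm := fun y hy => (hh y hy).symm
    nondeg := fun y hy => (hh y hy).nondeg
    smoothI := h.smoothI
    smoothJ := h.smoothJ
    smoothK := h.smoothK
    herm := hh }

/-- The hypotheses of the passage from quaternionic Kähler to hyper-Kähler metrics in a coordinate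
domain: `φ` is the Lee form, and its covariant derivative is the one that closedness and the
curvature `ν` impose. -/
structure IsClosedLeeOn (V : Set E) (g : E → E →L[ℝ] E →L[ℝ] ℝ) (I J K : E → E →L[ℝ] E)
    (φ : E → E →L[ℝ] ℝ) (ν : ℝ) : Prop where
  herm : IsHermitianOn V g I J K
  smooth : ContDiffOn ℝ ∞ φ V
  conn : IsLeeConnectionOn V g I J K φ
  cov : ∀ y ∈ V, ∀ u v, covDerivForm g φ y u v = -(ν / 2) * g y u v
    - 1 / 2 * (φ y u * φ y v - (φ y (I y u) * φ y (I y v) + φ y (J y u) * φ y (J y v)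
      + φ y (K y u) * φ y (K y v)))

namespace IsClosedLeeOn

variable {ν : ℝ}

omit [FiniteDimensional ℝ E] in
theorem contDiffAt (h : IsClosedLeeOn V g I J K φ ν) (hy : y ∈ V) : ContDiffAt ℝ ∞ φ y :=
  h.smooth.contDiffAt (h.herm.isOpen.mem_nhds hy)

theorem fderiv_formNormSq (h : IsClosedLeeOn V g I J K φ ν) (hy : y ∈ V) (u : E) :
    fderiv ℝ (fun z => formNormSq (g z) (φ z)) y u = -(formNormSq (g y) (φ y) + ν) * φ y u := by
  have hh := h.herm.herm y hy
  rw [h.herm.fderiv_formNormSq hy (h.contDiffAt hy), h.cov y hy, hh.form_I_sharp, hh.form_J_sharp,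
    hh.form_K_sharp, hh.symm, hh.apply_sharp, formNormSq]
  ring

omit [FiniteDimensional ℝ E] in
/-- The Obata derivative of `φ`. -/
theorem fderiv_form (h : IsClosedLeeOn V g I J K φ ν) (hy : y ∈ V) (u v : E) :
    fderiv ℝ φ y u v = (-(ν / 2) * g y u v + 1 / 2 * (φ y u * φ y v
      - (φ y (I y u) * φ y (I y v) + φ y (J y u) * φ y (J y v) + φ y (K y u) * φ y (K y v))))
      + φ y (christoffel g y u v + quatShift (I y) (J y) (K y) (φ y) u v) := by
  have h1 := h.cov y hy u v
  rw [covDerivForm_apply] at h1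
  simp only [quatShift, map_add, map_sub, map_smul, smul_eq_mul]
  linarith

omit [FiniteDimensional ℝ E] in
theorem fderiv_form_I (h : IsClosedLeeOn V g I J K φ ν)
    {A B C : E → E →L[ℝ] E} (hc : IsLeeConnectionOn V g A B C φ) (hA : IsHermitianOn V g A B C)
    (hs : ∀ u v, quatShift (A y) (B y) (C y) (φ y) u v = quatShift (I y) (J y) (K y) (φ y) u v)
    (hy : y ∈ V) (u v : E) :
    fderiv ℝ (fun z => φ z (A z v)) y u = (-(ν / 2) * g y u (A y v) + 1 / 2 * (φ y u * φ y (A y v)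
      - (φ y (I y u) * φ y (I y (A y v)) + φ y (J y u) * φ y (J y (A y v))
        + φ y (K y u) * φ y (K y (A y v)))))
      + φ y (A y (christoffel g y u v + quatShift (I y) (J y) (K y) (φ y) u v)) := by
  have dA := differentiableAt_of_smooth (hA.contDiffAtI hy)
  rw [fderiv_eval (differentiableAt_of_smooth (h.contDiffAt hy)) (f := fun z => A z v)
    (by fun_prop), fderiv_eval_const dA, h.fderiv_form hy, hc.fderiv_I hA hy]
  simp only [map_sub, map_add, hs]
  ring

/-- The Obata connection is the Levi-Civita connection of `g₀`. -/
theorem christoffel_hkForm (h : IsClosedLeeOn V g I J K φ ν) (hν : ν ≠ 0)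
    (hw : ∀ y ∈ V, formNormSq (g y) (φ y) + ν ≠ 0) (hy : y ∈ V) (u v : E) :
    christoffel (fun z => hkForm ν (g z) (I z) (J z) (K z) (φ z)) y u v =
      christoffel g y u v + quatShift (I y) (J y) (K y) (φ y) u v := by
  have hk := h.herm.isHermitianOn_hkForm hν h.smooth hw
  refine hk.christoffel_unique hy (C := fun u v => christoffel g y u v +
    quatShift (I y) (J y) (K y) (φ y) u v) (fun u v => by
    rw [h.herm.christoffel_symm hy, quatShift_symm]) (fun u v w => ?_) u v
  have dφ := differentiableAt_of_smooth (h.contDiffAt hy)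
  have dg := differentiableAt_of_smooth (h.herm.contDiffAt hy)
  have dI := differentiableAt_of_smooth (h.herm.contDiffAtI hy)
  have dJ := differentiableAt_of_smooth (h.herm.cycle.contDiffAtI hy)
  have dK := differentiableAt_of_smooth (h.herm.cycle.cycle.contDiffAtI hy)
  have dN := differentiableAt_of_smooth (h.herm.contDiffAt_formNormSq hy (h.contDiffAt hy))
  have dk := differentiableAt_of_smooth (hk.contDiffAt hy)
  have s2 : ∀ u v, quatShift (J y) (K y) (I y) (φ y) u v = quatShift (I y) (J y) (K y) (φ y) u v :=
    fun u v => (quatShift_cycle _ _ _ _ _ _).symm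
  have s3 : ∀ u v, quatShift (K y) (I y) (J y) (φ y) u v = quatShift (I y) (J y) (K y) (φ y) u v :=
    fun u v => quatShift_cycle _ _ _ _ _ _
  have dI' : ∀ v, fderiv ℝ (fun z => φ z (I z v)) y u = _ := fun v =>
    h.fderiv_form_I h.conn h.herm (fun _ _ => rfl) hy u v
  have dJ' : ∀ v, fderiv ℝ (fun z => φ z (J z v)) y u = _ := fun v =>
    h.fderiv_form_I h.conn.cycle h.herm.cycle s2 hy u v
  have dK' : ∀ v, fderiv ℝ (fun z => φ z (K z v)) y u = _ := fun v =>
    h.fderiv_form_I h.conn.cycle.cycle h.herm.cycle.cycle s3 hy u v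
  have hg' := h.herm.fderiv_metric hy u v w
  have e : (fun z => hkForm ν (g z) (I z) (J z) (K z) (φ z) v w) = fun z =>
      1 / ν ^ 2 * (formNormSq (g z) (φ z) + ν) * ((φ z v * φ z w + (φ z (I z v) * φ z (I z w)
        + φ z (J z v) * φ z (J z w) + φ z (K z v) * φ z (K z w))) + ν * g z v w) := by
    ext z; rw [hkForm_apply, quatSq_apply]
  have id := (h.herm.herm y hy).shift_identity (φ := φ y) (ν := ν) (fun _ _ => rfl) u v w
  have l : fderiv ℝ (fun z => hkForm ν (g z) (I z) (J z) (K z) (φ z)) y u v w = fderiv ℝ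
      (fun z => hkForm ν (g z) (I z) (J z) (K z) (φ z) v w) y u := by
    rw [fderiv_eval_const (A := fun z => hkForm ν (g z) (I z) (J z) (K z) (φ z) v)
      (dk.clm_apply (differentiableAt_const v)), fderiv_eval_const dk]
  rw [l, e, fderiv_fun_mul (by fun_prop) (by fun_prop), fderiv_const_mul (by fun_prop),
    fderiv_add_const, fderiv_fun_add (by fun_prop) (by fun_prop),
    fderiv_fun_add (by fun_prop) (by fun_prop), fderiv_fun_add (by fun_prop) (by fun_prop),
    fderiv_fun_add (by fun_prop) (by fun_prop), fderiv_fun_mul (by fun_prop) (by fun_prop),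
    fderiv_fun_mul (by fun_prop) (by fun_prop), fderiv_fun_mul (by fun_prop) (by fun_prop),
    fderiv_fun_mul (by fun_prop) (by fun_prop), fderiv_const_mul (by fun_prop)]
  simp only [add_apply, smul_apply, smul_eq_mul, fderiv_eval_const dφ, dI', dJ', dK',
    h.fderiv_formNormSq hy, h.fderiv_form hy]
  rw [fderiv_eval_const (A := fun z => g z v) (by fun_prop), fderiv_eval_const dg, hg']
  rw [quatSq_apply] at id
  simp only [hkForm_apply, quatSq_apply, map_add, add_apply] at id ⊢
  linear_combination (1 / ν ^ 2 * (formNormSq (g y) (φ y) + ν)) * id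

theorem covDerivEnd_hkForm (h : IsClosedLeeOn V g I J K φ ν) (hν : ν ≠ 0)
    (hw : ∀ y ∈ V, formNormSq (g y) (φ y) + ν ≠ 0) (hy : y ∈ V) (u v : E)
    {A B C : E → E →L[ℝ] E} (hc : IsLeeConnectionOn V g A B C φ) (hA : IsHermitianOn V g A B C)
    (hs : ∀ u v, quatShift (A y) (B y) (C y) (φ y) u v = quatShift (I y) (J y) (K y) (φ y) u v) :
    covDerivEnd (fun z => hkForm ν (g z) (I z) (J z) (K z) (φ z)) A y u v = 0 := by
  rw [covDerivEnd_apply, h.christoffel_hkForm hν hw hy, h.christoffel_hkForm hν hw hy,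
    hc.fderiv_I hA hy, hs, hs]
  abel

/-- The differential of the potential `2ν⁻²(g(φ,φ) + ν)`. -/
theorem fderiv_potential (h : IsClosedLeeOn V g I J K φ ν) (hy : y ∈ V) :
    fderiv ℝ (fun z => 2 / ν ^ 2 * (formNormSq (g z) (φ z) + ν)) y
      = (-(2 / ν ^ 2 * (formNormSq (g y) (φ y) + ν))) • φ y := by
  have dN := differentiableAt_of_smooth (h.herm.contDiffAt_formNormSq hy (h.contDiffAt hy))
  ext u
  rw [fderiv_const_mul (by fun_prop), fderiv_add_const, smul_apply, h.fderiv_formNormSq hy]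
  simp only [smul_apply, smul_eq_mul]
  ring

/-- The Hessian of the potential is `g₀`. -/
theorem hessian_potential (h : IsClosedLeeOn V g I J K φ ν) (hν : ν ≠ 0)
    (hw : ∀ y ∈ V, formNormSq (g y) (φ y) + ν ≠ 0) (hy : y ∈ V) (u v : E) :
    covDerivForm (fun z => hkForm ν (g z) (I z) (J z) (K z) (φ z))
      (fderiv ℝ (fun z => 2 / ν ^ 2 * (formNormSq (g z) (φ z) + ν))) y u v
      = hkForm ν (g y) (I y) (J y) (K y) (φ y) u v := by
  have dN := differentiableAt_of_smooth (h.herm.contDiffAt_formNormSq hy (h.contDiffAt hy))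
  have dφ := differentiableAt_of_smooth (h.contDiffAt hy)
  have h1 : fderiv ℝ (fun z => 2 / ν ^ 2 * (formNormSq (g z) (φ z) + ν)) =ᶠ[𝓝 y]
      fun z => (-(2 / ν ^ 2 * (formNormSq (g z) (φ z) + ν))) • φ z :=
    Filter.eventually_of_mem (h.herm.isOpen.mem_nhds hy) fun z hz => h.fderiv_potential hz
  rw [covDerivForm_apply, h1.fderiv_eq, h.fderiv_potential hy, h.christoffel_hkForm hν hw hy,
    fderiv_fun_smul (by fun_prop) dφ, fderiv_fun_neg, fderiv_const_mul (by fun_prop),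
    fderiv_add_const, hkForm_apply, quatSq_apply]
  simp only [add_apply, smul_apply, neg_apply, ContinuousLinearMap.smulRight_apply, smul_eq_mul,
    h.fderiv_formNormSq hy, h.fderiv_form hy]
  ring

end IsClosedLeeOn

/-- For a parallel endomorphism field `A`, the exterior derivative of `A m = -m ∘ A`. -/
theorem extDeriv_act {A : E → E →L[ℝ] E} {m : E → E →L[ℝ] ℝ} (h : IsMetricOn V g) (hy : y ∈ V)
    (dA : DifferentiableAt ℝ A y) (dm : DifferentiableAt ℝ m y)
    (hA : ∀ u v, covDerivEnd g A y u v = 0) (u v : E) :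
    extDeriv₁ (fun z => -(m z ∘L A z)) y u v
      = covDerivForm g m y v (A y u) - covDerivForm g m y u (A y v) := by
  have key : ∀ u v, fderiv ℝ (fun z => -(m z ∘L A z)) y u v =
      -(covDerivForm g m y u (A y v) + m y (A y (christoffel g y u v))) := by
    intro u v
    rw [← fderiv_eval_const (A := fun z => -(m z ∘L A z)) (by fun_prop)]
    have : (fun z => (-(m z ∘L A z)) v) = fun z => -(m z (A z v)) := by ext z; simp
    have h2 := hA u v
    rw [covDerivEnd_apply] at h2
    have h3 : fderiv ℝ A y u v = A y (christoffel g y u v) - christoffel g y u (A y v) := by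
      rw [← sub_eq_zero, ← h2]; abel
    rw [this, fderiv_fun_neg, neg_apply, fderiv_eval dm (f := fun z => A z v) (by fun_prop),
      fderiv_eval_const dA, covDerivForm_apply, h3, map_sub]
    ring
  rw [extDeriv₁, key, key, h.christoffel_symm hy v u]
  ring

/-- A hyper-Hermitian quaternionic Kähler metric with closed Lee form satisfies the equations for
the covariant derivative of its Lee form. -/
theorem isClosedLeeOn_of_closed {n : ℕ} (hn1 : 1 < n) (hn : Module.finrank ℝ E = 4 * n) {ν : ℝ}
    (h : IsHermitianOn V g I J K) (hφ : ContDiffOn ℝ ∞ φ V) (hc : IsLeeConnectionOn V g I J K φ)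
    (hclosed : ∀ y ∈ V, ∀ u v, extDeriv₁ φ y u v = 0)
    (hpos : ∀ y ∈ V, ∀ u, u ≠ 0 → 0 < g y u u)
    (hs : ∀ y ∈ V, scalarCurvature g y = 4 * n * (n + 2) * ν) :
    IsClosedLeeOn V g I J K φ ν where
  herm := h
  smooth := hφ
  conn := hc
  cov y hy u v := by
    have dφ := differentiableAt_of_smooth (hφ.contDiffAt (h.isOpen.mem_nhds hy))
    obtain ⟨hα, hβ, hγ⟩ := leeCurv_of_scalarCurvature hn1 hn hc h hy dφ (hpos y hy) (hs y hy)
    refine (h.herm y hy).form_of_leeCurv (fun u v => ?_) hα hβ hγ u v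
    have := hclosed y hy u v
    rw [extDeriv₁] at this
    rw [covDerivForm_apply, covDerivForm_apply, h.christoffel_symm hy u v]
    linarith

end ToHyperKahler

end QuaternionicGeometry

namespace QuaternionicGeometry

/-! ### From hyper-Kähler to quaternionic Kähler, in a coordinate domain -/

section ToQuaternionicKahler

open scoped Topology

variable {E : Type*} [NormedAddCommGroup E] [NormedSpace ℝ E]

/-- The pointwise identity behind `∇ g_p = 0`; here `t = (p g₀(dμ,dμ) + 1)⁻¹` and `m = dμ`. -/
theorem IsQuaternionHermitian.shift_identity' {g : E →L[ℝ] E →L[ℝ] ℝ} {I J K : E →L[ℝ] E}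
    {m φ : E →L[ℝ] ℝ} {p t : ℝ} (h : IsQuaternionHermitian g I J K) (hφ : φ = (-(2 * p * t)) • m)
    (u v w : E) :
    4 * p ^ 2 * t ^ 3 * m u * quatSq I J K m v w
      - p * t ^ 2 * (g u v * m w + m v * g u w + (g u (I v) * m (I w) + m (I v) * g u (I w)
        + (g u (J v) * m (J w) + m (J v) * g u (J w))
        + (g u (K v) * m (K w) + m (K v) * g u (K w))))
      - 2 * p * t ^ 2 * m u * g v w
      = -(-(p * t ^ 2) * quatSq I J K m (quatShift I J K φ u v) w + t * g (quatShift I J K φ u v) w)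
        - (-(p * t ^ 2) * quatSq I J K m v (quatShift I J K φ u w)
          + t * g v (quatShift I J K φ u w)) := by
  have hq := h.quat
  simp only [hφ, quatSq_apply, quatShift, map_add, map_sub, map_smul, map_neg, add_apply, sub_apply,
    smul_apply, smul_eq_mul, h.skewI, h.skewJ, h.skewK, hq.II, hq.JJ, hq.KK, hq.IJ,
    hq.JK, hq.KI, hq.JI, hq.KJ, hq.IK, h.symm v u, h.symm v (I u), h.symm v (J u), h.symm v (K u)]
  ring

variable [FiniteDimensional ℝ E]
  {V : Set E} {g : E → E →L[ℝ] E →L[ℝ] ℝ} {I J K : E → E →L[ℝ] E} {μ : E → ℝ} {y : E}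

/-- `(g, I, J, K)` is a pseudo-hyper-Kähler structure on the open subset `V` of `E`, and the
Hessian of `μ` is `g`. -/
structure IsHessianPotentialOn (V : Set E) (g : E → E →L[ℝ] E →L[ℝ] ℝ) (I J K : E → E →L[ℝ] E)
    (μ : E → ℝ) : Prop where
  herm : IsHermitianOn V g I J K
  parallelI : ∀ y ∈ V, ∀ u v, covDerivEnd g I y u v = 0
  parallelJ : ∀ y ∈ V, ∀ u v, covDerivEnd g J y u v = 0
  parallelK : ∀ y ∈ V, ∀ u v, covDerivEnd g K y u v = 0
  smooth : ContDiffOn ℝ ∞ μ V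
  hess : ∀ y ∈ V, ∀ u v, covDerivForm g (fderiv ℝ μ) y u v = g y u v

/-- The function `p g(dμ,dμ) + 1` in coordinates. -/
def denomForm (p : ℝ) (g : E → E →L[ℝ] E →L[ℝ] ℝ) (μ : E → ℝ) (y : E) : ℝ :=
  p * formNormSq (g y) (fderiv ℝ μ y) + 1

/-- The Lee form `-2p (p g(dμ,dμ) + 1)⁻¹ dμ` of `g_p` in coordinates. -/
def qkLeeForm (p : ℝ) (g : E → E →L[ℝ] E →L[ℝ] ℝ) (μ : E → ℝ) (y : E) : E →L[ℝ] ℝ :=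
  (-(2 * p * (denomForm p g μ y)⁻¹)) • fderiv ℝ μ y

/-- The metric `g_p` in coordinates. -/
def qkMetric (p : ℝ) (g : E → E →L[ℝ] E →L[ℝ] ℝ) (I J K : E → E →L[ℝ] E) (μ : E → ℝ) (y : E) :
    E →L[ℝ] E →L[ℝ] ℝ :=
  qkForm p (g y) (I y) (J y) (K y) (fderiv ℝ μ y)

omit [FiniteDimensional ℝ E] in
theorem qkMetric_apply (p : ℝ) (u v : E) : qkMetric p g I J K μ y u v =
    -(p * (denomForm p g μ y)⁻¹ ^ 2) * quatSq (I y) (J y) (K y) (fderiv ℝ μ y) u v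
      + (denomForm p g μ y)⁻¹ * g y u v := by
  rw [qkMetric, qkForm_apply, denomForm, inv_pow, one_div, div_eq_mul_inv]

namespace IsHessianPotentialOn

variable {p : ℝ}

omit [FiniteDimensional ℝ E] in
theorem cycle (h : IsHessianPotentialOn V g I J K μ) : IsHessianPotentialOn V g J K I μ :=
  ⟨h.herm.cycle, h.parallelJ, h.parallelK, h.parallelI, h.smooth, h.hess⟩

omit [FiniteDimensional ℝ E] in
theorem mono (h : IsHessianPotentialOn V g I J K μ) {W : Set E} (hW : IsOpen W) (hWV : W ⊆ V) :
    IsHessianPotentialOn W g I J K μ where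
  herm :=
    { isOpen := hW
      smooth := h.herm.smooth.mono hWV
      symm := fun y hy => h.herm.symm y (hWV hy)
      nondeg := fun y hy => h.herm.nondeg y (hWV hy)
      smoothI := h.herm.smoothI.mono hWV
      smoothJ := h.herm.smoothJ.mono hWV
      smoothK := h.herm.smoothK.mono hWV
      herm := fun y hy => h.herm.herm y (hWV hy) }
  parallelI y hy := h.parallelI y (hWV hy)
  parallelJ y hy := h.parallelJ y (hWV hy)
  parallelK y hy := h.parallelK y (hWV hy)
  smooth := h.smooth.mono hWV
  hess y hy := h.hess y (hWV hy)

omit [FiniteDimensional ℝ E] in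
theorem contDiffAt_fderiv (h : IsHessianPotentialOn V g I J K μ) (hy : y ∈ V) :
    ContDiffAt ℝ ∞ (fderiv ℝ μ) y :=
  QuaternionicGeometry.contDiffAt_fderiv (h.smooth.contDiffAt (h.herm.isOpen.mem_nhds hy))

theorem contDiffAt_denomForm (h : IsHessianPotentialOn V g I J K μ) (hy : y ∈ V) :
    ContDiffAt ℝ ∞ (denomForm p g μ) y :=
  (contDiffAt_const.mul (h.herm.contDiffAt_formNormSq hy (h.contDiffAt_fderiv hy))).add
    contDiffAt_const

theorem fderiv_denomForm (h : IsHessianPotentialOn V g I J K μ) (hy : y ∈ V) (u : E) :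
    fderiv ℝ (denomForm p g μ) y u = 2 * p * fderiv ℝ μ y u := by
  have dN := differentiableAt_of_smooth
    (h.herm.contDiffAt_formNormSq hy (h.contDiffAt_fderiv hy))
  have hh := h.herm.herm y hy
  unfold denomForm
  rw [fderiv_add_const, fderiv_const_mul (by fun_prop), smul_apply,
    h.herm.fderiv_formNormSq hy (h.contDiffAt_fderiv hy), h.hess y hy, hh.symm, hh.apply_sharp,
    smul_eq_mul]
  ring

theorem fderiv_inv_denomForm (h : IsHessianPotentialOn V g I J K μ) (hy : y ∈ V)
    (hd : denomForm p g μ y ≠ 0) (u : E) :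
    fderiv ℝ (fun z => (denomForm p g μ z)⁻¹) y u =
      -(2 * p * (denomForm p g μ y)⁻¹ ^ 2 * fderiv ℝ μ y u) := by
  have dN := differentiableAt_of_smooth (h.contDiffAt_denomForm (p := p) hy)
  have h1 := (hasDerivAt_inv hd).comp_hasFDerivAt y dN.hasFDerivAt
  have h2 : fderiv ℝ (fun z => (denomForm p g μ z)⁻¹) y = _ := h1.fderiv
  rw [h2, smul_apply, h.fderiv_denomForm hy, smul_eq_mul, inv_pow]
  ring

theorem contDiffAt_qkLeeForm (h : IsHessianPotentialOn V g I J K μ) (hy : y ∈ V)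
    (hd : denomForm p g μ y ≠ 0) : ContDiffAt ℝ ∞ (qkLeeForm p g μ) y :=
  ((contDiffAt_const.mul ((h.contDiffAt_denomForm hy).inv hd)).neg).smul (h.contDiffAt_fderiv hy)

theorem contDiffAt_qkMetric (h : IsHessianPotentialOn V g I J K μ) (hy : y ∈ V)
    (hd : denomForm p g μ y ≠ 0) : ContDiffAt ℝ ∞ (qkMetric p g I J K μ) y := by
  have h1 := (h.contDiffAt_denomForm (p := p) hy).inv hd
  have h2 := contDiffAt_quatSq (h.herm.contDiffAtI hy) (h.herm.cycle.contDiffAtI hy)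
    (h.herm.cycle.cycle.contDiffAtI hy) (h.contDiffAt_fderiv hy)
  have e : qkMetric p g I J K μ = fun y => (-(p * ((denomForm p g μ y)⁻¹) ^ 2)) •
      quatSq (I y) (J y) (K y) (fderiv ℝ μ y) + (denomForm p g μ y)⁻¹ • g y := by
    funext y
    ext u v
    simp only [qkMetric_apply, add_apply, smul_apply, smul_eq_mul]
  rw [e]
  exact (((contDiffAt_const.mul (h1.pow 2)).neg).smul h2).add (h1.smul (h.herm.contDiffAt hy))

theorem isHermitianOn_qkMetric (h : IsHessianPotentialOn V g I J K μ)
    (hd : ∀ y ∈ V, denomForm p g μ y ≠ 0) :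
    IsHermitianOn V (qkMetric p g I J K μ) I J K :=
  have hh : ∀ y ∈ V, IsQuaternionHermitian (qkMetric p g I J K μ y) (I y) (J y) (K y) :=
    fun y hy => (h.herm.herm y hy).qkForm (hd y hy)
  { isOpen := h.herm.isOpen
    smooth := fun y hy => (h.contDiffAt_qkMetric hy (hd y hy)).contDiffWithinAt
    symm := fun y hy => (hh y hy).symm
    nondeg := fun y hy => (hh y hy).nondeg
    smoothI := h.herm.smoothI
    smoothJ := h.herm.smoothJ
    smoothK := h.herm.smoothK
    herm := hh }

omit [FiniteDimensional ℝ E] in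
theorem fderiv_I (h : IsHessianPotentialOn V g I J K μ) (hy : y ∈ V) (u v : E) :
    fderiv ℝ I y u v = I y (christoffel g y u v) - christoffel g y u (I y v) := by
  have h1 := h.parallelI y hy u v
  rw [covDerivEnd_apply] at h1
  rw [← sub_eq_zero, ← h1]; abel

omit [FiniteDimensional ℝ E] in
theorem fderiv_fderiv (h : IsHessianPotentialOn V g I J K μ) (hy : y ∈ V) (u v : E) :
    fderiv ℝ (fderiv ℝ μ) y u v = g y u v + fderiv ℝ μ y (christoffel g y u v) := by
  have h1 := h.hess y hy u v
  rw [covDerivForm_apply] at h1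
  linarith

omit [FiniteDimensional ℝ E] in
theorem fderiv_fderiv_I (h : IsHessianPotentialOn V g I J K μ) (hy : y ∈ V) (u v : E) :
    fderiv ℝ (fun z => fderiv ℝ μ z (I z v)) y u =
      g y u (I y v) + fderiv ℝ μ y (I y (christoffel g y u v)) := by
  have dI := differentiableAt_of_smooth (h.herm.contDiffAtI hy)
  rw [fderiv_eval (differentiableAt_of_smooth (h.contDiffAt_fderiv hy)) (f := fun z => I z v)
    (by fun_prop), fderiv_eval_const dI, h.fderiv_fderiv hy, h.fderiv_I hy, map_sub]
  ring

/-- The Levi-Civita connection of `g_p`. -/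
theorem christoffel_qkMetric (h : IsHessianPotentialOn V g I J K μ)
    (hd : ∀ y ∈ V, denomForm p g μ y ≠ 0) (hy : y ∈ V) (u v : E) :
    christoffel (qkMetric p g I J K μ) y u v =
      christoffel g y u v - quatShift (I y) (J y) (K y) (qkLeeForm p g μ y) u v := by
  have hk := h.isHermitianOn_qkMetric hd
  refine hk.christoffel_unique hy (C := fun u v => christoffel g y u v -
    quatShift (I y) (J y) (K y) (qkLeeForm p g μ y) u v) (fun u v => by
    rw [h.herm.christoffel_symm hy, quatShift_symm]) (fun u v w => ?_) u v
  have dm := differentiableAt_of_smooth (h.contDiffAt_fderiv hy)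
  have dg := differentiableAt_of_smooth (h.herm.contDiffAt hy)
  have dI := differentiableAt_of_smooth (h.herm.contDiffAtI hy)
  have dJ := differentiableAt_of_smooth (h.herm.cycle.contDiffAtI hy)
  have dK := differentiableAt_of_smooth (h.herm.cycle.cycle.contDiffAtI hy)
  have dN := differentiableAt_of_smooth (h.contDiffAt_denomForm (p := p) hy)
  have dk := differentiableAt_of_smooth (hk.contDiffAt hy)
  have dt : DifferentiableAt ℝ (fun z => (denomForm p g μ z)⁻¹) y := dN.fun_inv (hd y hy)
  have hg' := h.herm.fderiv_metric hy u v w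
  have e : (fun z => qkMetric p g I J K μ z v w) = fun z =>
      -(p * ((denomForm p g μ z)⁻¹ * (denomForm p g μ z)⁻¹)) * (fderiv ℝ μ z v * fderiv ℝ μ z w
        + (fderiv ℝ μ z (I z v) * fderiv ℝ μ z (I z w)
        + fderiv ℝ μ z (J z v) * fderiv ℝ μ z (J z w)
        + fderiv ℝ μ z (K z v) * fderiv ℝ μ z (K z w))) + (denomForm p g μ z)⁻¹ * g z v w := by
    ext z; rw [qkMetric_apply, quatSq_apply]; ring
  have id := (h.herm.herm y hy).shift_identity' (φ := qkLeeForm p g μ y) rfl u v w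
  have l : fderiv ℝ (qkMetric p g I J K μ) y u v w = fderiv ℝ
      (fun z => qkMetric p g I J K μ z v w) y u := by
    rw [fderiv_eval_const (A := fun z => qkMetric p g I J K μ z v)
      (dk.clm_apply (differentiableAt_const v)), fderiv_eval_const dk]
  rw [l, e, fderiv_fun_add (by fun_prop) (by fun_prop), fderiv_fun_mul (by fun_prop) (by fun_prop),
    fderiv_fun_mul dt (by fun_prop), fderiv_fun_neg, fderiv_const_mul (by fun_prop),
    fderiv_fun_mul dt dt,
    fderiv_fun_add (by fun_prop) (by fun_prop), fderiv_fun_add (by fun_prop) (by fun_prop),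
    fderiv_fun_add (by fun_prop) (by fun_prop), fderiv_fun_mul (by fun_prop) (by fun_prop),
    fderiv_fun_mul (by fun_prop) (by fun_prop), fderiv_fun_mul (by fun_prop) (by fun_prop),
    fderiv_fun_mul (by fun_prop) (by fun_prop)]
  simp only [add_apply, smul_apply, neg_apply, smul_eq_mul, fderiv_eval_const dm,
    h.fderiv_inv_denomForm hy (hd y hy), h.fderiv_fderiv_I hy, h.cycle.fderiv_fderiv_I hy,
    h.cycle.cycle.fderiv_fderiv_I hy,
    h.fderiv_fderiv hy]
  rw [fderiv_eval_const (A := fun z => g z v) (by fun_prop), fderiv_eval_const dg, hg']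
  simp only [qkMetric_apply, map_sub, sub_apply]
  simp only [quatSq_apply] at id ⊢
  linear_combination id

/-- The connection of `g_p` is the one of an hHqK metric with Lee form `φ_p`. -/
theorem covDerivEnd_qkMetric (h : IsHessianPotentialOn V g I J K μ)
    (hd : ∀ y ∈ V, denomForm p g μ y ≠ 0) (hy : y ∈ V) (u v : E) :
    covDerivEnd (qkMetric p g I J K μ) I y u v = qkLeeForm p g μ y (J y u) • K y v
      - qkLeeForm p g μ y (K y u) • J y v := by
  have h1 := (h.herm.herm y hy).quat.quatShift_comm (qkLeeForm p g μ y) u v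
  rw [covDerivEnd_apply, h.christoffel_qkMetric hd hy, h.christoffel_qkMetric hd hy,
    h.fderiv_I hy, map_sub]
  rw [← neg_inj] at h1
  rw [neg_sub, neg_sub] at h1
  rw [← h1]
  abel

omit [FiniteDimensional ℝ E] in
theorem qkMetric_cycle : qkMetric p g J K I μ = qkMetric p g I J K μ := by
  funext y; rw [qkMetric, qkForm, quatSq_cycle, qkMetric, qkForm]

theorem isLeeConnectionOn_qkMetric (h : IsHessianPotentialOn V g I J K μ)
    (hd : ∀ y ∈ V, denomForm p g μ y ≠ 0) :
    IsLeeConnectionOn V (qkMetric p g I J K μ) I J K (qkLeeForm p g μ) where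
  covI _ hy u v := h.covDerivEnd_qkMetric hd hy u v
  covJ _ hy u v := by rw [← qkMetric_cycle]; exact h.cycle.covDerivEnd_qkMetric hd hy u v
  covK _ hy u v := by
    rw [← qkMetric_cycle, ← qkMetric_cycle]; exact h.cycle.cycle.covDerivEnd_qkMetric hd hy u v

/-- The curvature of `span {I, J, K}` for `g_p` is `4p` times the Kähler form. -/
theorem leeCurv_qkMetric (h : IsHessianPotentialOn V g I J K μ)
    (hd : ∀ y ∈ V, denomForm p g μ y ≠ 0) (hy : y ∈ V) (u v : E) :
    leeCurv (I y) (J y) (K y) (qkLeeForm p g μ y)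
      (covDerivForm (qkMetric p g I J K μ) (qkLeeForm p g μ) y) u v
      = 4 * p * qkMetric p g I J K μ y u (I y v) := by
  have dm := differentiableAt_of_smooth (h.contDiffAt_fderiv hy)
  have dN := differentiableAt_of_smooth (h.contDiffAt_denomForm (p := p) hy)
  have dt : DifferentiableAt ℝ (fun z => (denomForm p g μ z)⁻¹) y := dN.fun_inv (hd y hy)
  have hh := h.herm.herm y hy
  have hq := hh.quat
  have cov : ∀ u v, covDerivForm (qkMetric p g I J K μ) (qkLeeForm p g μ) y u v =
      4 * p ^ 2 * (denomForm p g μ y)⁻¹ ^ 2 * fderiv ℝ μ y u * fderiv ℝ μ y v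
        - 2 * p * (denomForm p g μ y)⁻¹ * (g y u v
          + fderiv ℝ μ y (quatShift (I y) (J y) (K y) (qkLeeForm p g μ y) u v)) := by
    intro u v
    have e : fderiv ℝ (qkLeeForm p g μ) y u v = fderiv ℝ (fun z => -(2 * p) *
        ((denomForm p g μ z)⁻¹ * fderiv ℝ μ z v)) y u := by
      rw [← fderiv_eval_const (differentiableAt_of_smooth (h.contDiffAt_qkLeeForm hy (hd y hy)))]
      congr 2
      funext z
      simp only [qkLeeForm, smul_apply, smul_eq_mul]
      ring
    rw [covDerivForm_apply, e, h.christoffel_qkMetric hd hy, fderiv_const_mul (by fun_prop),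
      fderiv_fun_mul dt (by fun_prop)]
    simp only [add_apply, smul_apply, smul_eq_mul, h.fderiv_inv_denomForm hy (hd y hy),
      fderiv_eval_const dm, h.fderiv_fderiv hy]
    have e2 : ∀ x, qkLeeForm p g μ y x = -(2 * p * (denomForm p g μ y)⁻¹) * fderiv ℝ μ y x :=
      fun x => rfl
    rw [e2, map_sub]
    ring
  have e2 : ∀ x, qkLeeForm p g μ y x = -(2 * p * (denomForm p g μ y)⁻¹) * fderiv ℝ μ y x :=
    fun x => rfl
  rw [leeCurv_apply, cov, cov, qkMetric_apply]
  simp only [e2, quatSq_apply, quatShift, map_add, map_sub, map_smul, map_neg, smul_eq_mul,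
    hq.II, hq.JI, hq.KI, hh.symm v (I y u), hh.skewI]
  ring

end IsHessianPotentialOn

end ToQuaternionicKahler

end QuaternionicGeometry

namespace QuaternionicGeometry

/-! ### Definiteness and signature -/

section Signature

variable {E : Type*} [NormedAddCommGroup E] [NormedSpace ℝ E]
  {g : E →L[ℝ] E →L[ℝ] ℝ} {I J K : E →L[ℝ] E} {φ : E →L[ℝ] ℝ} {ν p : ℝ}

/-- The quaternionic line through `ξ`. -/
def quatSpan (I J K : E →L[ℝ] E) (ξ : E) : Submodule ℝ E := Submodule.span ℝ {ξ, I ξ, J ξ, K ξ}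

/-- The annihilator of `φ`, `Iφ`, `Jφ` and `Kφ`. -/
def quatKer (I J K : E →L[ℝ] E) (φ : E →L[ℝ] ℝ) : Submodule ℝ E :=
  LinearMap.ker (φ : E →ₗ[ℝ] ℝ) ⊓ (LinearMap.ker ((φ ∘L I : E →L[ℝ] ℝ) : E →ₗ[ℝ] ℝ)
    ⊓ LinearMap.ker ((φ ∘L J : E →L[ℝ] ℝ) : E →ₗ[ℝ] ℝ)
    ⊓ LinearMap.ker ((φ ∘L K : E →L[ℝ] ℝ) : E →ₗ[ℝ] ℝ))

theorem mem_quatKer {z : E} :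
    z ∈ quatKer I J K φ ↔ φ z = 0 ∧ (φ (I z) = 0 ∧ φ (J z) = 0) ∧ φ (K z) = 0 := by
  simp [quatKer]

theorem quatSq_self_nonneg (u : E) : 0 ≤ quatSq I J K φ u u := by
  rw [quatSq_apply]
  nlinarith [mul_self_nonneg (φ u), mul_self_nonneg (φ (I u)), mul_self_nonneg (φ (J u)),
    mul_self_nonneg (φ (K u))]

theorem quatSq_of_mem_quatKer {z : E} (hz : z ∈ quatKer I J K φ) (v : E) :
    quatSq I J K φ z v = 0 := by
  obtain ⟨h0, ⟨h1, h2⟩, h3⟩ := mem_quatKer.1 hz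
  rw [quatSq_apply, h0, h1, h2, h3]; ring

theorem IsQuaternionic.finrank_quatSpan (h : IsQuaternionic I J K) {ξ : E} (hξ : ξ ≠ 0) :
    Module.finrank ℝ (quatSpan I J K ξ) = 4 := by
  have hli : LinearIndependent ℝ ![ξ, I ξ, J ξ, K ξ] := by
    refine Fintype.linearIndependent_iff.2 fun c hc => ?_
    rw [Fin.sum_univ_four] at hc
    obtain ⟨h0, h1, h2, h3⟩ := h.eq_zero_of_combination hξ hc
    intro i
    fin_cases i <;> assumption
  have hr : ({ξ, I ξ, J ξ, K ξ} : Set E) = Set.range ![ξ, I ξ, J ξ, K ξ] := by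
    simp only [Matrix.range_cons, Matrix.range_empty, Set.union_empty, Set.singleton_union]
  rw [quatSpan, hr, finrank_span_eq_card hli]
  simp

variable [FiniteDimensional ℝ E]

namespace IsQuaternionHermitian

/-- On the quaternionic line of `φ^♯` the form `(1 + L) φ ⊗ φ` is `g(φ,φ) g`. -/
theorem quatSq_of_mem_span (h : IsQuaternionHermitian g I J K) {u : E}
    (hu : u ∈ quatSpan I J K (g.inverse φ)) (v : E) :
    quatSq I J K φ u v = formNormSq g φ * g u v := by
  have key : ∀ A B C : E →L[ℝ] E, IsQuaternionHermitian g A B C →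
      quatSq A B C φ = quatSq I J K φ →
      quatSq I J K φ (A (g.inverse φ)) v = formNormSq g φ * g (A (g.inverse φ)) v := by
    intro A B C hA hQ
    have h1 := hA.quat.quatSq_orth (φ := φ) (A (g.inverse φ)) v
    rw [hA.quat.II, map_neg, neg_apply, hA.quatSq_sharp] at h1
    rw [← hQ, ← h1, hA.skewI, hA.apply_sharp]
    ring
  refine Submodule.span_induction (p := fun u _ => quatSq I J K φ u v = formNormSq g φ * g u v)
    ?_ ?_ ?_ ?_ hu
  · rintro x (rfl | rfl | rfl | rfl)
    · rw [h.quatSq_sharp, h.apply_sharp]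
    · exact key I J K h rfl
    · exact key J K I h.cycle (quatSq_cycle I J K φ)
    · exact key K I J h.cycle.cycle ((quatSq_cycle J K I φ).trans (quatSq_cycle I J K φ))
  · simp
  · intro x y _ _ hx hy
    rw [map_add, add_apply, hx, hy, map_add, add_apply]; ring
  · intro c x _ hx
    rw [map_smul, smul_apply, hx, map_smul, smul_apply, smul_eq_mul, smul_eq_mul]; ring

theorem orth_of_mem (h : IsQuaternionHermitian g I J K) (hN : formNormSq g φ ≠ 0) {u z : E}
    (hu : u ∈ quatSpan I J K (g.inverse φ)) (hz : z ∈ quatKer I J K φ) : g u z = 0 := by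
  have h1 := h.quatSq_of_mem_span hu z
  rw [quatSq_symm, quatSq_of_mem_quatKer hz] at h1
  exact (mul_eq_zero.1 h1.symm).resolve_left hN

theorem exists_decomposition (h : IsQuaternionHermitian g I J K) (hN : formNormSq g φ ≠ 0)
    (u : E) : ∃ v ∈ quatSpan I J K (g.inverse φ), ∃ z ∈ quatKer I J K φ, u = v + z := by
  set ξ := g.inverse φ with hξ
  have hφξ : φ ξ = formNormSq g φ := rfl
  have hq := h.quat
  have hI : φ (I ξ) = 0 := h.form_I_sharp
  have hJ : φ (J ξ) = 0 := h.form_J_sharp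
  have hK : φ (K ξ) = 0 := h.form_K_sharp
  refine ⟨(1 / formNormSq g φ) • (φ u • ξ - φ (I u) • I ξ - φ (J u) • J ξ - φ (K u) • K ξ), ?_,
    u - (1 / formNormSq g φ) • (φ u • ξ - φ (I u) • I ξ - φ (J u) • J ξ - φ (K u) • K ξ), ?_,
    by abel⟩
  · have m0 : ξ ∈ quatSpan I J K ξ := Submodule.subset_span (by simp)
    have m1 : I ξ ∈ quatSpan I J K ξ := Submodule.subset_span (by simp)
    have m2 : J ξ ∈ quatSpan I J K ξ := Submodule.subset_span (by simp)
    have m3 : K ξ ∈ quatSpan I J K ξ := Submodule.subset_span (by simp)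
    exact Submodule.smul_mem _ _ (Submodule.sub_mem _ (Submodule.sub_mem _ (Submodule.sub_mem _
      (Submodule.smul_mem _ _ m0) (Submodule.smul_mem _ _ m1)) (Submodule.smul_mem _ _ m2))
      (Submodule.smul_mem _ _ m3))
  · refine mem_quatKer.2 ⟨?_, ⟨?_, ?_⟩, ?_⟩ <;>
    · simp only [map_sub, map_smul, smul_eq_mul, map_neg, hI, hJ, hK, hφξ, hq.II, hq.JJ, hq.KK,
        hq.IJ, hq.JK, hq.KI, hq.JI, hq.KJ, hq.IK]
      field_simp
      ring

theorem isCompl_quatSpan (h : IsQuaternionHermitian g I J K) (hN : formNormSq g φ ≠ 0) :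
    IsCompl (quatSpan I J K (g.inverse φ)) (quatKer I J K φ) := by
  refine ⟨?_, ?_⟩
  · refine Submodule.disjoint_def.2 fun x hx hx' => h.nondeg x fun v => ?_
    obtain ⟨v, hv, z, hz, rfl⟩ := h.exists_decomposition hN v
    rw [map_add, h.orth_of_mem hN hx hz, h.symm, h.orth_of_mem hN hv hx', add_zero]
  · refine codisjoint_iff.2 (eq_top_iff.2 fun u _ => ?_)
    obtain ⟨v, hv, z, hz, rfl⟩ := h.exists_decomposition hN u
    exact Submodule.add_mem_sup hv hz

omit [FiniteDimensional ℝ E] in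
theorem sharp_ne_zero (hN : formNormSq g φ ≠ 0) : g.inverse φ ≠ 0 := fun h0 =>
  hN (by rw [formNormSq, h0, map_zero])

theorem finrank_quatKer (h : IsQuaternionHermitian g I J K) (hN : formNormSq g φ ≠ 0) :
    4 + Module.finrank ℝ (quatKer I J K φ) = Module.finrank ℝ E := by
  rw [← Submodule.finrank_add_eq_of_isCompl (h.isCompl_quatSpan hN),
    h.quat.finrank_quatSpan (sharp_ne_zero hN)]

theorem formNormSq_eq (h : IsQuaternionHermitian g I J K) :
    formNormSq g φ = g (g.inverse φ) (g.inverse φ) := by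
  rw [h.apply_sharp, formNormSq]

theorem formNormSq_nonneg (h : IsQuaternionHermitian g I J K) (hpos : ∀ u, u ≠ 0 → 0 < g u u) :
    0 ≤ formNormSq g φ := by
  rw [h.formNormSq_eq]
  rcases eq_or_ne (g.inverse φ) 0 with h0 | h0
  · rw [h0]; simp
  · exact (hpos _ h0).le

/-- Bessel's inequality for the orthogonal vectors `φ^♯`, `Iφ^♯`, `Jφ^♯`, `Kφ^♯`. -/
theorem quatSq_le (h : IsQuaternionHermitian g I J K) (hpos : ∀ u, u ≠ 0 → 0 < g u u) (u : E) :
    quatSq I J K φ u u ≤ formNormSq g φ * g u u := by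
  rcases eq_or_ne (formNormSq g φ) 0 with hN | hN
  · have hξ : g.inverse φ = 0 := by
      by_contra h0
      exact (hpos _ h0).ne' (by rw [← h.formNormSq_eq, hN])
    have hφ : ∀ v, φ v = 0 := fun v => by rw [← h.apply_sharp v, hξ]; simp
    rw [quatSq_apply, hN]
    simp [hφ]
  · obtain ⟨v, hv, z, hz, rfl⟩ := h.exists_decomposition hN u
    have h1 : quatSq I J K φ (v + z) (v + z) = formNormSq g φ * g v v := by
      rw [map_add, map_add, add_apply, add_apply, quatSq_of_mem_quatKer hz,
        quatSq_of_mem_quatKer hz, quatSq_symm v z, quatSq_of_mem_quatKer hz,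
        h.quatSq_of_mem_span hv]
      ring
    have h2 : g (v + z) (v + z) = g v v + g z z := by
      rw [map_add, map_add, add_apply, add_apply, h.orth_of_mem hN hv hz, h.symm z v,
        h.orth_of_mem hN hv hz]
      ring
    have h3 : 0 ≤ g z z := by
      rcases eq_or_ne z 0 with h0 | h0
      · rw [h0]; simp
      · exact (hpos _ h0).le
    rw [h1, h2, mul_add]
    linarith [mul_nonneg (h.formNormSq_nonneg (φ := φ) hpos) h3]

theorem hkForm_posDef (h : IsQuaternionHermitian g I J K) (hpos : ∀ u, u ≠ 0 → 0 < g u u)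
    (hw : 0 < ν * (formNormSq g φ + ν)) (u : E) (hu : u ≠ 0) :
    0 < QuaternionicGeometry.hkForm ν g I J K φ u u := by
  have hν : ν ≠ 0 := by rintro rfl; simp at hw
  have hg := hpos u hu
  have h1 := quatSq_self_nonneg (I := I) (J := J) (K := K) (φ := φ) u
  have h2 := h.quatSq_le (φ := φ) hpos u
  rw [hkForm_apply, mul_assoc]
  refine mul_pos (by positivity) ?_
  rcases lt_or_gt_of_ne hν with hn | hp
  · have hw' : formNormSq g φ + ν < 0 := by
      by_contra hc
      exact absurd hw (not_lt.2 (mul_nonpos_of_nonpos_of_nonneg hn.le (not_lt.1 hc)))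
    refine mul_pos_of_neg_of_neg hw' ?_
    nlinarith [mul_neg_of_neg_of_pos hw' hg]
  · have hw' : 0 < formNormSq g φ + ν := pos_of_mul_pos_right hw hp.le
    exact mul_pos hw' (by positivity)

omit [FiniteDimensional ℝ E] in
theorem formNormSq_ne_zero_of_neg (h : ν * (formNormSq g φ + ν) < 0) : formNormSq g φ ≠ 0 := by
  intro h0
  rw [h0, zero_add] at h
  exact absurd h (not_lt.2 (mul_self_nonneg ν))

theorem hkForm_pos_span (h : IsQuaternionHermitian g I J K) (hpos : ∀ u, u ≠ 0 → 0 < g u u)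
    (hw : ν * (formNormSq g φ + ν) < 0) {u : E}
    (hu : u ∈ quatSpan I J K (g.inverse φ)) (hu0 : u ≠ 0) :
    0 < QuaternionicGeometry.hkForm ν g I J K φ u u := by
  have hν : ν ≠ 0 := by rintro rfl; simp at hw
  have hw' : formNormSq g φ + ν ≠ 0 := by intro h0; rw [h0] at hw; simp at hw
  have hg := hpos u hu0
  have : QuaternionicGeometry.hkForm ν g I J K φ u u =
      (1 / ν ^ 2 * (formNormSq g φ + ν) ^ 2) * g u u := by
    rw [hkForm_apply, h.quatSq_of_mem_span hu]; ring
  rw [this]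
  positivity

omit [FiniteDimensional ℝ E] in
theorem hkForm_neg_ker (hpos : ∀ u, u ≠ 0 → 0 < g u u)
    (hw : ν * (formNormSq g φ + ν) < 0) {u : E}
    (hu : u ∈ quatKer I J K φ) (hu0 : u ≠ 0) :
    QuaternionicGeometry.hkForm ν g I J K φ u u < 0 := by
  have hν : ν ≠ 0 := by rintro rfl; simp at hw
  have hg := hpos u hu0
  have : QuaternionicGeometry.hkForm ν g I J K φ u u
      = (ν * (formNormSq g φ + ν)) * (1 / ν ^ 2 * g u u) := by
    rw [hkForm_apply, quatSq_of_mem_quatKer hu]; ring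
  rw [this]
  exact mul_neg_of_neg_of_pos hw (by positivity)

/-- The signature is read off from a definite splitting. -/
theorem hkForm_signature {n : ℕ} (hn : Module.finrank ℝ E = 4 * n)
    (h : IsQuaternionHermitian g I J K) (hpos : ∀ u, u ≠ 0 → 0 < g u u)
    (hw : ν * (formNormSq g φ + ν) < 0) :
    sigPos (LinearMap.BilinMap.toQuadraticMap
      (QuaternionicGeometry.hkForm ν g I J K φ).toLinearMap₁₂) = 4 ∧
    sigNeg (LinearMap.BilinMap.toQuadraticMap
      (QuaternionicGeometry.hkForm ν g I J K φ).toLinearMap₁₂) = 4 * (n - 1) := by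
  set Q := LinearMap.BilinMap.toQuadraticMap
      (QuaternionicGeometry.hkForm ν g I J K φ).toLinearMap₁₂ with hQ
  have hN := formNormSq_ne_zero_of_neg hw
  have hQu : ∀ u, Q u = QuaternionicGeometry.hkForm ν g I J K φ u u := fun u => rfl
  have h1 : 4 ≤ sigPos Q := by
    rw [← h.quat.finrank_quatSpan (sharp_ne_zero hN)]
    refine le_sigPos_of_posDef Q fun u hu => ?_
    exact h.hkForm_pos_span hpos hw u.2 (by simpa using hu)
  have h2 : Module.finrank ℝ (quatKer I J K φ) ≤ sigNeg Q := by
    refine le_sigNeg_of_negDef Q fun u hu => ?_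
    have := hkForm_neg_ker hpos hw u.2 (by simpa using hu)
    change 0 < -Q u
    rw [hQu]; linarith
  have h3 := h.finrank_quatKer hN
  have h4 := QuadraticForm.sigPos_add_sigNeg_add_radical (Q := Q)
  omega

theorem qkForm_posDef (h : IsQuaternionHermitian g I J K) (hpos : ∀ u, u ≠ 0 → 0 < g u u)
    (hd : 0 < p * formNormSq g φ + 1) (u : E) (hu : u ≠ 0) :
    0 < QuaternionicGeometry.qkForm p g I J K φ u u := by
  have hg := hpos u hu
  have h1 := quatSq_self_nonneg (I := I) (J := J) (K := K) (φ := φ) u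
  have h2 := h.quatSq_le (φ := φ) hpos u
  have : QuaternionicGeometry.qkForm p g I J K φ u u = 1 / (p * formNormSq g φ + 1) ^ 2 *
      ((p * formNormSq g φ + 1) * g u u - p * quatSq I J K φ u u) := by
    rw [qkForm_apply]; field_simp; ring
  rw [this]
  refine mul_pos (by positivity) ?_
  rcases le_or_gt p 0 with hp | hp
  · have := mul_pos hd hg
    nlinarith
  · nlinarith

theorem qkForm_posDef_of_signature {n : ℕ} (hn1 : 1 < n) (hn : Module.finrank ℝ E = 4 * n)
    (h : IsQuaternionHermitian g I J K) (hd : p * formNormSq g φ + 1 < 0)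
    (hsig : sigNeg (LinearMap.BilinMap.toQuadraticMap g.toLinearMap₁₂) = 4 * (n - 1))
    (hspan : ∀ u ∈ quatSpan I J K (g.inverse φ), u ≠ 0 → 0 < g u u) (u : E) (hu : u ≠ 0) :
    0 < QuaternionicGeometry.qkForm p g I J K φ u u := by
  have hN : formNormSq g φ ≠ 0 := by
    intro h0; rw [h0] at hd; linarith
  -- `g` is negative definite on the complement of the quaternionic line, by its signature
  have hneg : ∀ z ∈ quatKer I J K φ, z ≠ 0 → g z z < 0 := by
    intro z hz hz0
    by_contra hc
    rw [not_lt] at hc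
    have hzs : z ∉ quatSpan I J K (g.inverse φ) := fun hm =>
      hz0 (Submodule.disjoint_def.1 (h.isCompl_quatSpan hN).disjoint z hm hz)
    have h1 := QuadraticForm.sigPos_add_finrank_le_of_nonpos
      (Q := -LinearMap.BilinMap.toQuadraticMap g.toLinearMap₁₂)
      (V := quatSpan I J K (g.inverse φ) ⊔ Submodule.span ℝ {z}) (fun x hx => by
        obtain ⟨v, hv, y, hy, rfl⟩ := Submodule.mem_sup.1 hx
        obtain ⟨c, rfl⟩ := Submodule.mem_span_singleton.1 hy
        change -(g (v + c • z) (v + c • z)) ≤ 0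
        have h2 : g (v + c • z) (v + c • z) = g v v + c * c * g z z := by
          have h3 := h.orth_of_mem hN hv hz
          simp only [map_add, map_smul, add_apply, smul_apply, smul_eq_mul, h3, h.symm z v]
          ring
        have h4 : 0 ≤ g v v := by
          rcases eq_or_ne v 0 with h0 | h0
          · rw [h0]; simp
          · exact (hspan v hv h0).le
        rw [h2]
        nlinarith [mul_self_nonneg c])
    have h5 : Module.finrank ℝ (quatSpan I J K (g.inverse φ) ⊔ Submodule.span ℝ {z} : Submodule ℝ E)
        = 5 := by
      have h6 : Disjoint (quatSpan I J K (g.inverse φ)) (Submodule.span ℝ {z}) :=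
        (Submodule.disjoint_span_singleton' hz0).2 hzs
      have h7 := Submodule.finrank_sup_add_finrank_inf_eq (quatSpan I J K (g.inverse φ))
        (Submodule.span ℝ {z})
      rw [h6.eq_bot, h.quat.finrank_quatSpan (sharp_ne_zero hN), finrank_span_singleton hz0] at h7
      simpa using h7
    rw [sigPos_neg, hsig, h5] at h1
    omega
  obtain ⟨v, hv, z, hz, rfl⟩ := h.exists_decomposition hN u
  have e : QuaternionicGeometry.qkForm p g I J K φ (v + z) (v + z) =
      1 / (p * formNormSq g φ + 1) ^ 2 * (g v v + (p * formNormSq g φ + 1) * g z z) := by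
    have h1 : quatSq I J K φ (v + z) (v + z) = formNormSq g φ * g v v := by
      rw [map_add, map_add, add_apply, add_apply, quatSq_of_mem_quatKer hz,
        quatSq_of_mem_quatKer hz, quatSq_symm v z, quatSq_of_mem_quatKer hz,
        h.quatSq_of_mem_span hv]
      ring
    have h2 : g (v + z) (v + z) = g v v + g z z := by
      rw [map_add, map_add, add_apply, add_apply, h.orth_of_mem hN hv hz, h.symm z v,
        h.orth_of_mem hN hv hz]
      ring
    have hd0 := hd.ne
    rw [qkForm_apply, h1, h2]; field_simp; ring
  rw [e]
  have hd0 := hd.ne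
  refine mul_pos (by positivity) ?_
  rcases eq_or_ne z 0 with rfl | hz0
  · have := hspan v hv (by simpa using hu)
    simpa using this
  · have h1 := mul_pos_of_neg_of_neg hd (hneg z hz hz0)
    have h2 : 0 ≤ g v v := by
      rcases eq_or_ne v 0 with h0 | h0
      · rw [h0]; simp
      · exact (hspan v hv h0).le
    linarith

end IsQuaternionHermitian

end Signature

end QuaternionicGeometry

namespace QuaternionicGeometry

/-! ### Transport of the linear algebra by an isomorphism -/

section Pullback

variable {E : Type*} [NormedAddCommGroup E] [NormedSpace ℝ E]
  {g : E →L[ℝ] E →L[ℝ] ℝ} {I J K L L' : E →L[ℝ] E} {φ : E →L[ℝ] ℝ} {ν p : ℝ}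

/-- The pullback of a bilinear form by a linear map. -/
def pullForm (g : E →L[ℝ] E →L[ℝ] ℝ) (L : E →L[ℝ] E) : E →L[ℝ] E →L[ℝ] ℝ :=
  (ContinuousLinearMap.precomp ℝ L) ∘L g ∘L L

theorem pullForm_apply (u v : E) : pullForm g L u v = g (L u) (L v) := by simp [pullForm]

theorem pullForm_nondeg (hL' : ∀ u, L' (L u) = u) (hL : ∀ u, L (L' u) = u)
    (hg : ∀ u, (∀ v, g u v = 0) → u = 0) (u : E) (hu : ∀ v, pullForm g L u v = 0) : u = 0 := by
  have : L u = 0 := hg _ fun v => by rw [← hL v, ← pullForm_apply, hu]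
  rw [← hL' u, this, map_zero]

theorem IsQuaternionic.conj (h : IsQuaternionic I J K) (hL' : ∀ u, L' (L u) = u)
    (hL : ∀ u, L (L' u) = u) : IsQuaternionic (L' ∘L I ∘L L) (L' ∘L J ∘L L) (L' ∘L K ∘L L) := by
  constructor <;> intro u <;>
  simp [hL, hL', h.II, h.JJ, h.KK, h.IJ, h.JK, h.KI, h.JI, h.KJ, h.IK]

theorem IsQuaternionHermitian.pull (h : IsQuaternionHermitian g I J K) (hL' : ∀ u, L' (L u) = u)
    (hL : ∀ u, L (L' u) = u) :
    IsQuaternionHermitian (pullForm g L) (L' ∘L I ∘L L) (L' ∘L J ∘L L) (L' ∘L K ∘L L) where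
  quat := h.quat.conj hL' hL
  symm u v := by rw [pullForm_apply, pullForm_apply, h.symm]
  nondeg := pullForm_nondeg hL' hL h.nondeg
  orthI u v := by simp [pullForm_apply, hL, h.orthI]
  orthJ u v := by simp [pullForm_apply, hL, h.orthJ]
  orthK u v := by simp [pullForm_apply, hL, h.orthK]

theorem quatSq_pull (hL : ∀ u, L (L' u) = u) :
    quatSq (L' ∘L I ∘L L) (L' ∘L J ∘L L) (L' ∘L K ∘L L) (φ ∘L L) =
      pullForm (quatSq I J K φ) L := by
  ext u v
  simp [pullForm_apply, quatSq_apply, hL]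

variable [FiniteDimensional ℝ E]

theorem formNormSq_pull (hL' : ∀ u, L' (L u) = u) (hL : ∀ u, L (L' u) = u)
    (hg : ∀ u, (∀ v, g u v = 0) → u = 0) :
    formNormSq (pullForm g L) (φ ∘L L) = formNormSq g φ := by
  have : (pullForm g L).inverse (φ ∘L L) = L' (g.inverse φ) :=
    inverse_apply_eq (pullForm_nondeg hL' hL hg) fun v => by
      rw [pullForm_apply, hL, apply_inverse hg]; rfl
  rw [formNormSq, this, formNormSq, ContinuousLinearMap.comp_apply, hL]

theorem hkForm_pull (hL' : ∀ u, L' (L u) = u) (hL : ∀ u, L (L' u) = u)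
    (hg : ∀ u, (∀ v, g u v = 0) → u = 0) :
    hkForm ν (pullForm g L) (L' ∘L I ∘L L) (L' ∘L J ∘L L) (L' ∘L K ∘L L) (φ ∘L L) =
      pullForm (hkForm ν g I J K φ) L := by
  ext u v
  rw [hkForm_apply, formNormSq_pull hL' hL hg, quatSq_pull hL]
  simp only [pullForm_apply, hkForm_apply]

theorem qkForm_pull (hL' : ∀ u, L' (L u) = u) (hL : ∀ u, L (L' u) = u)
    (hg : ∀ u, (∀ v, g u v = 0) → u = 0) :
    qkForm p (pullForm g L) (L' ∘L I ∘L L) (L' ∘L J ∘L L) (L' ∘L K ∘L L) (φ ∘L L) =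
      pullForm (qkForm p g I J K φ) L := by
  ext u v
  rw [qkForm_apply, formNormSq_pull hL' hL hg, quatSq_pull hL]
  simp only [pullForm_apply, qkForm_apply]

end Pullback

/-! ### Tensor fields in charts -/

section Charts

open scoped Topology

variable {E : Type*} [NormedAddCommGroup E] [NormedSpace ℝ E]
  {M : Type*} [TopologicalSpace M] [ChartedSpace E M]
  {e : OpenPartialHomeomorph M E} {y : E}

theorem mdifferentiable_of_mem_maximalAtlas (he : e ∈ IsManifold.maximalAtlas 𝓘(ℝ, E) ∞ M) :
    e.MDifferentiable 𝓘(ℝ, E) 𝓘(ℝ, E) :=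
  ⟨(contMDiffOn_of_mem_maximalAtlas he).mdifferentiableOn (by simp),
    (contMDiffOn_symm_of_mem_maximalAtlas he).mdifferentiableOn (by simp)⟩

theorem exists_chart [IsManifold 𝓘(ℝ, E) ∞ M] (x : M) :
    ∃ e ∈ IsManifold.maximalAtlas 𝓘(ℝ, E) ∞ M, ∃ y ∈ e.target,
    e.symm y = x :=
  ⟨chartAt E x, IsManifold.chart_mem_maximalAtlas x, chartAt E x x, mem_chart_target E x,
    (chartAt E x).left_inv (mem_chart_source E x)⟩

theorem dChart_dChartSymm (he : e ∈ IsManifold.maximalAtlas 𝓘(ℝ, E) ∞ M) (hy : y ∈ e.target)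
    (u : E) : dChart e y (dChartSymm e y u) = u := by
  have h1 := (mdifferentiable_of_mem_maximalAtlas he).comp_symm_deriv hy
  exact congrArg (fun L => L u) h1

theorem dChartSymm_dChart (he : e ∈ IsManifold.maximalAtlas 𝓘(ℝ, E) ∞ M) (hy : y ∈ e.target)
    (u : TangentSpace 𝓘(ℝ, E) (e.symm y)) : dChartSymm e y (dChart e y u) = u := by
  have h1 := (mdifferentiable_of_mem_maximalAtlas he).symm_comp_deriv (e.map_target hy)
  rw [e.right_inv hy] at h1
  exact congrArg (fun L => L u) h1

theorem differential_inChart (he : e ∈ IsManifold.maximalAtlas 𝓘(ℝ, E) ∞ M) (hy : y ∈ e.target)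
    {f : M → ℝ} (hf : MDifferentiableAt 𝓘(ℝ, E) 𝓘(ℝ, ℝ) f (e.symm y)) :
    (differential f : OneForm E M).inChart e y = fderiv ℝ (fun z => f (e.symm z)) y := by
  have h1 := mfderiv_comp y hf ((mdifferentiable_of_mem_maximalAtlas he).mdifferentiableAt_symm hy)
  rw [mfderiv_eq_fderiv] at h1
  exact h1.symm

theorem contDiffOn_of_contMDiffOn (he : e ∈ IsManifold.maximalAtlas 𝓘(ℝ, E) ∞ M) {U : Set M}
    {f : M → ℝ} (hf : ContMDiffOn 𝓘(ℝ, E) 𝓘(ℝ, ℝ) ∞ f U) :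
    ContDiffOn ℝ ∞ (fun z => f (e.symm z)) (e.target ∩ e.symm ⁻¹' U) := by
  rw [← contMDiffOn_iff_contDiffOn]
  exact hf.comp ((contMDiffOn_symm_of_mem_maximalAtlas he).mono inter_subset_left)
    inter_subset_right

theorem contMDiffOn_of_contDiffOn [IsManifold 𝓘(ℝ, E) ∞ M] {U : Set M} (hU : IsOpen U) {f : M → ℝ}
    (hf : ∀ e ∈ IsManifold.maximalAtlas 𝓘(ℝ, E) ∞ M,
      ContDiffOn ℝ ∞ (fun z => f (e.symm z)) (e.target ∩ e.symm ⁻¹' U)) :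
    ContMDiffOn 𝓘(ℝ, E) 𝓘(ℝ, ℝ) ∞ f U := by
  intro x hx
  have he := IsManifold.chart_mem_maximalAtlas (I := 𝓘(ℝ, E)) (n := ∞) x
  set e := chartAt E x
  have hxe : x ∈ e.source := mem_chart_source E x
  have h1 := (hf e he).contDiffAt (x := e x) ((e.isOpen_inter_preimage_symm hU).mem_nhds
    ⟨e.map_source hxe, by simpa [e.left_inv hxe] using hx⟩)
  have h2 := (h1.contMDiffAt).comp x (contMDiffAt_of_mem_maximalAtlas he hxe)
  refine (h2.congr_of_eventuallyEq ?_).contMDiffWithinAt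
  filter_upwards [e.open_source.mem_nhds hxe] with z hz
  simp [e.left_inv hz]

end Charts

/-! ### Locality of the Levi-Civita connection -/

section Germs

open scoped Topology

variable {E : Type*} [NormedAddCommGroup E] [NormedSpace ℝ E]
  {g g' : E → E →L[ℝ] E →L[ℝ] ℝ} {y : E}

theorem christoffel_congr (h : g =ᶠ[𝓝 y] g') : christoffel g y = christoffel g' y := by
  rw [christoffel, christoffel, christoffelLower, christoffelLower, h.fderiv_eq, h.eq_of_nhds]

theorem covDerivEnd_congr (h : g =ᶠ[𝓝 y] g') (A : E → E →L[ℝ] E) :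
    covDerivEnd g A y = covDerivEnd g' A y := by
  rw [covDerivEnd, covDerivEnd, christoffel_congr h]

theorem covDerivForm_congr (h : g =ᶠ[𝓝 y] g') (m : E → E →L[ℝ] ℝ) :
    covDerivForm g m y = covDerivForm g' m y := by
  rw [covDerivForm, covDerivForm, christoffel_congr h]

theorem leeForm_congr (h : g =ᶠ[𝓝 y] g') (A : E → E →L[ℝ] E) (v : E) :
    leeForm g A y v = leeForm g' A y v := by
  rw [leeForm, leeForm, covDerivEnd_congr h]

theorem ricci_congr (h : g =ᶠ[𝓝 y] g') : ricci g y = ricci g' y := by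
  have h1 : christoffel g =ᶠ[𝓝 y] christoffel g' := h.eventuallyEq_nhds.mono
    fun z hz => christoffel_congr hz
  ext v w
  rw [ricci_eq_ricciOf, ricci_eq_ricciOf, riemannCLM, riemannCLM, h1.fderiv_eq, h1.eq_of_nhds]

theorem scalarCurvature_congr [FiniteDimensional ℝ E] (h : g =ᶠ[𝓝 y] g') :
    scalarCurvature g y = scalarCurvature g' y := by
  rw [scalarCurvature, scalarCurvature, ricci_congr h, h.eq_of_nhds]

theorem extDeriv₁_congr {α β : E → E →L[ℝ] ℝ} (h : α =ᶠ[𝓝 y] β) (u v : E) :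
    extDeriv₁ α y u v = extDeriv₁ β y u v := by
  rw [extDeriv₁, extDeriv₁, h.fderiv_eq]

end Germs

end QuaternionicGeometry

namespace QuaternionicGeometry

/-! ### Structures on manifolds and their coordinate expressions -/

section Transfer

open scoped Topology

variable {E : Type*} [NormedAddCommGroup E] [NormedSpace ℝ E]
  {M : Type*} [TopologicalSpace M] [ChartedSpace E M]
  {e : OpenPartialHomeomorph M E} {y : E} {U : Set M}
  {g : BilinField E M} {I J K : EndField E M} {φ : OneForm E M} {ν p : ℝ} {μ : M → ℝ}

theorem BilinField.inChart_apply (b : BilinField E M) (u v : E) :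
    b.inChart e y u v = b (e.symm y) (dChartSymm e y u) (dChartSymm e y v) := by
  simp [BilinField.inChart]

theorem onePlusL_tensorSq (x : M) :
    onePlusL I J K (tensorSq φ) x = quatSq (E := E) (I x) (J x) (K x) (φ x) := by
  refine ContinuousLinearMap.ext fun u => ContinuousLinearMap.ext fun v => ?_
  refine Eq.trans ?_ (quatSq_apply (E := E) (I x) (J x) (K x) (φ x) u v).symm
  rfl

theorem toHyperKahler_eq (x : M) :
    toHyperKahler ν g I J K φ x = hkForm (E := E) ν (g x) (I x) (J x) (K x) (φ x) := by
  rw [toHyperKahler, onePlusL_tensorSq]; rfl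

theorem toHHqK_eq (x : M) :
    toHHqK p g I J K μ x =
      qkForm (E := E) p (g x) (I x) (J x) (K x) (differential (E := E) μ x) := by
  rw [toHHqK, onePlusL_tensorSq]; rfl

theorem IsPseudoAlmostHyperHermitianOn.isQuaternionHermitian
    (h : IsPseudoAlmostHyperHermitianOn U g I J K) {x : M} (hx : x ∈ U) :
    IsQuaternionHermitian (E := E) (g x) (I x) (J x) (K x) where
  quat := IsQuaternionic.of_mul (E := E) (h.almostHypercomplex.sq_I x hx)
    (h.almostHypercomplex.sq_J x hx) (h.almostHypercomplex.sq_K x hx)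
    (h.almostHypercomplex.mul_IJK x hx)
  symm := h.metric.symm x hx
  nondeg := h.metric.nondegenerate x hx
  orthI := h.orthogonal_I x hx
  orthJ := h.orthogonal_J x hx
  orthK := h.orthogonal_K x hx

theorem IsPseudoAlmostHyperHermitianOn.isHermitianOn
    (h : IsPseudoAlmostHyperHermitianOn U g I J K) (hU : IsOpen U)
    (he : e ∈ IsManifold.maximalAtlas 𝓘(ℝ, E) ∞ M) :
    IsHermitianOn (e.target ∩ e.symm ⁻¹' U) (g.inChart e) (I.inChart e) (J.inChart e)
      (K.inChart e) :=
  have hh : ∀ y ∈ e.target ∩ e.symm ⁻¹' U, IsQuaternionHermitian (g.inChart e y) (I.inChart e y)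
      (J.inChart e y) (K.inChart e y) := fun y hy =>
    (h.isQuaternionHermitian hy.2).pull (L := dChartSymm e y) (L' := dChart e y)
      (dChart_dChartSymm he hy.1) (dChartSymm_dChart he hy.1)
  { isOpen := e.isOpen_inter_preimage_symm hU
    smooth := h.metric.smooth e he
    symm := fun y hy => (hh y hy).symm
    nondeg := fun y hy => (hh y hy).nondeg
    smoothI := h.almostHypercomplex.smooth_I e he
    smoothJ := h.almostHypercomplex.smooth_J e he
    smoothK := h.almostHypercomplex.smooth_K e he
    herm := hh }

variable [FiniteDimensional ℝ E]

theorem normSq_inChart (h : IsPseudoAlmostHyperHermitianOn U g I J K)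
    (he : e ∈ IsManifold.maximalAtlas 𝓘(ℝ, E) ∞ M) (hy : y ∈ e.target ∩ e.symm ⁻¹' U) :
    formNormSq (g.inChart e y) (φ.inChart e y) = normSq g φ (e.symm y) :=
  formNormSq_pull (E := E) (L := dChartSymm e y) (L' := dChart e y)
    (dChart_dChartSymm he hy.1) (dChartSymm_dChart he hy.1) (h.metric.nondegenerate _ hy.2)

theorem toHyperKahler_inChart (h : IsPseudoAlmostHyperHermitianOn U g I J K)
    (he : e ∈ IsManifold.maximalAtlas 𝓘(ℝ, E) ∞ M) (hy : y ∈ e.target ∩ e.symm ⁻¹' U) :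
    (toHyperKahler ν g I J K φ).inChart e y =
      hkForm ν (g.inChart e y) (I.inChart e y) (J.inChart e y) (K.inChart e y) (φ.inChart e y) := by
  rw [BilinField.inChart, toHyperKahler_eq]
  exact (hkForm_pull (E := E) (L := dChartSymm e y) (L' := dChart e y)
    (dChart_dChartSymm he hy.1) (dChartSymm_dChart he hy.1) (h.metric.nondegenerate _ hy.2)).symm

theorem toHHqK_inChart (h : IsPseudoAlmostHyperHermitianOn U g I J K)
    (he : e ∈ IsManifold.maximalAtlas 𝓘(ℝ, E) ∞ M) (hy : y ∈ e.target ∩ e.symm ⁻¹' U) :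
    (toHHqK p g I J K μ).inChart e y =
      qkForm p (g.inChart e y) (I.inChart e y) (J.inChart e y) (K.inChart e y)
        ((differential μ : OneForm E M).inChart e y) := by
  rw [BilinField.inChart, toHHqK_eq]
  exact (qkForm_pull (E := E) (L := dChartSymm e y) (L' := dChart e y)
    (dChart_dChartSymm he hy.1) (dChartSymm_dChart he hy.1) (h.metric.nondegenerate _ hy.2)).symm

omit [FiniteDimensional ℝ E] in
/-- `1`-forms that agree in a chart agree. -/
theorem OneForm.eq_of_inChart (he : e ∈ IsManifold.maximalAtlas 𝓘(ℝ, E) ∞ M) (hy : y ∈ e.target)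
    {α β : OneForm E M} (h : α.inChart e y = β.inChart e y) : α (e.symm y) = β (e.symm y) := by
  refine ContinuousLinearMap.ext fun u => ?_
  have := congrArg (fun L : E →L[ℝ] ℝ => L (dChart e y u)) h
  simp only [OneForm.inChart, ContinuousLinearMap.comp_apply] at this
  rwa [dChartSymm_dChart he hy] at this

omit [FiniteDimensional ℝ E] in
theorem kahlerForm_inChart_apply (he : e ∈ IsManifold.maximalAtlas 𝓘(ℝ, E) ∞ M)
    (hy : y ∈ e.target) (A : EndField E M) (u v : E) :
    (kahlerForm g A).inChart e y u v = g.inChart e y (A.inChart e y u) v := by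
  rw [BilinField.inChart_apply, BilinField.inChart_apply]
  simp only [EndField.inChart, ContinuousLinearMap.comp_apply, dChartSymm_dChart he hy]
  rfl

/-- In a chart, `d(A dμ)` is the skew-symmetrised composition of the Hessian of `μ` with the
parallel field `A`. -/
theorem extDeriv_actOneForm_inChart (h : IsPseudoAlmostHyperHermitianOn U g I J K) (hU : IsOpen U)
    {A : EndField E M} (hA : SmoothInChartsOn U fun e => A.inChart e) (hp : IsParallelOn U g A)
    (hμ : ContMDiffOn 𝓘(ℝ, E) 𝓘(ℝ, ℝ) ∞ μ U)
    (he : e ∈ IsManifold.maximalAtlas 𝓘(ℝ, E) ∞ M) (hy : y ∈ e.target ∩ e.symm ⁻¹' U) (u v : E) :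
    extDeriv₁ ((actOneForm A (differential μ)).inChart e) y u v =
      covDerivForm (g.inChart e) (fderiv ℝ fun z => μ (e.symm z)) y v (A.inChart e y u)
        - covDerivForm (g.inChart e) (fderiv ℝ fun z => μ (e.symm z)) y u (A.inChart e y v) := by
  have hV := (e.isOpen_inter_preimage_symm hU).mem_nhds hy
  have germ : (actOneForm A (differential μ)).inChart e =ᶠ[𝓝 y]
      fun z => -(fderiv ℝ (fun z => μ (e.symm z)) z ∘L A.inChart e z) := by
    filter_upwards [hV] with z hz
    rw [← differential_inChart he hz.1
      ((hμ.contMDiffAt (hU.mem_nhds hz.2)).mdifferentiableAt (by simp))]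
    refine ContinuousLinearMap.ext fun u => ?_
    simp only [OneForm.inChart, EndField.inChart, ContinuousLinearMap.comp_apply, neg_apply,
      dChartSymm_dChart he hz.1]
    rfl
  rw [extDeriv₁_congr germ]
  have hμe := (contDiffOn_of_contMDiffOn he hμ).contDiffAt hV
  refine extDeriv_act (h.isHermitianOn hU he).toIsMetricOn hy
    (differentiableAt_of_smooth ((hA e he).contDiffAt hV))
    (differentiableAt_of_smooth (contDiffAt_fderiv hμe)) (fun u v => ?_) u v
  rw [hp e he y hy u]; rfl

end Transfer

/-! ### From quaternionic Kähler to hyper-Kähler manifolds -/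

section PartOne

open scoped Topology

variable {E : Type*} [NormedAddCommGroup E] [NormedSpace ℝ E] [FiniteDimensional ℝ E]
  {M : Type*} [TopologicalSpace M] [ChartedSpace E M]
  {e : OpenPartialHomeomorph M E} {y : E}
  {g : BilinField E M} {I J K : EndField E M} {φ : OneForm E M} {ν : ℝ} {n : ℕ}

/-- In every chart an hHqK structure with closed Lee form satisfies the equations for the covariant
derivative of the Lee form. -/
theorem IsHHqKOn.isClosedLeeOn (h : IsHHqKOn n univ g I J K ν) (hφ : IsLeeFormOn univ g I φ)
    (hcl : IsClosedFormOn univ φ) (he : e ∈ IsManifold.maximalAtlas 𝓘(ℝ, E) ∞ M) :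
    IsClosedLeeOn (e.target ∩ e.symm ⁻¹' univ) (g.inChart e) (I.inChart e) (J.inChart e)
      (K.inChart e) (φ.inChart e) ν := by
  have hH := h.toIsPseudoAlmostHyperHermitianOn.isHermitianOn isOpen_univ he
  have hpos : 0 < Module.finrank ℝ E := by
    have h1 := h.finrank_eq
    have h2 := h.one_lt
    omega
  have : Nontrivial E := Module.nontrivial_of_finrank_pos hpos
  have hL : ∀ y ∈ e.target ∩ e.symm ⁻¹' univ, φ.inChart e y =
      leeFormCLM (g.inChart e) (I.inChart e) y :=
    fun y hy => ContinuousLinearMap.ext fun v => hφ e he y hy v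
  have hconn := isLeeConnectionOn_of_parallelSpan hH
    (fun y hy u => ⟨h.parallel e he y hy I (by simp) u, h.parallel e he y hy J (by simp) u⟩)
    (h.hypercomplex.integrable_I e he) (h.hypercomplex.integrable_J e he)
  refine isClosedLeeOn_of_closed h.one_lt h.finrank_eq hH ?_ ?_ (hcl e he) ?_
    (h.reducedScalarCurvature e he)
  · exact fun y hy => ((contDiffAt_leeFormCLM hH.toIsMetricOn hy
      (hH.contDiffAtI hy)).contDiffWithinAt).congr hL (hL y hy)
  · exact ⟨fun y hy => by rw [hL y hy]; exact hconn.covI y hy,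
      fun y hy => by rw [hL y hy]; exact hconn.covJ y hy,
      fun y hy => by rw [hL y hy]; exact hconn.covK y hy⟩
  · intro y hy u hu
    rw [BilinField.inChart_apply]
    refine h.posDef _ (mem_univ _) _ fun h0 => hu ?_
    rw [← dChart_dChartSymm he hy.1 u, h0, map_zero]

section

variable (h : IsHHqKOn n univ g I J K ν) (hφ : IsLeeFormOn univ g I φ)
  (hcl : IsClosedFormOn univ φ) (hw : ∀ x, normSq g φ x + ν ≠ 0)
include h

theorem toPotential_inChart (he : e ∈ IsManifold.maximalAtlas 𝓘(ℝ, E) ∞ M) (hy : y ∈ e.target) :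
    toPotential ν g φ (e.symm y) =
      2 / ν ^ 2 * (formNormSq (g.inChart e y) (φ.inChart e y) + ν) := by
  rw [normSq_inChart h.toIsPseudoAlmostHyperHermitianOn he ⟨hy, mem_univ _⟩, toPotential]

include hφ hcl

theorem contMDiffOn_toPotential [IsManifold 𝓘(ℝ, E) ∞ M] :
    ContMDiffOn 𝓘(ℝ, E) 𝓘(ℝ, ℝ) ∞ (toPotential ν g φ) univ := by
  refine contMDiffOn_of_contDiffOn isOpen_univ fun e he y hy => ?_
  have hc := h.isClosedLeeOn hφ hcl he
  refine ContDiffWithinAt.congr (ContDiffAt.contDiffWithinAt ?_)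
    (fun z hz => toPotential_inChart h he hz.1) (toPotential_inChart h he hy.1)
  exact contDiffAt_const.mul
    ((hc.herm.contDiffAt_formNormSq hy (hc.contDiffAt hy)).add contDiffAt_const)

theorem differential_toPotential_inChart [IsManifold 𝓘(ℝ, E) ∞ M]
    (he : e ∈ IsManifold.maximalAtlas 𝓘(ℝ, E) ∞ M)
    (hy : y ∈ e.target) :
    (differential (toPotential ν g φ) : OneForm E M).inChart e y =
      fderiv ℝ (fun z => 2 / ν ^ 2 * (formNormSq (g.inChart e z) (φ.inChart e z) + ν)) y := by
  rw [differential_inChart he hy]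
  · refine Filter.EventuallyEq.fderiv_eq ?_
    filter_upwards [e.open_target.mem_nhds hy] with z hz
    exact toPotential_inChart h he hz
  · exact ((contMDiffOn_toPotential h hφ hcl).contMDiffAt Filter.univ_mem).mdifferentiableAt
      (by simp)

theorem differential_toPotential [IsManifold 𝓘(ℝ, E) ∞ M] (x : M) :
    differential (toPotential ν g φ) x = (-(2 / ν ^ 2 * (normSq g φ x + ν))) • φ x := by
  obtain ⟨e, he, y, hy, rfl⟩ := exists_chart (E := E) x
  refine OneForm.eq_of_inChart he hy
    (β := fun x => (-(2 / ν ^ 2 * (normSq g φ x + ν))) • φ x) ?_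
  have hc := h.isClosedLeeOn hφ hcl he
  rw [differential_toPotential_inChart h hφ hcl he hy, hc.fderiv_potential ⟨hy, mem_univ _⟩,
    normSq_inChart h.toIsPseudoAlmostHyperHermitianOn he ⟨hy, mem_univ _⟩]
  rfl

include hw

theorem isPseudoHyperKahlerOn_toHyperKahler :
    IsPseudoHyperKahlerOn univ (toHyperKahler ν g I J K φ) I J K := by
  have hA := h.toIsPseudoAlmostHyperHermitianOn
  have hν := h.ne_zero
  have hh : ∀ x, IsQuaternionHermitian (E := E) (toHyperKahler ν g I J K φ x) (I x) (J x) (K x) :=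
    fun x => by
      rw [toHyperKahler_eq]
      exact (hA.isQuaternionHermitian (mem_univ x)).hkForm hν (hw x)
  have hw' : ∀ e ∈ IsManifold.maximalAtlas 𝓘(ℝ, E) ∞ M, ∀ y ∈ e.target ∩ e.symm ⁻¹' univ,
      formNormSq (g.inChart e y) (φ.inChart e y) + ν ≠ 0 := fun e he y hy => by
    rw [normSq_inChart hA he hy]; exact hw _
  have germ : ∀ e ∈ IsManifold.maximalAtlas 𝓘(ℝ, E) ∞ M, ∀ y ∈ e.target ∩ e.symm ⁻¹' univ,
      (toHyperKahler ν g I J K φ).inChart e =ᶠ[𝓝 y] fun y => hkForm ν (g.inChart e y)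
        (I.inChart e y) (J.inChart e y) (K.inChart e y) (φ.inChart e y) := fun e he y hy =>
    Filter.eventually_of_mem ((e.isOpen_inter_preimage_symm isOpen_univ).mem_nhds hy) fun z hz =>
      toHyperKahler_inChart hA he hz
  refine ⟨⟨?_, hA.almostHypercomplex, fun x _ => (hh x).orthI, fun x _ => (hh x).orthJ,
    fun x _ => (hh x).orthK⟩, ?_, ?_, ?_⟩
  · refine ⟨fun e he y hy => ?_, fun x _ => (hh x).symm, fun x _ => (hh x).nondeg⟩
    have hc := h.isClosedLeeOn hφ hcl he
    exact ((hc.herm.contDiffAt_hkForm hy ν (hc.contDiffAt hy)).congr_of_eventuallyEq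
      (germ e he y hy)).contDiffWithinAt
  · intro e he y hy u
    have hc := h.isClosedLeeOn hφ hcl he
    rw [covDerivEnd_congr (germ e he y hy)]
    ext v
    exact hc.covDerivEnd_hkForm hν (hw' e he) hy u v hc.conn hc.herm fun _ _ => rfl
  · intro e he y hy u
    have hc := h.isClosedLeeOn hφ hcl he
    rw [covDerivEnd_congr (germ e he y hy)]
    ext v
    exact hc.covDerivEnd_hkForm hν (hw' e he) hy u v hc.conn.cycle hc.herm.cycle
      fun _ _ => (quatShift_cycle _ _ _ _ _ _).symm
  · intro e he y hy u
    have hc := h.isClosedLeeOn hφ hcl he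
    rw [covDerivEnd_congr (germ e he y hy)]
    ext v
    exact hc.covDerivEnd_hkForm hν (hw' e he) hy u v hc.conn.cycle.cycle hc.herm.cycle.cycle
      fun _ _ => quatShift_cycle _ _ _ _ _ _

theorem isHyperKahlerPotentialOn_toPotential [IsManifold 𝓘(ℝ, E) ∞ M] :
    IsHyperKahlerPotentialOn univ (toHyperKahler ν g I J K φ) I J K (toPotential ν g φ) := by
  have hA := h.toIsPseudoAlmostHyperHermitianOn
  have hk := isPseudoHyperKahlerOn_toHyperKahler h hφ hcl hw
  have hkA := hk.toIsPseudoAlmostHyperHermitianOn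
  have hμ := contMDiffOn_toPotential h hφ hcl
  have hess : ∀ e ∈ IsManifold.maximalAtlas 𝓘(ℝ, E) ∞ M, ∀ y ∈ e.target ∩ e.symm ⁻¹' univ,
      ∀ u v, covDerivForm ((toHyperKahler ν g I J K φ).inChart e)
        (fderiv ℝ fun z => toPotential ν g φ (e.symm z)) y u v
        = (toHyperKahler ν g I J K φ).inChart e y u v := fun e he y hy u v => by
    have hV := (e.isOpen_inter_preimage_symm isOpen_univ).mem_nhds hy
    have g1 : (toHyperKahler ν g I J K φ).inChart e =ᶠ[𝓝 y] fun y => hkForm ν (g.inChart e y)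
        (I.inChart e y) (J.inChart e y) (K.inChart e y) (φ.inChart e y) :=
      Filter.eventually_of_mem hV fun z hz => toHyperKahler_inChart hA he hz
    have g2 : (fun z => toPotential ν g φ (e.symm z)) =ᶠ[𝓝 y]
        fun z => 2 / ν ^ 2 * (formNormSq (g.inChart e z) (φ.inChart e z) + ν) :=
      Filter.eventually_of_mem hV fun z hz => toPotential_inChart h he hz.1
    have hc := h.isClosedLeeOn hφ hcl he
    rw [covDerivForm_congr g1, toHyperKahler_inChart hA he hy, ← hc.hessian_potential h.ne_zero
      (fun z hz => by rw [normSq_inChart hA he hz]; exact hw _) hy, covDerivForm_apply,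
      covDerivForm_apply, g2.fderiv.fderiv_eq, g2.fderiv_eq]
  have key : ∀ A : EndField E M, SmoothInChartsOn univ (fun e => A.inChart e) →
      IsParallelOn univ (toHyperKahler ν g I J K φ) A →
      (∀ e ∈ IsManifold.maximalAtlas 𝓘(ℝ, E) ∞ M, ∀ y ∈ e.target ∩ e.symm ⁻¹' univ, ∀ u v,
        (toHyperKahler ν g I J K φ).inChart e y (A.inChart e y u) v =
          -(toHyperKahler ν g I J K φ).inChart e y u (A.inChart e y v)) →
      IsKahlerPotentialOn univ (toHyperKahler ν g I J K φ) A (toPotential ν g φ) := by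
    refine fun A hs hp hskew => ⟨hμ, fun e he y hy u v => ?_⟩
    rw [extDeriv_actOneForm_inChart hkA isOpen_univ hs hp hμ he hy, hess e he y hy, hess e he y hy,
      kahlerForm_inChart_apply he hy.1, ← neg_eq_iff_eq_neg.2 (hskew e he y hy u v),
      (hkA.isHermitianOn isOpen_univ he).symm y hy v]
    ring
  have hH := fun e he => hkA.isHermitianOn (e := e) isOpen_univ he
  have ha := hA.almostHypercomplex
  exact ⟨key I ha.smooth_I hk.parallel_I fun e he y hy => ((hH e he).herm y hy).skewI,
    key J ha.smooth_J hk.parallel_J fun e he y hy => ((hH e he).herm y hy).skewJ,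
    key K ha.smooth_K hk.parallel_K fun e he y hy => ((hH e he).herm y hy).skewK⟩

end

end PartOne

end QuaternionicGeometry

namespace QuaternionicGeometry

/-! ### From hyper-Kähler to quaternionic Kähler manifolds -/

section PartTwo

open scoped Topology

variable {E : Type*} [NormedAddCommGroup E] [NormedSpace ℝ E] [FiniteDimensional ℝ E]
  {M : Type*} [TopologicalSpace M] [ChartedSpace E M]
  {e : OpenPartialHomeomorph M E} {y : E}
  {g : BilinField E M} {I J K : EndField E M} {μ : M → ℝ} {p : ℝ} {n : ℕ}

section

variable (h : IsPseudoHyperKahlerOn univ g I J K) (hμ : IsHyperKahlerPotentialOn univ g I J K μ)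
include h hμ

/-- The Hessian of a hyper-Kähler potential is the metric. -/
theorem isHessianPotentialOn (he : e ∈ IsManifold.maximalAtlas 𝓘(ℝ, E) ∞ M) :
    IsHessianPotentialOn (e.target ∩ e.symm ⁻¹' univ) (g.inChart e) (I.inChart e) (J.inChart e)
      (K.inChart e) (fun z => μ (e.symm z)) := by
  have hA := h.toIsPseudoAlmostHyperHermitianOn
  have hH := hA.isHermitianOn isOpen_univ he
  have hs := contDiffOn_of_contMDiffOn he hμ.1.1
  refine ⟨hH, fun y hy u v => ?_, fun y hy u v => ?_, fun y hy u v => ?_, hs,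
    fun y hy u v => ?_⟩
  · rw [h.parallel_I e he y hy u]; rfl
  · rw [h.parallel_J e he y hy u]; rfl
  · rw [h.parallel_K e he y hy u]; rfl
  · have ha := hA.almostHypercomplex
    refine (hH.herm y hy).hessian_eq (fun u v => ?_) (fun u v => ?_) (fun u v => ?_)
      (fun u v => ?_) u v
    · rw [covDerivForm_apply, covDerivForm_apply, hH.christoffel_symm hy,
        fderiv_fderiv_symm (hs.contDiffAt (hH.isOpen.mem_nhds hy))]
    · rw [← extDeriv_actOneForm_inChart hA isOpen_univ ha.smooth_I h.parallel_I hμ.1.1 he hy,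
        hμ.1.2 e he y hy, kahlerForm_inChart_apply he hy.1]
    · rw [← extDeriv_actOneForm_inChart hA isOpen_univ ha.smooth_J h.parallel_J hμ.1.1 he hy,
        hμ.2.1.2 e he y hy, kahlerForm_inChart_apply he hy.1]
    · rw [← extDeriv_actOneForm_inChart hA isOpen_univ ha.smooth_K h.parallel_K hμ.1.1 he hy,
        hμ.2.2.2 e he y hy, kahlerForm_inChart_apply he hy.1]

omit [FiniteDimensional ℝ E] h in
theorem differential_potential_inChart (he : e ∈ IsManifold.maximalAtlas 𝓘(ℝ, E) ∞ M)
    (hy : y ∈ e.target) :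
    (differential μ : OneForm E M).inChart e y = fderiv ℝ (fun z => μ (e.symm z)) y :=
  differential_inChart he hy
    ((hμ.1.1.contMDiffAt Filter.univ_mem).mdifferentiableAt (by simp))

theorem denom_inChart (he : e ∈ IsManifold.maximalAtlas 𝓘(ℝ, E) ∞ M) (hy : y ∈ e.target) :
    denom p g μ (e.symm y) = denomForm p (g.inChart e) (fun z => μ (e.symm z)) y := by
  rw [denomForm, ← differential_potential_inChart hμ he hy,
    normSq_inChart h.toIsPseudoAlmostHyperHermitianOn he ⟨hy, mem_univ _⟩, denom]

theorem contMDiffOn_denom [IsManifold 𝓘(ℝ, E) ∞ M]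
    : ContMDiffOn 𝓘(ℝ, E) 𝓘(ℝ, ℝ) ∞ (denom p g μ) univ := by
  refine contMDiffOn_of_contDiffOn isOpen_univ fun e he y hy => ?_
  exact ((isHessianPotentialOn h hμ he).contDiffAt_denomForm hy).contDiffWithinAt.congr
    (fun z hz => denom_inChart h hμ he hz.1) (denom_inChart h hμ he hy.1)

theorem isOpen_domainSet [IsManifold 𝓘(ℝ, E) ∞ M] : IsOpen (domainSet p g μ) :=
  isOpen_ne_fun (contMDiffOn_univ.1 (contMDiffOn_denom h hμ)).continuous continuous_const

theorem isHessianPotentialOn_domain [IsManifold 𝓘(ℝ, E) ∞ M]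
    (he : e ∈ IsManifold.maximalAtlas 𝓘(ℝ, E) ∞ M) :
    IsHessianPotentialOn (e.target ∩ e.symm ⁻¹' domainSet p g μ) (g.inChart e) (I.inChart e)
      (J.inChart e) (K.inChart e) (fun z => μ (e.symm z)) :=
  (isHessianPotentialOn h hμ he).mono
    (e.isOpen_inter_preimage_symm (isOpen_domainSet h hμ)) fun _ hy => ⟨hy.1, mem_univ _⟩

theorem denomForm_ne_zero (he : e ∈ IsManifold.maximalAtlas 𝓘(ℝ, E) ∞ M)
    (hy : y ∈ e.target ∩ e.symm ⁻¹' domainSet p g μ) :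
    denomForm p (g.inChart e) (fun z => μ (e.symm z)) y ≠ 0 := by
  rw [← denom_inChart h hμ he hy.1]; exact hy.2

theorem toHHqK_inChart_eq (he : e ∈ IsManifold.maximalAtlas 𝓘(ℝ, E) ∞ M) (hy : y ∈ e.target) :
    (toHHqK p g I J K μ).inChart e y =
      qkMetric p (g.inChart e) (I.inChart e) (J.inChart e) (K.inChart e)
        (fun z => μ (e.symm z)) y := by
  rw [toHHqK_inChart h.toIsPseudoAlmostHyperHermitianOn he ⟨hy, mem_univ _⟩,
    differential_potential_inChart hμ he hy, qkMetric]

theorem toHHqK_germ (he : e ∈ IsManifold.maximalAtlas 𝓘(ℝ, E) ∞ M) (hy : y ∈ e.target) :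
    (toHHqK p g I J K μ).inChart e =ᶠ[𝓝 y]
      qkMetric p (g.inChart e) (I.inChart e) (J.inChart e) (K.inChart e)
        (fun z => μ (e.symm z)) :=
  Filter.eventually_of_mem (e.open_target.mem_nhds hy) fun _ hz => toHHqK_inChart_eq h hμ he hz

/-- `φ_p = -2p (p g₀(dμ,dμ) + 1)⁻¹ dμ`, since `p g₀(dμ,dμ) + 1` has differential `2p dμ`. -/
theorem toLeeForm_inChart [IsManifold 𝓘(ℝ, E) ∞ M] (he : e ∈ IsManifold.maximalAtlas 𝓘(ℝ, E) ∞ M)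
    (hy : y ∈ e.target ∩ e.symm ⁻¹' domainSet p g μ) :
    (toLeeForm p g μ : OneForm E M).inChart e y =
      qkLeeForm p (g.inChart e) (fun z => μ (e.symm z)) y := by
  have hd := denomForm_ne_zero h hμ he hy
  have hP := isHessianPotentialOn_domain (p := p) h hμ he
  have dN := differentiableAt_of_smooth (hP.contDiffAt_denomForm (p := p) hy)
  have hM : MDifferentiableAt 𝓘(ℝ, E) 𝓘(ℝ, ℝ) (fun z => Real.log |denom p g μ z|) (e.symm y) := by
    simp only [Real.log_abs]
    have h1 : MDifferentiableAt 𝓘(ℝ, E) 𝓘(ℝ, ℝ) (denom p g μ) (e.symm y) :=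
      ((contMDiffOn_denom h hμ).contMDiffAt Filter.univ_mem).mdifferentiableAt (by simp)
    exact ((Real.differentiableAt_log hy.2).mdifferentiableAt).comp (e.symm y) h1
  have h1 : (toLeeForm p g μ : OneForm E M).inChart e y =
      -((differential (fun z => Real.log |denom p g μ z|) : OneForm E M).inChart e y) := rfl
  have germ : (fun z => Real.log |denom p g μ (e.symm z)|) =ᶠ[𝓝 y]
      fun z => Real.log (denomForm p (g.inChart e) (fun z => μ (e.symm z)) z) := by
    filter_upwards [e.open_target.mem_nhds hy.1] with z hz
    rw [Real.log_abs, denom_inChart h hμ he hz]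
  rw [h1, differential_inChart he hy.1 hM, germ.fderiv_eq, fderiv.log dN hd]
  ext u
  simp only [neg_apply, smul_apply, hP.fderiv_denomForm hy, qkLeeForm, smul_eq_mul]
  ring

theorem toLeeForm_eq [IsManifold 𝓘(ℝ, E) ∞ M] {x : M} (hx : x ∈ domainSet p g μ) :
    (toLeeForm p g μ : OneForm E M) x =
      (-(2 * p / (p * normSq g (differential μ) x + 1))) • differential μ x := by
  obtain ⟨e, he, y, hy, rfl⟩ := exists_chart (E := E) x
  refine OneForm.eq_of_inChart he hy
    (β := fun x => (-(2 * p / (p * normSq g (differential μ) x + 1))) • differential μ x) ?_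
  rw [toLeeForm_inChart h hμ he ⟨hy, hx⟩, qkLeeForm, ← denom_inChart h hμ he hy,
    ← differential_potential_inChart hμ he hy, denom]
  rfl

omit hμ in
theorem isQuaternionHermitian_toHHqK {x : M} (hx : x ∈ domainSet p g μ) :
    IsQuaternionHermitian (E := E) (toHHqK p g I J K μ x) (I x) (J x) (K x) := by
  rw [toHHqK_eq]
  exact (h.toIsPseudoAlmostHyperHermitianOn.isQuaternionHermitian (mem_univ x)).qkForm hx

theorem isPseudoAlmostHyperHermitianOn_toHHqK [IsManifold 𝓘(ℝ, E) ∞ M] :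
    IsPseudoAlmostHyperHermitianOn (domainSet p g μ) (toHHqK p g I J K μ) I J K := by
  have hh := fun x (hx : x ∈ domainSet p g μ) => isQuaternionHermitian_toHHqK h hx
  have ha := h.almostHypercomplex
  have mono : ∀ e : OpenPartialHomeomorph M E, e.target ∩ e.symm ⁻¹' domainSet p g μ ⊆
    e.target ∩ e.symm ⁻¹' univ := fun e y hy => ⟨hy.1, mem_univ _⟩
  refine ⟨⟨fun e he y hy => ?_, fun x hx => (hh x hx).symm, fun x hx => (hh x hx).nondeg⟩,
    ⟨fun e he => (ha.smooth_I e he).mono (mono e), fun e he => (ha.smooth_J e he).mono (mono e),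
      fun e he => (ha.smooth_K e he).mono (mono e), fun x _ => ha.sq_I x (mem_univ x),
      fun x _ => ha.sq_J x (mem_univ x), fun x _ => ha.sq_K x (mem_univ x),
      fun x _ => ha.mul_IJK x (mem_univ x)⟩,
    fun x hx => (hh x hx).orthI, fun x hx => (hh x hx).orthJ, fun x hx => (hh x hx).orthK⟩
  have hP := isHessianPotentialOn_domain (p := p) h hμ he
  exact ((hP.contDiffAt_qkMetric hy (denomForm_ne_zero h hμ he hy)).congr_of_eventuallyEq
    (toHHqK_germ h hμ he hy.1)).contDiffWithinAt

theorem isLeeFormOn_toHHqK [IsManifold 𝓘(ℝ, E) ∞ M] :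
    IsLeeFormOn (domainSet p g μ) (toHHqK p g I J K μ) I (toLeeForm p g μ) ∧
    IsLeeFormOn (domainSet p g μ) (toHHqK p g I J K μ) J (toLeeForm p g μ) ∧
    IsLeeFormOn (domainSet p g μ) (toHHqK p g I J K μ) K (toLeeForm p g μ) := by
  have conn : ∀ e ∈ IsManifold.maximalAtlas 𝓘(ℝ, E) ∞ M, _ := fun e he =>
    (isHessianPotentialOn_domain (p := p) h hμ he).isLeeConnectionOn_qkMetric
      fun y hy => denomForm_ne_zero h hμ he hy
  have herm : ∀ e ∈ IsManifold.maximalAtlas 𝓘(ℝ, E) ∞ M, _ := fun e he =>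
    (isHessianPotentialOn_domain (p := p) h hμ he).isHermitianOn_qkMetric
      fun y hy => denomForm_ne_zero h hμ he hy
  refine ⟨fun e he y hy v => ?_, fun e he y hy v => ?_, fun e he y hy v => ?_⟩
  · rw [leeForm_congr (toHHqK_germ h hμ he hy.1), toLeeForm_inChart h hμ he hy]
    exact ((conn e he).leeForm_eq (herm e he) hy v).symm
  · rw [leeForm_congr (toHHqK_germ h hμ he hy.1), toLeeForm_inChart h hμ he hy]
    exact ((conn e he).cycle.leeForm_eq (herm e he).cycle hy v).symm
  · rw [leeForm_congr (toHHqK_germ h hμ he hy.1), toLeeForm_inChart h hμ he hy]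
    exact ((conn e he).cycle.cycle.leeForm_eq (herm e he).cycle.cycle hy v).symm

theorem isPseudoHHqKOn_toHHqK [IsManifold 𝓘(ℝ, E) ∞ M]
    (hn : 1 < n) (hdim : Module.finrank ℝ E = 4 * n) (hp : p ≠ 0) :
    IsPseudoHHqKOn n (domainSet p g μ) (toHHqK p g I J K μ) I J K (4 * p) := by
  have hA := isPseudoAlmostHyperHermitianOn_toHHqK (p := p) h hμ
  have hH := h.toIsPseudoAlmostHyperHermitianOn
  have nij : ∀ A : EndField E M, IsParallelOn univ g A → IsIntegrableOn (domainSet p g μ) A := by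
    intro A hp e he y hy u v
    have hy' : y ∈ e.target ∩ e.symm ⁻¹' univ := ⟨hy.1, mem_univ _⟩
    rw [nijenhuis_eq (hH.isHermitianOn isOpen_univ he).toIsMetricOn hy']
    simp [hp e he y hy']
  refine ⟨hA, hn, hdim, ⟨hA.almostHypercomplex, nij I h.parallel_I, nij J h.parallel_J,
    nij K h.parallel_K⟩, ?_, ?_, mul_ne_zero four_ne_zero hp⟩
  · intro e he y hy A hAm u
    have conn := (isHessianPotentialOn_domain (p := p) h hμ he).isLeeConnectionOn_qkMetric
      fun y hy => denomForm_ne_zero h hμ he hy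
    have mI : I.inChart e y ∈
        Submodule.span ℝ {I.inChart e y, J.inChart e y, K.inChart e y} :=
      Submodule.subset_span (by simp)
    have mJ : J.inChart e y ∈
        Submodule.span ℝ {I.inChart e y, J.inChart e y, K.inChart e y} :=
      Submodule.subset_span (by simp)
    have mK : K.inChart e y ∈
        Submodule.span ℝ {I.inChart e y, J.inChart e y, K.inChart e y} :=
      Submodule.subset_span (by simp)
    rw [covDerivEnd_congr (toHHqK_germ h hμ he hy.1)]
    have mem : ∀ {L B C : E →L[ℝ] E} {b c : ℝ},
        B ∈ Submodule.span ℝ {I.inChart e y, J.inChart e y, K.inChart e y} →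
        C ∈ Submodule.span ℝ {I.inChart e y, J.inChart e y, K.inChart e y} →
        (∀ w, L w = b • B w - c • C w) →
        L ∈ Submodule.span ℝ {I.inChart e y, J.inChart e y, K.inChart e y} := by
      intro L B C b c hB hC hL
      have : L = b • B - c • C := ContinuousLinearMap.ext hL
      rw [this]
      exact Submodule.sub_mem _ (Submodule.smul_mem _ _ hB) (Submodule.smul_mem _ _ hC)
    rcases hAm with rfl | rfl | rfl
    · exact mem mK mJ (conn.covI y hy u)
    · exact mem mI mK (conn.covJ y hy u)
    · exact mem mJ mI (conn.covK y hy u)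
  · intro e he y hy
    have hd := fun y hy => denomForm_ne_zero (p := p) (y := y) h hμ he hy
    have hP := isHessianPotentialOn_domain (p := p) h hμ he
    rw [scalarCurvature_congr (toHHqK_germ h hμ he hy.1)]
    refine scalarCurvature_of_leeCurv hdim (hP.isLeeConnectionOn_qkMetric hd)
      (hP.isHermitianOn_qkMetric hd) hy
      (differentiableAt_of_smooth (hP.contDiffAt_qkLeeForm hy (hd y hy)))
      (hP.leeCurv_qkMetric hd hy) (fun u v => ?_) (fun u v => ?_)
    · rw [← IsHessianPotentialOn.qkMetric_cycle]
      exact hP.cycle.leeCurv_qkMetric hd hy u v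
    · rw [← IsHessianPotentialOn.qkMetric_cycle, ← IsHessianPotentialOn.qkMetric_cycle]
      exact hP.cycle.cycle.leeCurv_qkMetric hd hy u v

end

end PartTwo

end QuaternionicGeometry

end

open QuaternionicGeometry in
theorem theorem2 (n : ℕ) (hn : 1 < n)
    {M : Type*} [TopologicalSpace M] [ChartedSpace (EuclideanSpace ℝ (Fin (4 * n))) M]
    [IsManifold 𝓘(ℝ, EuclideanSpace ℝ (Fin (4 * n))) ∞ M]
    (I J K : EndField (EuclideanSpace ℝ (Fin (4 * n))) M) :
    -- Part (i), and the first half of part (iii).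
    (∀ (g : BilinField (EuclideanSpace ℝ (Fin (4 * n))) M)
        (φ : OneForm (EuclideanSpace ℝ (Fin (4 * n))) M) (ν : ℝ),
      IsHHqKOn n univ g I J K ν →
      IsLeeFormOn univ g I φ →
      IsClosedFormOn univ φ →
      (∀ x, normSq g φ x + ν ≠ 0) →
      IsPseudoHyperKahlerOn univ (toHyperKahler ν g I J K φ) I J K ∧
      IsHyperKahlerPotentialOn univ (toHyperKahler ν g I J K φ) I J K (toPotential ν g φ) ∧
      (∀ x, 0 < ν * (normSq g φ x + ν) → PosDefAt (toHyperKahler ν g I J K φ) x) ∧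
      (0 < ν → ∀ x, PosDefAt (toHyperKahler ν g I J K φ) x) ∧
      (∀ x, ν * (normSq g φ x + ν) < 0 →
        HasSignatureAt (toHyperKahler ν g I J K φ) x 4 (4 * (n - 1)) ∧
        PosDefAtOn (toHyperKahler ν g I J K φ) x (quaternionicSpan I J K x (sharp g φ x))) ∧
      (∀ x, denom (ν / 4) (toHyperKahler ν g I J K φ) (toPotential ν g φ) x ≠ 0 ∧
        toHHqK (ν / 4) (toHyperKahler ν g I J K φ) I J K (toPotential ν g φ) x = g x)) ∧
    -- Part (ii), and the second half of part (iii).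
    (∀ (g₀ : BilinField (EuclideanSpace ℝ (Fin (4 * n))) M) (μ : M → ℝ),
      IsPseudoHyperKahlerOn univ g₀ I J K →
      IsHyperKahlerPotentialOn univ g₀ I J K μ →
      ∀ p : ℝ, p ≠ 0 →
      IsOpen (domainSet p g₀ μ) ∧
      IsPseudoHHqKOn n (domainSet p g₀ μ) (toHHqK p g₀ I J K μ) I J K (4 * p) ∧
      IsLeeFormOn (domainSet p g₀ μ) (toHHqK p g₀ I J K μ) I (toLeeForm p g₀ μ) ∧
      IsLeeFormOn (domainSet p g₀ μ) (toHHqK p g₀ I J K μ) J (toLeeForm p g₀ μ) ∧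
      IsLeeFormOn (domainSet p g₀ μ) (toHHqK p g₀ I J K μ) K (toLeeForm p g₀ μ) ∧
      (∀ x, 0 < denom p g₀ μ x → PosDefAt g₀ x → PosDefAt (toHHqK p g₀ I J K μ) x) ∧
      (∀ x, denom p g₀ μ x < 0 → HasSignatureAt g₀ x 4 (4 * (n - 1)) →
        PosDefAtOn g₀ x (quaternionicSpan I J K x (sharp g₀ (differential μ) x)) →
        PosDefAt (toHHqK p g₀ I J K μ) x) ∧
      (∀ x ∈ domainSet p g₀ μ,
        normSq (toHHqK p g₀ I J K μ) (toLeeForm p g₀ μ) x + 4 * p ≠ 0 ∧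
        toHyperKahler (4 * p) (toHHqK p g₀ I J K μ) I J K (toLeeForm p g₀ μ) x = g₀ x)) := by
  refine ⟨fun g φ ν h hφ hcl hw => ?_, fun g₀ μ h hμ p hp => ?_⟩
  · have hq := fun x => h.toIsPseudoAlmostHyperHermitianOn.isQuaternionHermitian (mem_univ x)
    have hpos := fun x => h.posDef x (mem_univ x)
    have posDef : ∀ x, 0 < ν * (normSq g φ x + ν) → PosDefAt (toHyperKahler ν g I J K φ) x := by
      intro x hx u hu
      rw [toHyperKahler_eq]
      exact (hq x).hkForm_posDef (hpos x) hx u hu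
    refine ⟨isPseudoHyperKahlerOn_toHyperKahler h hφ hcl hw,
      isHyperKahlerPotentialOn_toPotential h hφ hcl hw, posDef, fun hν x => posDef x ?_,
      fun x hx => ⟨?_, fun u hu hu0 => ?_⟩, fun x => ?_⟩
    · have h0 : 0 ≤ normSq g φ x :=
        IsQuaternionHermitian.formNormSq_nonneg (E := EuclideanSpace ℝ (Fin (4 * n))) (hq x)
          (hpos x)
      exact mul_pos hν (add_pos_of_nonneg_of_pos h0 hν)
    · rw [HasSignatureAt, toHyperKahler_eq]
      exact IsQuaternionHermitian.hkForm_signature (E := EuclideanSpace ℝ (Fin (4 * n)))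
        h.finrank_eq (hq x) (hpos x) hx
    · rw [toHyperKahler_eq]
      exact (hq x).hkForm_pos_span (hpos x) hx hu hu0
    · have key := qkForm_hkForm (E := EuclideanSpace ℝ (Fin (4 * n))) (hq x)
        h.ne_zero (hw x) (differential_toPotential h hφ hcl x)
      rw [toHHqK_eq, denom, normSq, sharp, toHyperKahler_eq]
      exact key
  · have hq := fun x => h.toIsPseudoAlmostHyperHermitianOn.isQuaternionHermitian (mem_univ x)
    have hdim : Module.finrank ℝ (EuclideanSpace ℝ (Fin (4 * n))) = 4 * n := by simp
    obtain ⟨leeI, leeJ, leeK⟩ := isLeeFormOn_toHHqK (p := p) h hμ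
    refine ⟨isOpen_domainSet h hμ, isPseudoHHqKOn_toHHqK h hμ hn hdim hp, leeI, leeJ, leeK,
      fun x hx hpos u hu => ?_, fun x hx hsig hspan u hu => ?_, fun x hx => ?_⟩
    · rw [toHHqK_eq]
      exact (hq x).qkForm_posDef hpos hx u hu
    · rw [toHHqK_eq]
      exact IsQuaternionHermitian.qkForm_posDef_of_signature (E := EuclideanSpace ℝ (Fin (4 * n)))
        hn hdim (hq x) hx hsig.2 hspan u hu
    · have key := hkForm_qkForm (E := EuclideanSpace ℝ (Fin (4 * n))) (hq x) hp hx
        (toLeeForm_eq h hμ hx)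
      rw [toHyperKahler_eq, normSq, sharp, toHHqK_eq]
      exact key
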